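/- Let $L,B,K_d,\zeta,\eta,\rho_o,S_{eff},V_{eff}>0$ be constants, and put $$\mathcal P(N,l)=\frac{\eta\rho_o V_{eff}N(L-l)}{B\rho_o+K_d(L-l)},\qquad \mathcal F(l,N,f)=\frac{\frac{K_d}{\eta}\mathcal P(N,l)-\rho_oV_{eff}Nf}{\rho_oS_{eff}(1-f)} .$$ Let $(l_e,N_e,f_{p_e})$ be an equilibrium: $l_e\in(0,L)$, $N_e>0$, $f_{p_e}\in(0,1)$ and $\mathcal F(l_e,N_e,f_{p_e})=0$; put $\Delta P_e=\mathcal P(N_e,l_e)$, $F_{in_e}=\rho_oV_{eff}N_ef_{p_e}$ and $b_2=\frac{\partial\mathcal P}{\partial N}(N_e,l_e)$. Let $k_1,k_2\in\mathbb R$ be fixed with $1-k_1b_2\neq0$. For $T\in(0,\infty]$ consider the closed-loop system on $[0,T)$ $$\begin{cases}\dot l(t)=\mathcal F(l(t),N(t),f_p(t,1)),& t\in(0,T),\\ \partial_tf_p(t,x)+\alpha_p(t,x)\,\partial_xf_p(t,x)=0,& (t,x)\in(0,T)\times(0,1),\\ f_p(t,0)=\dfrac{F_{in}(t)}{\rho_oV_{eff}N(t)},&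 t\in(0,T),\\ l(0)=l^0,\quad f_p(0,x)=f_p^0(x),& x\in(0,1),\end{cases}$$ where $\alpha_p(t,x)=\dfrac{\zeta N(t)-x\,\mathcal F(l(t),N(t),f_p(t,1))}{l(t)}$ and, for $t\in[0,T)$, the controls satisfy the feedback law $$N(t)-N_e=k_1(\Delta P(t)-\Delta P_e),\quad F_{in}(t)-F_{in_e}=k_2(\Delta P(t)-\Delta P_e),\quad \Delta P(t)=\mathcal P(N(t),l(t)).$$ A solution on $[0,T)$ is a pair $(l,f_p)\in W^{1,\infty}([0,T))\times C^0([0,T);H^2(0,1))$ for which none of the denominators above vanishes on $[0,T)$ and which satisfies the system, the two differential equations in the sense of distributions. Then there exists $\varepsilon>0$ such that the following holds for all $l^0\in\mathbb R$ and $f_p^0\in H^2(0,1)$ with $$|l^0-l_e|^2+\|f_p^0-f_{p_e}\|_{H^2(0,1)}^2\le\varepsilon$$ that satisfy the compatibility conditions at $(t,x)=(0,0)$ $$f_p^0(0)=\frac{F_{in}(0)}{\rho_oV_{eff}N(0)},\qquad \frac{\dot F_{in}(0)N(0)-F_{in}(0)\dot N(0)}{\rho_oV_{eff}N(0)^2}+\frac{\zeta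 N(0)}{l^0}\,(f_p^{0})'(0)=0,$$ where $N(0),F_{in}(0)$ are determined by the feedback law with $l(0)=l^0$, and $\dot N(0),\dot F_{in}(0)$ by the relations obtained by differentiating the feedback law in time, with $\dot l(0)=\mathcal F(l^0,N(0),f_p^0(1))$. (i) There are $T\in(0,\infty]$ and a solution $(l,f_p)$ on $[0,T)$ that is unique, in the sense that every solution on $[0,T')$ with $0<T'\le T$ coincides with it on $[0,T')$; and if $|l(t)-l_e|^2+\|f_p(t,\cdot)-f_{p_e}\|_{H^2(0,1)}^2\le\varepsilon$ for all $t\in[0,T)$, then $T=\infty$. (ii) More generally, every solution on an interval $[0,T)$, $T\in(0,\infty]$, which satisfies $|l(t)-l_e|^2+\|f_p(t,\cdot)-f_{p_e}\|_{H^2(0,1)}^2\le\varepsilon$ for all $t\in[0,T)$ either has $T=\infty$ or extends to a solution on $[0,T')$ for some $T'>T$. -/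

import Mathlib

open Set Filter Topology MeasureTheory
open scoped ContDiff

noncomputable section

namespace Extruder

/-! ### Sobolev spaces on intervals -/

/-- `v` is the weak derivative of `u` on the open set `U ⊆ ℝ`. -/
def HasWeakDerivOn (U : Set ℝ) (u v : ℝ → ℝ) : Prop :=
  LocallyIntegrableOn u U ∧ LocallyIntegrableOn v U ∧
    ∀ φ : ℝ → ℝ, ContDiff ℝ ∞ φ → HasCompactSupport φ → tsupport φ ⊆ U →
      ∫ x in U, u x * deriv φ x = -∫ x in U, v x * φ x

/-- `u ∈ W^{1,∞}(U)`. -/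
def MemW1Infty (U : Set ℝ) (u : ℝ → ℝ) : Prop :=
  ∃ v : ℝ → ℝ, MemLp u ⊤ (volume.restrict U) ∧ MemLp v ⊤ (volume.restrict U) ∧
    HasWeakDerivOn U u v

/-- `u ∈ H²(0,1)`, where `u` is the continuous representative on `[0,1]` of its class
(every class in `H²(0,1)` has exactly one), so that the values of `u` at `0` and `1` are traces. -/
def MemH2 (u : ℝ → ℝ) : Prop :=
  ContinuousOn u (Icc 0 1) ∧
    ∃ v w : ℝ → ℝ,
      MemLp u 2 (volume.restrict (Ioo 0 1)) ∧
      MemLp v 2 (volume.restrict (Ioo 0 1)) ∧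
      MemLp w 2 (volume.restrict (Ioo 0 1)) ∧
      HasWeakDerivOn (Ioo 0 1) u v ∧ HasWeakDerivOn (Ioo 0 1) v w

open Classical in
/-- A representative of the weak derivative of `u` on `(0,1)` (and `0` if there is none). -/
def weakDeriv (u : ℝ → ℝ) : ℝ → ℝ :=
  if h : ∃ v, HasWeakDerivOn (Ioo 0 1) u v then h.choose else 0

/-- The squared norm `‖u‖²` of `H²(0,1)`. -/
def h2NormSq (u : ℝ → ℝ) : ℝ :=
  (∫ x in Ioo (0 : ℝ) 1, u x ^ 2) + (∫ x in Ioo (0 : ℝ) 1, weakDeriv u x ^ 2) +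
    ∫ x in Ioo (0 : ℝ) 1, weakDeriv (weakDeriv u) x ^ 2

/-! ### Time intervals `[0,T)` and `(0,T)` with `T ∈ (0,∞]` -/

/-- The interval `[0,T)`. -/
def timeIco (T : EReal) : Set ℝ := {t | 0 ≤ t ∧ (t : EReal) < T}

/-- The interval `(0,T)`. -/
def timeIoo (T : EReal) : Set ℝ := {t | 0 < t ∧ (t : EReal) < T}

/-- `f ∈ C⁰([0,T); H²(0,1))`. -/
def ContinuousInH2 (T : EReal) (f : ℝ → ℝ → ℝ) : Prop :=
  (∀ t ∈ timeIco T, MemH2 (f t)) ∧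
    ∀ t ∈ timeIco T,
      Tendsto (fun s => h2NormSq (fun x => f s x - f t x)) (𝓝[timeIco T] t) (𝓝 0)

/-! ### The model -/

/-- The physical parameters of the extruder. -/
structure Params where
  /-- length of the extruder -/
  L : ℝ
  /-- geometric parameter -/
  B : ℝ
  /-- die conductance -/
  Kd : ℝ
  /-- screw pitch -/
  ζ : ℝ
  /-- viscosity -/
  η : ℝ
  /-- melt density -/
  ρ : ℝ
  /-- effective section -/
  Seff : ℝ
  /-- effective volume -/
  Veff : ℝ
  L_pos : 0 < L
  B_pos : 0 < B
  Kd_pos : 0 < Kd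
  ζ_pos : 0 < ζ
  η_pos : 0 < η
  ρ_pos : 0 < ρ
  Seff_pos : 0 < Seff
  Veff_pos : 0 < Veff

namespace Params

variable (p : Params)

/-- The pressure difference `𝒫(N,l)`. -/
def pressure (N l : ℝ) : ℝ :=
  p.η * p.ρ * p.Veff * N * (p.L - l) / (p.B * p.ρ + p.Kd * (p.L - l))

/-- The interface velocity `ℱ(l,N,f)`, where `f` is the filling ratio at `x = 1`. -/
def interfaceVelocity (l N f : ℝ) : ℝ :=
  (p.Kd / p.η * p.pressure N l - p.ρ * p.Veff * N * f) / (p.ρ * p.Seff * (1 - f))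

/-- The transport speed `α_p` at the point `x`, where `f` is the filling ratio at `x = 1`. -/
def transportSpeed (l N f x : ℝ) : ℝ :=
  (p.ζ * N - x * p.interfaceVelocity l N f) / l

end Params

/-- A constant equilibrium `(l_e, N_e, f_{p_e})`. -/
structure Equilibrium (p : Params) where
  le : ℝ
  Ne : ℝ
  fe : ℝ
  le_mem : le ∈ Ioo 0 p.L
  Ne_pos : 0 < Ne
  fe_mem : fe ∈ Ioo 0 1
  stationary : p.interfaceVelocity le Ne fe = 0

namespace Equilibrium

variable {p : Params} (e : Equilibrium p)

/-- The equilibrium pressure difference `ΔP_e`. -/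
def pressure : ℝ := p.pressure e.Ne e.le

/-- The equilibrium inlet flow rate `F_{in_e}`. -/
def inflow : ℝ := p.ρ * p.Veff * e.Ne * e.fe

/-- The constant `b₂ = ∂𝒫/∂N` at the equilibrium. -/
def b₂ : ℝ := deriv (fun N => p.pressure N e.le) e.Ne

/-- The linear feedback law, for the values `N`, `Fin` of the controls and `l` of the interface
at one instant: `N - N_e = k₁ (ΔP - ΔP_e)` and `F_in - F_{in_e} = k₂ (ΔP - ΔP_e)`. -/
def Feedback (k₁ k₂ l N Fin : ℝ) : Prop :=
  N - e.Ne = k₁ * (p.pressure N l - e.pressure) ∧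
    Fin - e.inflow = k₂ * (p.pressure N l - e.pressure)

/-- The compatibility conditions at `(t,x) = (0,0)`. Here `N`, `Fin` are `N(0)`, `F_in(0)`, and
`dl`, `dP`, `dN`, `dFin` are the time derivatives at `0` of `l`, `ΔP`, `N`, `F_in`. -/
def Compatible (k₁ k₂ l₀ : ℝ) (f₀ : ℝ → ℝ) : Prop :=
  ∃ N Fin dl dP dN dFin : ℝ,
    e.Feedback k₁ k₂ l₀ N Fin ∧
    dl = p.interfaceVelocity l₀ N (f₀ 1) ∧
    dP = deriv (fun l => p.pressure N l) l₀ * dl + deriv (fun M => p.pressure M l₀) N * dN ∧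
    dN = k₁ * dP ∧
    dFin = k₂ * dP ∧
    f₀ 0 = Fin / (p.ρ * p.Veff * N) ∧
    (dFin * N - Fin * dN) / (p.ρ * p.Veff * N ^ 2)
      + p.ζ * N / l₀ * derivWithin f₀ (Icc 0 1) 0 = 0

/-- `(l, f)` is a solution on `[0,T)`, in the class `W^{1,∞}([0,T)) × C⁰([0,T); H²(0,1))`, of the
closed-loop system with initial data `(l₀, f₀)`; `N` and `Fin` are the controls. The functions `l`
and `f t` are the continuous representatives; the two evolution equations hold in the sense of
distributions on `(0,T)` and `(0,T) × (0,1)`, the initial and boundary conditions pointwise. -/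
structure IsSolutionWith (k₁ k₂ l₀ : ℝ) (f₀ : ℝ → ℝ) (T : EReal)
    (l : ℝ → ℝ) (f : ℝ → ℝ → ℝ) (N Fin : ℝ → ℝ) : Prop where
  l_continuous : ContinuousOn l (timeIco T)
  l_mem : MemW1Infty (timeIoo T) l
  f_mem : ContinuousInH2 T f
  /-- none of the denominators in the equations vanishes -/
  nondegenerate : ∀ t ∈ timeIco T,
    l t ≠ 0 ∧ N t ≠ 0 ∧ f t 1 ≠ 1 ∧ p.B * p.ρ + p.Kd * (p.L - l t) ≠ 0
  feedback : ∀ t ∈ timeIco T, e.Feedback k₁ k₂ (l t) (N t) (Fin t)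
  /-- `l' = ℱ(l, N, f(·,1))` -/
  interface_eq :
    HasWeakDerivOn (timeIoo T) l (fun t => p.interfaceVelocity (l t) (N t) (f t 1))
  /-- `∂ₜ f + α_p ∂ₓ f = 0` -/
  transport_eq : ∀ φ : ℝ × ℝ → ℝ, ContDiff ℝ ∞ φ → HasCompactSupport φ →
    tsupport φ ⊆ timeIoo T ×ˢ Ioo 0 1 →
    ∫ z in timeIoo T ×ˢ Ioo (0 : ℝ) 1,
      f z.1 z.2 * (deriv (fun s => φ (s, z.2)) z.1 +
        deriv (fun y => p.transportSpeed (l z.1) (N z.1) (f z.1 1) y * φ (z.1, y)) z.2) = 0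
  l_initial : l 0 = l₀
  f_initial : ∀ x ∈ Icc (0 : ℝ) 1, f 0 x = f₀ x
  f_boundary : ∀ t ∈ timeIoo T, f t 0 = Fin t / (p.ρ * p.Veff * N t)

/-- `(l, f)` is a solution of the closed-loop system on `[0,T)`. -/
def IsSolution (k₁ k₂ l₀ : ℝ) (f₀ : ℝ → ℝ) (T : EReal) (l : ℝ → ℝ) (f : ℝ → ℝ → ℝ) : Prop :=
  ∃ N Fin : ℝ → ℝ, e.IsSolutionWith k₁ k₂ l₀ f₀ T l f N Fin

/-- `|l - l_e|² + ‖f - f_{p_e}‖²_{H²(0,1)}`. -/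
def distSq (l : ℝ) (f : ℝ → ℝ) : ℝ :=
  |l - e.le| ^ 2 + h2NormSq (fun x => f x - e.fe)

end Equilibrium

/-- `(l, f)` and `(l', f')` coincide on `[0,T)`. -/
def AgreeOn (T : EReal) (l : ℝ → ℝ) (f : ℝ → ℝ → ℝ) (l' : ℝ → ℝ) (f' : ℝ → ℝ → ℝ) : Prop :=
  ∀ t ∈ timeIco T, l t = l' t ∧ ∀ x ∈ Icc (0 : ℝ) 1, f t x = f' t x

end Extruder

end

noncomputable section

namespace Extruder

/-! ### Weak derivatives on intervals -/

/-! The pressure is `N * gain l`, so the feedback law is linear in the controls. It forces 1 - k₁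
gain(l) ≠ 0 and determines N and F_in as C² functions of l alone (`Feedback.one_sub_ne_zero`,
`Feedback.eq_screw`). What remains is an autonomous `InterfaceSystem`: l' = F(l, f(·,1)), transport
of f with speed (n(l) - x l')/l, and f(·,0) = β(l).

In the coordinate l x every characteristic moves with the common velocity n(l). With Z' = n(l) and
Z(0) = 0, the quantity l(t)x - Z(t) is therefore constant along characteristics, and f(t,x) =
Φ(l(t)x - Z(t)). The profile Φ is the rescaled initial datum on [0,l₀] and the boundary input β(l)
on the negative side. As long as l ≥ Z, the value f(t,1) is read off the initial datum, so (l,Z)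
solves a closed ODE, which is Lipschitz because H² functions are.

Existence (`exists_local`): solve this ODE and glue the two branches of Φ. The two compatibility
conditions are exactly the continuity of Φ and Φ' at 0, so Φ is H² (`exists_isProfile`); continuity
in time with values in H² is the L²-continuity of dilations and translations
(`tendsto_integral_sq_affine`). The lifespan depends only on sup bounds near the equilibrium, not on
the Lipschitz constant of f₀.

Uniqueness (`eq_of_good`): every classical solution has this representation for a short time, so
uniqueness for the ODE propagates. Distributional solutions in the given class are classical
(`isClassical`), because f and ∂ₓf are jointly continuous; the converse, under bounds on l and l',
is `isSolution_of_isClassical`.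

Continuation (`UniformlySolvable.extend`): the H² ball controls sup norms, and differentiating the
boundary condition shows that compatibility persists at positive times. A solution in the ball can
thus be restarted shortly before T and gains a fixed time τ/2. This gives (ii). For (i), either all
regular solutions stay in the ball, and iteration makes one global, or some solution leaves it; its
own interval then serves as [0,T), and the last claim of (i) has a false premise. -/

lemma exists_Ioo_of_isCompact {U K : Set ℝ} (hU : IsOpen U) [hc : U.OrdConnected]
    (hne : U.Nonempty) (hK : IsCompact K) (hKU : K ⊆ U) :
    ∃ a b, a ∈ U ∧ b ∈ U ∧ a < b ∧ K ⊆ Ioo a b ∧ Icc a b ⊆ U := by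
  obtain ⟨x₀, hx₀⟩ := hne
  have hK' : IsCompact (insert x₀ K) := hK.insert x₀
  have hsub : insert x₀ K ⊆ U := insert_subset hx₀ hKU
  obtain ⟨m, hm⟩ := hK'.exists_isLeast ⟨x₀, mem_insert _ _⟩
  obtain ⟨M, hM⟩ := hK'.exists_isGreatest ⟨x₀, mem_insert _ _⟩
  obtain ⟨r, hr, hrU⟩ := Metric.isOpen_iff.1 hU m (hsub hm.1)
  obtain ⟨s, hs, hsU⟩ := Metric.isOpen_iff.1 hU M (hsub hM.1)
  have ha : m - r / 2 ∈ U := hrU (by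
    rw [Metric.mem_ball, Real.dist_eq, abs_lt]; constructor <;> linarith)
  have hb : M + s / 2 ∈ U := hsU (by
    rw [Metric.mem_ball, Real.dist_eq, abs_lt]; constructor <;> linarith)
  have hmM : m ≤ M := hm.2 hM.1
  refine ⟨m - r / 2, M + s / 2, ha, hb, by linarith, fun x hx => ⟨?_, ?_⟩, hc.out ha hb⟩
  · have := hm.2 (mem_insert_of_mem _ hx); linarith
  · have := hM.2 (mem_insert_of_mem _ hx); linarith

lemma setIntegral_eq_intervalIntegral_of_eq_zero {U : Set ℝ} {a b : ℝ} {g : ℝ → ℝ} (hab : a ≤ b)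
    (hU : Ioo a b ⊆ U) (hg : ∀ x, x ∉ Ioo a b → g x = 0) :
    ∫ x in U, g x = ∫ x in a..b, g x := by
  rw [setIntegral_eq_integral_of_forall_compl_eq_zero (fun x hx => hg x fun h => hx (hU h)),
    intervalIntegral.integral_of_le hab,
    setIntegral_eq_integral_of_forall_compl_eq_zero
      (fun x hx => hg x fun h => hx (Ioo_subset_Ioc_self h))]

lemma eq_zero_of_tsupport_subset {φ : ℝ → ℝ} {s : Set ℝ} (h : tsupport φ ⊆ s) {x : ℝ}
    (hx : x ∉ s) : φ x = 0 :=
  image_eq_zero_of_notMem_tsupport fun h' => hx (h h')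

lemma deriv_eq_zero_of_tsupport_subset {φ : ℝ → ℝ} {s : Set ℝ} (h : tsupport φ ⊆ s) {x : ℝ}
    (hx : x ∉ s) : deriv φ x = 0 :=
  eq_zero_of_tsupport_subset (tsupport_deriv_subset.trans h) hx

lemma integrable_mul_of_tsupport_subset {U : Set ℝ} {k ψ : ℝ → ℝ} (hk : LocallyIntegrableOn k U)
    (hψ : Continuous ψ) (hψc : HasCompactSupport ψ) (hψt : tsupport ψ ⊆ U) :
    Integrable (fun x => k x * ψ x) (volume.restrict U) := by
  have h4 : IntegrableOn (fun x => k x * ψ x) (tsupport ψ) :=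
    (hk.integrableOn_compact_subset hψt hψc).mul_continuousOn hψ.continuousOn hψc
  refine Integrable.restrict ((integrableOn_iff_integrable_of_support_subset fun x hx => ?_).1 h4)
  exact subset_tsupport _ (right_ne_zero_of_mul hx)

/-- Integration by parts for absolutely continuous functions; the boundary terms vanish with the
test function. -/
lemma integral_primitive_mul_deriv {U : Set ℝ} {a b c : ℝ} {v φ : ℝ → ℝ} (hab : a ≤ b)
    (hc : c ∈ Icc a b) (hU : Ioo a b ⊆ U) (hv : IntervalIntegrable v volume a b)
    (hφ : ContDiff ℝ ∞ φ) (hs : tsupport φ ⊆ Ioo a b) :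
    ∫ x in U, (∫ y in c..x, v y) * deriv φ x = -∫ x in U, v x * φ x := by
  rw [setIntegral_eq_intervalIntegral_of_eq_zero hab hU
      (fun x hx => by rw [deriv_eq_zero_of_tsupport_subset hs hx, mul_zero]),
    setIntegral_eq_intervalIntegral_of_eq_zero hab hU
      (fun x hx => by rw [eq_zero_of_tsupport_subset hs hx, mul_zero])]
  have hV := hv.absolutelyContinuousOnInterval_intervalIntegral (c := c) (by rwa [uIcc_of_le hab])
  have hφ' : AbsolutelyContinuousOnInterval φ a b :=
    ContDiffOn.absolutelyContinuousOnInterval ((hφ.of_le (by simp)).contDiffOn)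
  rw [hV.integral_mul_deriv_eq_deriv_mul hφ', eq_zero_of_tsupport_subset hs (x := a) (by simp),
    eq_zero_of_tsupport_subset hs (x := b) (by simp)]
  simp only [mul_zero, sub_zero, zero_sub, neg_inj]
  apply intervalIntegral.integral_congr_ae
  filter_upwards [hv.ae_hasDerivAt_integral] with x hx hx'
  rw [(hx (uIoc_subset_uIcc hx') c (by rwa [uIcc_of_le hab])).deriv]

/-- The du Bois-Reymond lemma: on an interval, a test function is the derivative of a test function
as soon as its integral vanishes. -/
lemma ae_eq_const_of_integral_mul_deriv_eq_zero {U : Set ℝ} (hU : IsOpen U) [U.OrdConnected]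
    (hne : U.Nonempty) {h : ℝ → ℝ} (hh : LocallyIntegrableOn h U)
    (hz : ∀ φ : ℝ → ℝ, ContDiff ℝ ∞ φ → HasCompactSupport φ → tsupport φ ⊆ U →
      ∫ x in U, h x * deriv φ x = 0) :
    ∃ c, ∀ᵐ x ∂(volume.restrict U), h x = c := by
  obtain ⟨x₀, hx₀⟩ := id hne
  obtain ⟨r, hr, hrU⟩ := Metric.isOpen_iff.1 hU x₀ hx₀
  -- A fixed weight of integral 1; pairing h with it produces the constant.
  let χb : ContDiffBump x₀ := ⟨r / 4, r / 2, by positivity, by linarith⟩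
  let χ : ℝ → ℝ := χb.normed volume
  have hχs : ContDiff ℝ ∞ χ := χb.contDiff_normed
  have hχc : HasCompactSupport χ := χb.hasCompactSupport_normed
  have hχt : tsupport χ ⊆ U := by
    rw [χb.tsupport_normed_eq]
    exact (Metric.closedBall_subset_ball (by simp only [χb]; linarith)).trans hrU
  have hχi : ∫ x, χ x = 1 := χb.integral_normed
  have hint : ∀ ψ : ℝ → ℝ, ContDiff ℝ ∞ ψ → HasCompactSupport ψ → tsupport ψ ⊆ U →
      Integrable (fun x => h x * ψ x) (volume.restrict U) := by
    exact fun ψ h1 h2 h3 => integrable_mul_of_tsupport_subset hh h1.continuous h2 h3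
  refine ⟨∫ x in U, h x * χ x, ?_⟩
  set c := ∫ x in U, h x * χ x with hcdef
  have key : ∀ᵐ x ∂(volume : Measure ℝ), x ∈ U → h x - c = 0 := by
    apply hU.ae_eq_zero_of_integral_contDiff_smul_eq_zero
      (hh.sub ((locallyIntegrable_const c).locallyIntegrableOn U))
    intro ψ hψ hψc hψt
    set m := ∫ x, ψ x with hm
    -- The part of ψ with zero mean. Its primitive has compact support in U, so `hz` applies to it
    -- and gives ∫ h ψ = m c.
    let g : ℝ → ℝ := fun x => ψ x - m * χ x
    have hg : ContDiff ℝ ∞ g := hψ.sub (contDiff_const.mul hχs)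
    have hKc : IsCompact (tsupport ψ ∪ tsupport χ) := hψc.union hχc
    obtain ⟨a, b, -, -, hab, hK, hI⟩ :=
      exists_Ioo_of_isCompact hU hne hKc (union_subset hψt hχt)
    have hg0 : ∀ x, x ∉ Ioo a b → g x = 0 := by
      intro x hx
      simp only [g]
      rw [eq_zero_of_tsupport_subset (subset_union_left.trans hK) hx,
        eq_zero_of_tsupport_subset (subset_union_right.trans hK) hx]
      simp
    have hψi : Integrable ψ := hψ.continuous.integrable_of_hasCompactSupport hψc
    have hχi' : Integrable χ := hχs.continuous.integrable_of_hasCompactSupport hχc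
    have hgint : ∫ x in a..b, g x = 0 := by
      rw [← setIntegral_eq_intervalIntegral_of_eq_zero (U := univ) hab.le (subset_univ _) hg0,
        setIntegral_univ, integral_sub hψi (hχi'.const_mul m), integral_const_mul, hχi]
      simp [hm]
    let φ : ℝ → ℝ := fun x => ∫ y in a..x, g y
    have hφd : ∀ x, HasDerivAt φ (g x) x := fun x =>
      intervalIntegral.integral_hasDerivAt_right (hg.continuous.intervalIntegrable _ _)
        (hg.continuous.stronglyMeasurableAtFilter _ _) hg.continuous.continuousAt
    have hφ' : deriv φ = g := funext fun x => (hφd x).deriv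
    have hφs : ContDiff ℝ ∞ φ := by
      rw [contDiff_infty_iff_deriv]
      exact ⟨fun x => (hφd x).differentiableAt, by rw [hφ']; exact hg⟩
    have hφ0 : ∀ x, x ∉ Icc a b → φ x = 0 := by
      intro x hx
      by_cases hxa : x < a
      · simp only [φ]
        rw [intervalIntegral.integral_symm, neg_eq_zero]
        refine (intervalIntegral.integral_congr fun y hy => ?_).trans
          intervalIntegral.integral_zero
        rw [uIcc_of_le hxa.le] at hy
        exact hg0 y fun h => absurd h.1 (not_lt.2 hy.2)
      · have hxb : b < x := by
          by_contra hb
          exact hx ⟨not_lt.1 hxa, not_lt.1 hb⟩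
        simp only [φ]
        rw [← intervalIntegral.integral_add_adjacent_intervals
          (hg.continuous.intervalIntegrable a b) (hg.continuous.intervalIntegrable b x), hgint,
          zero_add]
        refine (intervalIntegral.integral_congr fun y hy => ?_).trans
          intervalIntegral.integral_zero
        rw [uIcc_of_le hxb.le] at hy
        exact hg0 y fun h => absurd h.2 (not_lt.2 hy.1)
    have hφt : tsupport φ ⊆ Icc a b :=
      closure_minimal (fun x hx => by_contra fun h => hx (hφ0 x h)) isClosed_Icc
    have hz' := hz φ hφs (HasCompactSupport.of_support_subset_isCompact isCompact_Icc
      ((subset_tsupport _).trans hφt)) (hφt.trans hI)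
    rw [hφ'] at hz'
    have e1 : ∫ x in U, h x * g x = (∫ x in U, h x * ψ x) - m * c := by
      rw [hcdef, ← integral_const_mul, ← integral_sub (hint ψ hψ hψc hψt)
        ((hint χ hχs hχc hχt).const_mul m)]
      congr 1; ext x; simp only [g]; ring
    have e2 : ∫ x, ψ x • (h x - c) = (∫ x in U, h x * ψ x) - m * c := by
      rw [← setIntegral_eq_integral_of_forall_compl_eq_zero (s := U)
        (fun x hx => by rw [eq_zero_of_tsupport_subset hψt hx, zero_smul])]
      have e3 : ∫ x in U, ψ x = m := by
        rw [hm, setIntegral_eq_integral_of_forall_compl_eq_zero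
          (fun x hx => eq_zero_of_tsupport_subset hψt hx)]
      rw [← e3, ← integral_mul_const,
        ← integral_sub (hint ψ hψ hψc hψt) (hψi.restrict.mul_const c)]
      congr 1; ext x; simp only [smul_eq_mul]; ring
    exact e2.trans (e1.symm.trans hz')
  rw [ae_restrict_iff' hU.measurableSet]
  filter_upwards [key] with x hx hxU
  linarith [hx hxU]

lemma intervalIntegrable_of_locallyIntegrableOn {U : Set ℝ} [hc : U.OrdConnected] {v : ℝ → ℝ}
    (hv : LocallyIntegrableOn v U) {a b : ℝ} (ha : a ∈ U) (hb : b ∈ U) :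
    IntervalIntegrable v volume a b :=
  (hv.integrableOn_compact_subset (hc.uIcc_subset ha hb) isCompact_uIcc).intervalIntegrable

lemma locallyIntegrableOn_primitive {U : Set ℝ} (hU : IsOpen U) [hc : U.OrdConnected] {v : ℝ → ℝ}
    (hv : LocallyIntegrableOn v U) {x₀ : ℝ} (hx₀ : x₀ ∈ U) :
    ContinuousOn (fun x => ∫ y in x₀..x, v y) U := by
  intro x hx
  obtain ⟨a, b, ha, hb, hab, hK, hI⟩ := exists_Ioo_of_isCompact hU ⟨x₀, hx₀⟩
    (K := {x, x₀}) ((finite_singleton _).insert _).isCompact (by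
      rintro y (rfl | rfl) <;> assumption)
  have h1 : ContinuousOn (fun x => ∫ y in x₀..x, v y) (Icc a b) := by
    have := intervalIntegral.continuousOn_primitive_interval' (μ := volume) (f := v) (a := x₀)
      (b₁ := a) (b₂ := b) (intervalIntegrable_of_locallyIntegrableOn hv ha hb)
      (by rw [uIcc_of_le hab.le]; exact Ioo_subset_Icc_self (hK (by simp)))
    rwa [uIcc_of_le hab.le] at this
  exact (h1.continuousAt (Icc_mem_nhds (hK (by simp)).1 (hK (by simp)).2)).continuousWithinAt

/-- A function with a weak derivative is, up to a constant, almost everywhere the primitive of its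
weak derivative. -/
lemma HasWeakDerivOn.ae_eq_primitive {U : Set ℝ} (hU : IsOpen U) [hc : U.OrdConnected]
    {u v : ℝ → ℝ} (h : HasWeakDerivOn U u v) {x₀ : ℝ} (hx₀ : x₀ ∈ U) :
    ∃ c, ∀ᵐ x ∂(volume.restrict U), u x = c + ∫ y in x₀..x, v y := by
  obtain ⟨hu, hv, hw⟩ := h
  have hV : LocallyIntegrableOn (fun x => ∫ y in x₀..x, v y) U :=
    (locallyIntegrableOn_primitive hU hv hx₀).locallyIntegrableOn hU.measurableSet
  obtain ⟨c, hc'⟩ := ae_eq_const_of_integral_mul_deriv_eq_zero hU ⟨x₀, hx₀⟩ (hu.sub hV) (by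
    intro φ hφ hφc hφt
    obtain ⟨a, b, ha, hb, hab, hK, hI⟩ := exists_Ioo_of_isCompact hU ⟨x₀, hx₀⟩
      (K := insert x₀ (tsupport φ)) (hφc.isCompact.insert _) (insert_subset hx₀ hφt)
    have h1 := integral_primitive_mul_deriv hab.le
      (Ioo_subset_Icc_self (hK (mem_insert _ _))) (Ioo_subset_Icc_self.trans hI)
      (intervalIntegrable_of_locallyIntegrableOn hv ha hb) hφ ((subset_insert _ _).trans hK)
    have hint : ∀ k : ℝ → ℝ, LocallyIntegrableOn k U →
        Integrable (fun x => k x * deriv φ x) (volume.restrict U) := by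
      exact fun k hk => integrable_mul_of_tsupport_subset hk
        (hφ.continuous_deriv (by simp)) hφc.deriv (tsupport_deriv_subset.trans hφt)
    have h2 : ∫ x in U, (u - fun x => ∫ y in x₀..x, v y) x * deriv φ x =
        (∫ x in U, u x * deriv φ x) - ∫ x in U, (∫ y in x₀..x, v y) * deriv φ x := by
      rw [← integral_sub (hint u hu) (hint _ hV)]
      congr 1; ext x; simp only [Pi.sub_apply]; ring
    rw [h2, h1, hw φ hφ hφc hφt, sub_self])
  refine ⟨c, ?_⟩
  filter_upwards [hc'] with x hx
  simp only [Pi.sub_apply] at hx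
  linarith

/-- Two continuous functions that agree almost everywhere on an open set agree everywhere; this
turns the almost-everywhere identity into one for point values. -/
lemma HasWeakDerivOn.eq_primitive {U : Set ℝ} (hU : IsOpen U) [hc : U.OrdConnected]
    {u v : ℝ → ℝ} (h : HasWeakDerivOn U u v) (hu : ContinuousOn u U) {x y : ℝ} (hx : x ∈ U)
    (hy : y ∈ U) : u y - u x = ∫ z in x..y, v z := by
  obtain ⟨c, hc'⟩ := h.ae_eq_primitive hU hx
  have h1 : EqOn u (fun y => c + ∫ z in x..y, v z) U :=
    Measure.eqOn_open_of_ae_eq hc' hU hu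
      (continuousOn_const.add (locallyIntegrableOn_primitive hU h.2.1 hx))
  rw [h1 hy, h1 hx]; simp

lemma HasWeakDerivOn.congr_left {U : Set ℝ} {u u' v : ℝ → ℝ} (h : HasWeakDerivOn U u v)
    (huu' : u =ᵐ[volume.restrict U] u') (hu' : LocallyIntegrableOn u' U) :
    HasWeakDerivOn U u' v := by
  refine ⟨hu', h.2.1, fun φ h1 h2 h3 => ?_⟩
  rw [← h.2.2 φ h1 h2 h3]
  apply integral_congr_ae
  filter_upwards [huu'] with x hx
  rw [hx]

lemma HasWeakDerivOn.unique {U : Set ℝ} (hU : IsOpen U) {u v v' : ℝ → ℝ}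
    (h : HasWeakDerivOn U u v) (h' : HasWeakDerivOn U u v') : v =ᵐ[volume.restrict U] v' := by
  have key : ∀ᵐ x ∂(volume : Measure ℝ), x ∈ U → v x - v' x = 0 := by
    apply hU.ae_eq_zero_of_integral_contDiff_smul_eq_zero (h.2.1.sub h'.2.1)
    intro ψ hψ hψc hψt
    have hint : ∀ k : ℝ → ℝ, LocallyIntegrableOn k U →
        Integrable (fun x => k x * ψ x) (volume.restrict U) := by
      exact fun k hk => integrable_mul_of_tsupport_subset hk hψ.continuous hψc hψt
    rw [← setIntegral_eq_integral_of_forall_compl_eq_zero (s := U)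
        (fun x hx => by rw [eq_zero_of_tsupport_subset hψt hx, zero_smul])]
    have e : ∫ x in U, ψ x • (v x - v' x) = (∫ x in U, v x * ψ x) - ∫ x in U, v' x * ψ x := by
      rw [← integral_sub (hint _ h.2.1) (hint _ h'.2.1)]
      congr 1; ext x; simp only [smul_eq_mul]; ring
    refine e.trans ?_
    linarith [h.2.2 ψ hψ hψc hψt, h'.2.2 ψ hψ hψc hψt]
  rw [Filter.EventuallyEq, ae_restrict_iff' hU.measurableSet]
  filter_upwards [key] with x hx hxU
  linarith [hx hxU]

lemma hasWeakDerivOn_of_eq_primitive {U : Set ℝ} (hU : IsOpen U) [hc : U.OrdConnected]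
    {u v : ℝ → ℝ} (hv : LocallyIntegrableOn v U)
    (h : ∀ x ∈ U, ∀ y ∈ U, u y - u x = ∫ z in x..y, v z) : HasWeakDerivOn U u v := by
  rcases U.eq_empty_or_nonempty with rfl | ⟨x₀, hx₀⟩
  · exact ⟨by simp [LocallyIntegrableOn], hv, by simp⟩
  have hc1 := locallyIntegrableOn_primitive hU hv hx₀
  have heq : EqOn u (fun x => u x₀ + ∫ y in x₀..x, v y) U := fun x hx => by
    simp only [← h x₀ hx₀ x hx]; ring
  have hu : ContinuousOn u U := (continuousOn_const.add hc1).congr heq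
  refine ⟨hu.locallyIntegrableOn hU.measurableSet, hv, fun φ hφ hφc hφt => ?_⟩
  obtain ⟨a, b, ha, hb, hab, hK, hI⟩ := exists_Ioo_of_isCompact hU ⟨x₀, hx₀⟩
      (K := insert x₀ (tsupport φ)) (hφc.isCompact.insert _) (insert_subset hx₀ hφt)
  have h1 := integral_primitive_mul_deriv hab.le
      (Ioo_subset_Icc_self (hK (mem_insert _ _))) (Ioo_subset_Icc_self.trans hI)
      (intervalIntegrable_of_locallyIntegrableOn hv ha hb) hφ ((subset_insert _ _).trans hK)
  have hint : ∀ k : ℝ → ℝ, ContinuousOn k U →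
        Integrable (fun x => k x * deriv φ x) (volume.restrict U) := by
    exact fun k hk => integrable_mul_of_tsupport_subset (hk.locallyIntegrableOn hU.measurableSet)
      (hφ.continuous_deriv (by simp)) hφc.deriv (tsupport_deriv_subset.trans hφt)
  have h2 : ∫ x in U, u x * deriv φ x = u x₀ * (∫ x in U, deriv φ x) +
      ∫ x in U, (∫ y in x₀..x, v y) * deriv φ x := by
    rw [← integral_const_mul, ← integral_add (hint _ continuousOn_const) (hint _ hc1)]
    apply setIntegral_congr_fun hU.measurableSet
    intro x hx
    simp only [heq hx]; ring
  have h3 : ∫ x in U, deriv φ x = 0 := by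
    have hs := (subset_insert x₀ _).trans hK
    rw [setIntegral_eq_intervalIntegral_of_eq_zero hab.le (Ioo_subset_Icc_self.trans hI)
      (fun x hx => deriv_eq_zero_of_tsupport_subset hs hx),
      intervalIntegral.integral_deriv_eq_sub
        (fun x _ => (hφ.differentiable (by simp)) x)
        ((hφ.continuous_deriv (by simp)).intervalIntegrable _ _),
      eq_zero_of_tsupport_subset hs (x := a) (by simp),
      eq_zero_of_tsupport_subset hs (x := b) (by simp), sub_zero]
  rw [h2, h3, mul_zero, zero_add, h1]

end Extruder

end

noncomputable section

namespace Extruder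

/-! ### The space `H²(0,1)` -/

/-- `u ∈ H²(0,1)` with first derivative `v`, the continuous representative, and second weak
derivative `w`. -/
structure IsH2 (u v w : ℝ → ℝ) : Prop where
  memLp : MemLp w 2 (volume.restrict (Ioo 0 1))
  v_eq : ∀ x ∈ Icc (0 : ℝ) 1, v x = v 0 + ∫ y in (0 : ℝ)..x, w y
  u_eq : ∀ x ∈ Icc (0 : ℝ) 1, u x = u 0 + ∫ y in (0 : ℝ)..x, v y

lemma intervalIntegrable_of_memLp {w : ℝ → ℝ} (h : MemLp w 2 (volume.restrict (Ioo (0 : ℝ) 1)))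
    {x y : ℝ} (hx : x ∈ Icc (0 : ℝ) 1) (hy : y ∈ Icc (0 : ℝ) 1) :
    IntervalIntegrable w volume x y := by
  have h1 : IntegrableOn w (Ioo 0 1) := h.integrable (by norm_num)
  have h2 : IntegrableOn w (Icc 0 1) := (integrableOn_Icc_iff_integrableOn_Ioo).2 h1
  exact (h2.mono_set (ordConnected_Icc.uIcc_subset hx hy)).intervalIntegrable

lemma ContinuousOn.memLp_Ioo {u : ℝ → ℝ} (hu : ContinuousOn u (Icc 0 1)) :
    MemLp u 2 (volume.restrict (Ioo (0 : ℝ) 1)) := by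
  obtain ⟨C, hC⟩ := isCompact_Icc.exists_bound_of_continuousOn hu
  refine MemLp.of_bound ((hu.mono Ioo_subset_Icc_self).aestronglyMeasurable measurableSet_Ioo) C ?_
  rw [ae_restrict_iff' measurableSet_Ioo]
  exact Eventually.of_forall fun x hx => hC x (Ioo_subset_Icc_self hx)

lemma ContinuousOn.intervalIntegrable_Icc {u : ℝ → ℝ} (hu : ContinuousOn u (Icc 0 1)) {x y : ℝ}
    (hx : x ∈ Icc (0 : ℝ) 1) (hy : y ∈ Icc (0 : ℝ) 1) : IntervalIntegrable u volume x y :=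
  (hu.mono (ordConnected_Icc.uIcc_subset hx hy)).intervalIntegrable

namespace IsH2

variable {u v w u' v' w' : ℝ → ℝ}

lemma continuousOn_v (h : IsH2 u v w) : ContinuousOn v (Icc 0 1) := by
  have h1 := intervalIntegral.continuousOn_primitive_interval' (μ := volume) (f := w) (a := 0)
      (b₁ := 0) (b₂ := 1) (intervalIntegrable_of_memLp h.memLp (by simp) (by simp)) (by simp)
  rw [uIcc_of_le zero_le_one] at h1
  exact (continuousOn_const.add h1).congr h.v_eq

lemma v_sub (h : IsH2 u v w) {x y : ℝ} (hx : x ∈ Icc (0 : ℝ) 1) (hy : y ∈ Icc (0 : ℝ) 1) :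
    v y - v x = ∫ z in x..y, w z := by
  rw [h.v_eq x hx, h.v_eq y hy, add_sub_add_left_eq_sub,
    intervalIntegral.integral_interval_sub_left
      (intervalIntegrable_of_memLp h.memLp (by simp) hy)
      (intervalIntegrable_of_memLp h.memLp (by simp) hx)]

lemma u_sub (h : IsH2 u v w) {x y : ℝ} (hx : x ∈ Icc (0 : ℝ) 1) (hy : y ∈ Icc (0 : ℝ) 1) :
    u y - u x = ∫ z in x..y, v z := by
  rw [h.u_eq x hx, h.u_eq y hy, add_sub_add_left_eq_sub,
    intervalIntegral.integral_interval_sub_left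
      (ContinuousOn.intervalIntegrable_Icc h.continuousOn_v (by simp) hy)
      (ContinuousOn.intervalIntegrable_Icc h.continuousOn_v (by simp) hx)]

lemma hasDerivWithinAt (h : IsH2 u v w) {x : ℝ} (hx : x ∈ Icc (0 : ℝ) 1) :
    HasDerivWithinAt u (v x) (Icc 0 1) x := by
  have hv := h.continuousOn_v
  -- Extending v by its endpoint values makes the primitive differentiable from both sides at 0 and
  -- 1.
  have hv' : ContinuousOn (IccExtend (zero_le_one' ℝ) ((Icc 0 1).domRestrict v)) univ :=
    (continuousOn_iff_continuous_domRestrict.1 hv).Icc_extend'.continuousOn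
  set V := IccExtend (zero_le_one' ℝ) ((Icc 0 1).domRestrict v)
  have hV : Continuous V := by rwa [← continuousOn_univ]
  have hVv : ∀ y ∈ Icc (0 : ℝ) 1, V y = v y := fun y hy => IccExtend_of_mem _ _ hy
  have h1 : HasDerivAt (fun y => u 0 + ∫ z in (0 : ℝ)..y, V z) (V x) x :=
    (intervalIntegral.integral_hasDerivAt_right (hV.intervalIntegrable _ _)
      (hV.stronglyMeasurableAtFilter _ _) hV.continuousAt).const_add _
  rw [hVv x hx] at h1
  have h2 : ∀ y ∈ Icc (0 : ℝ) 1, u y = u 0 + ∫ z in (0 : ℝ)..y, V z := by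
    intro y hy
    rw [h.u_eq y hy]
    congr 1
    apply intervalIntegral.integral_congr
    intro z hz
    rw [uIcc_of_le hy.1] at hz
    exact (hVv z ⟨hz.1, hz.2.trans hy.2⟩).symm
  exact h1.hasDerivWithinAt.congr h2 (h2 x hx)

lemma derivWithin_eq (h : IsH2 u v w) {x : ℝ} (hx : x ∈ Icc (0 : ℝ) 1) :
    derivWithin u (Icc 0 1) x = v x :=
  (h.hasDerivWithinAt hx).derivWithin (uniqueDiffOn_Icc zero_lt_one x hx)

lemma continuousOn_u (h : IsH2 u v w) : ContinuousOn u (Icc 0 1) :=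
  fun _ hx => (h.hasDerivWithinAt hx).continuousWithinAt

lemma hasWeakDerivOn_u (h : IsH2 u v w) : HasWeakDerivOn (Ioo 0 1) u v :=
  hasWeakDerivOn_of_eq_primitive isOpen_Ioo
    ((h.continuousOn_v.mono Ioo_subset_Icc_self).locallyIntegrableOn measurableSet_Ioo)
    fun _ hx _ hy => h.u_sub (Ioo_subset_Icc_self hx) (Ioo_subset_Icc_self hy)

lemma hasWeakDerivOn_v (h : IsH2 u v w) : HasWeakDerivOn (Ioo 0 1) v w := by
  have h1 : IntegrableOn w (Ioo 0 1) := h.memLp.integrable (by norm_num)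
  exact hasWeakDerivOn_of_eq_primitive isOpen_Ioo h1.locallyIntegrableOn
    fun _ hx _ hy => h.v_sub (Ioo_subset_Icc_self hx) (Ioo_subset_Icc_self hy)

lemma memH2 (h : IsH2 u v w) : MemH2 u :=
  ⟨h.continuousOn_u, v, w, ContinuousOn.memLp_Ioo h.continuousOn_u,
    ContinuousOn.memLp_Ioo h.continuousOn_v, h.memLp, h.hasWeakDerivOn_u, h.hasWeakDerivOn_v⟩

lemma sub (h : IsH2 u v w) (h' : IsH2 u' v' w') :
    IsH2 (fun x => u x - u' x) (fun x => v x - v' x) (fun x => w x - w' x) := by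
  refine ⟨h.memLp.sub h'.memLp, fun x hx => ?_, fun x hx => ?_⟩
  · rw [intervalIntegral.integral_sub (intervalIntegrable_of_memLp h.memLp (by simp) hx)
      (intervalIntegrable_of_memLp h'.memLp (by simp) hx), h.v_eq x hx, h'.v_eq x hx]
    ring
  · rw [intervalIntegral.integral_sub
      (ContinuousOn.intervalIntegrable_Icc h.continuousOn_v (by simp) hx)
      (ContinuousOn.intervalIntegrable_Icc h'.continuousOn_v (by simp) hx), h.u_eq x hx,
      h'.u_eq x hx]
    ring

lemma const (c : ℝ) : IsH2 (fun _ => c) (fun _ => 0) (fun _ => 0) :=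
  ⟨by simp, by simp, by simp⟩

lemma congr (h : IsH2 u v w) (huu' : ∀ x ∈ Icc (0 : ℝ) 1, u' x = u x)
    (hvv' : ∀ x ∈ Icc (0 : ℝ) 1, v' x = v x) : IsH2 u' v' w := by
  refine ⟨h.memLp, fun x hx => ?_, fun x hx => ?_⟩
  · rw [hvv' x hx, hvv' 0 (by simp), h.v_eq x hx]
  · rw [huu' x hx, huu' 0 (by simp), h.u_eq x hx]
    congr 1
    apply intervalIntegral.integral_congr
    intro z hz
    rw [uIcc_of_le hx.1] at hz
    exact (hvv' z ⟨hz.1, hz.2.trans hx.2⟩).symm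

lemma weakDeriv_ae_eq (h : HasWeakDerivOn (Ioo 0 1) u v) :
    weakDeriv u =ᵐ[volume.restrict (Ioo 0 1)] v := by
  have hex : ∃ v, HasWeakDerivOn (Ioo 0 1) u v := ⟨v, h⟩
  have : weakDeriv u = hex.choose := by simp only [weakDeriv, dif_pos hex]
  rw [this]
  exact hex.choose_spec.unique isOpen_Ioo h

/-- `weakDeriv` is an arbitrary choice of representative; almost-everywhere uniqueness of weak
derivatives frees the norm from that choice. -/
lemma h2NormSq_eq (h : IsH2 u v w) :
    h2NormSq u = (∫ x in Ioo (0 : ℝ) 1, u x ^ 2) + (∫ x in Ioo (0 : ℝ) 1, v x ^ 2) +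
      ∫ x in Ioo (0 : ℝ) 1, w x ^ 2 := by
  have h1 := weakDeriv_ae_eq h.hasWeakDerivOn_u
  have h2 : HasWeakDerivOn (Ioo 0 1) (weakDeriv u) w := by
    refine h.hasWeakDerivOn_v.congr_left h1.symm ?_
    have : IntegrableOn (weakDeriv u) (Ioo 0 1) :=
      Integrable.congr ((ContinuousOn.memLp_Ioo h.continuousOn_v).integrable (by norm_num)) h1.symm
    exact this.locallyIntegrableOn
  have h3 := weakDeriv_ae_eq h2
  unfold h2NormSq
  congr 1
  · congr 1
    exact integral_congr_ae (h1.mono fun x hx => by simp only [hx])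
  · exact integral_congr_ae (h3.mono fun x hx => by simp only [hx])

/-- Sobolev embedding with an explicit constant: average v(x)² ≤ 2 v(y)² + 2 (v(y) - v(x))² over y
in (0,1), where |v(y) - v(x)| ≤ ‖w‖₁ ≤ ‖w‖₂ because the interval has measure one. -/
lemma sq_le_of_primitive (hv : ContinuousOn v (Icc 0 1))
    (hw : MemLp w 2 (volume.restrict (Ioo (0 : ℝ) 1)))
    (h : ∀ x ∈ Icc (0 : ℝ) 1, ∀ y ∈ Icc (0 : ℝ) 1, v y - v x = ∫ z in x..y, w z) {x : ℝ}
    (hx : x ∈ Icc (0 : ℝ) 1) :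
    v x ^ 2 ≤ 2 * (∫ y in Ioo (0 : ℝ) 1, v y ^ 2) + 2 * ∫ y in Ioo (0 : ℝ) 1, w y ^ 2 := by
  have hμ : IsProbabilityMeasure (volume.restrict (Ioo (0 : ℝ) 1)) := ⟨by simp⟩
  have hwi : IntegrableOn w (Ioo 0 1) := hw.integrable (by norm_num)
  have hw2 : IntegrableOn (fun y => w y ^ 2) (Ioo 0 1) := hw.integrable_sq
  have hv2 : IntegrableOn (fun y => v y ^ 2) (Ioo 0 1) :=
    (ContinuousOn.memLp_Ioo hv).integrable_sq
  -- Cauchy–Schwarz, in the form that the variance of |w| is nonnegative.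
  have hj : (∫ y in Ioo (0 : ℝ) 1, |w y|) ^ 2 ≤ ∫ y in Ioo (0 : ℝ) 1, w y ^ 2 := by
    have h0 : 0 ≤ ∫ y in Ioo (0 : ℝ) 1, (|w y| - ∫ z in Ioo (0 : ℝ) 1, |w z|) ^ 2 :=
      integral_nonneg fun y => sq_nonneg _
    set m := ∫ z in Ioo (0 : ℝ) 1, |w z|
    have e : ∫ y in Ioo (0 : ℝ) 1, (|w y| - m) ^ 2 =
        (∫ y in Ioo (0 : ℝ) 1, w y ^ 2) - 2 * m * m + m ^ 2 := by
      have e1 : ∀ y, (|w y| - m) ^ 2 = (w y ^ 2 - 2 * m * |w y|) + m ^ 2 := fun y => by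
        rw [← sq_abs (w y)]; ring
      have e2 : Integrable (fun y => w y ^ 2 - 2 * m * |w y|) (volume.restrict (Ioo 0 1)) :=
        hw2.sub (hwi.abs.const_mul _)
      simp_rw [e1]
      rw [integral_add e2 (integrable_const _),
        integral_sub hw2 (hwi.abs.const_mul _), integral_const_mul]
      simp [m]
    nlinarith
  have hb : ∀ y ∈ Ioo (0 : ℝ) 1, v x ^ 2 ≤ 2 * v y ^ 2 + 2 * ∫ z in Ioo (0 : ℝ) 1, w z ^ 2 := by
    intro y hy
    have hy' := Ioo_subset_Icc_self hy
    have h1 : |v y - v x| ≤ ∫ z in Ioo (0 : ℝ) 1, |w z| := by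
      rw [h x hx y hy', ← integral_Icc_eq_integral_Ioo, ← Real.norm_eq_abs]
      refine intervalIntegral.norm_integral_le_integral_norm_uIoc.trans ?_
      refine setIntegral_mono_set ((integrableOn_Icc_iff_integrableOn_Ioo).2 hwi.abs)
        (Eventually.of_forall fun z => abs_nonneg _) ?_
      exact (uIoc_subset_uIcc.trans (ordConnected_Icc.uIcc_subset hx hy')).eventuallyLE
    have h2 : (v y - v x) ^ 2 ≤ ∫ z in Ioo (0 : ℝ) 1, w z ^ 2 := by
      rw [← sq_abs]
      exact (pow_le_pow_left₀ (abs_nonneg _) h1 2).trans hj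
    nlinarith [sq_nonneg (v y + (v y - v x))]
  have h3 := setIntegral_mono_on (μ := volume) (s := Ioo (0 : ℝ) 1) (f := fun _ => v x ^ 2)
    (g := fun y => 2 * v y ^ 2 + 2 * ∫ z in Ioo (0 : ℝ) 1, w z ^ 2) (integrable_const _)
    (Integrable.fun_add (hv2.const_mul 2) (integrable_const _)) measurableSet_Ioo hb
  rw [integral_add (hv2.const_mul 2) (integrable_const _), integral_const_mul] at h3
  simpa using h3

lemma sq_v_le (h : IsH2 u v w) {x : ℝ} (hx : x ∈ Icc (0 : ℝ) 1) : v x ^ 2 ≤ 2 * h2NormSq u := by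
  have h1 := sq_le_of_primitive h.continuousOn_v h.memLp (fun x hx y hy => h.v_sub hx hy) hx
  have h2 : 0 ≤ ∫ y in Ioo (0 : ℝ) 1, u y ^ 2 := integral_nonneg fun y => sq_nonneg _
  rw [h.h2NormSq_eq]
  linarith

lemma sq_u_le (h : IsH2 u v w) {x : ℝ} (hx : x ∈ Icc (0 : ℝ) 1) : u x ^ 2 ≤ 2 * h2NormSq u := by
  have h1 := sq_le_of_primitive h.continuousOn_u (ContinuousOn.memLp_Ioo h.continuousOn_v)
    (fun x hx y hy => h.u_sub hx hy) hx
  have h2 : 0 ≤ ∫ y in Ioo (0 : ℝ) 1, w y ^ 2 := integral_nonneg fun y => sq_nonneg _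
  rw [h.h2NormSq_eq]
  linarith

end IsH2

/-- The weak identities live on the open interval, so primitives are based at 1/2 and extended to
the endpoints by continuity. With `derivWithin` as first derivative, the traces of u and u' at 0 and
1 are available without exceptional null sets. -/
lemma MemH2.exists_isH2 {u : ℝ → ℝ} (h : MemH2 u) :
    ∃ w, IsH2 u (derivWithin u (Icc 0 1)) w := by
  obtain ⟨hu, v, w, -, -, hw, huv, hvw⟩ := h
  have hmid : (1 / 2 : ℝ) ∈ Ioo (0 : ℝ) 1 := by norm_num
  obtain ⟨c, hc⟩ := hvw.ae_eq_primitive isOpen_Ioo hmid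
  have hi := fun {x y : ℝ} (hx : x ∈ Icc (0 : ℝ) 1) (hy : y ∈ Icc (0 : ℝ) 1) =>
    intervalIntegrable_of_memLp hw hx hy
  set V : ℝ → ℝ := fun x => c + ∫ y in (1 / 2 : ℝ)..x, w y with hV
  have hVc : ContinuousOn V (Icc 0 1) := by
    have h1 := intervalIntegral.continuousOn_primitive_interval' (μ := volume) (f := w)
      (a := 1 / 2) (b₁ := 0) (b₂ := 1) (hi (by simp) (by simp))
      (by rw [uIcc_of_le zero_le_one]; exact Ioo_subset_Icc_self hmid)
    rw [uIcc_of_le zero_le_one] at h1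
    exact continuousOn_const.add h1
  have hsub : ∀ x ∈ Ioo (0 : ℝ) 1, ∀ y ∈ Ioo (0 : ℝ) 1, u y - u x = ∫ z in x..y, V z := by
    intro x hx y hy
    rw [huv.eq_primitive isOpen_Ioo (hu.mono Ioo_subset_Icc_self) hx hy]
    apply intervalIntegral.integral_congr_ae
    rw [ae_restrict_iff' measurableSet_Ioo] at hc
    filter_upwards [hc] with z hz hz'
    exact hz (ordConnected_Ioo.uIcc_subset hx hy (uIoc_subset_uIcc hz'))
  have hP : ContinuousOn (fun y => ∫ z in (1 / 2 : ℝ)..y, V z) (Icc 0 1) := by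
    have h1 := intervalIntegral.continuousOn_primitive_interval' (μ := volume) (f := V)
      (a := 1 / 2) (b₁ := 0) (b₂ := 1)
      (ContinuousOn.intervalIntegrable_Icc hVc (by simp) (by simp))
      (by rw [uIcc_of_le zero_le_one]; exact Ioo_subset_Icc_self hmid)
    rwa [uIcc_of_le zero_le_one] at h1
  have heq : EqOn u (fun y => u (1 / 2) + ∫ z in (1 / 2 : ℝ)..y, V z) (Icc 0 1) := by
    have h1 : EqOn u (fun y => u (1 / 2) + ∫ z in (1 / 2 : ℝ)..y, V z) (Ioo 0 1) := fun y hy => by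
      simp only [← hsub _ hmid y hy]; ring
    exact h1.of_subset_closure hu (continuousOn_const.add hP) Ioo_subset_Icc_self
      (by rw [closure_Ioo (by norm_num)])
  have hH : IsH2 u V w := by
    refine ⟨hw, fun x hx => ?_, fun x hx => ?_⟩
    · simp only [hV]
      rw [add_assoc, intervalIntegral.integral_add_adjacent_intervals
        (hi (Ioo_subset_Icc_self hmid) (by simp)) (hi (by simp) hx)]
    · rw [heq hx, heq (by simp : (0 : ℝ) ∈ Icc (0 : ℝ) 1)]
      simp only
      rw [add_assoc, intervalIntegral.integral_add_adjacent_intervals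
        (ContinuousOn.intervalIntegrable_Icc hVc (Ioo_subset_Icc_self hmid) (by simp))
        (ContinuousOn.intervalIntegrable_Icc hVc (by simp) hx)]
  exact ⟨w, hH.congr (fun _ _ => rfl) fun x hx => hH.derivWithin_eq hx⟩

end Extruder

end

noncomputable section

namespace Extruder

/-! ### Continuity in time with values in `H²(0,1)` -/

/-- `f ∈ C⁰(S; H²(0,1))`. -/
def H2ContinuousOn (S : Set ℝ) (f : ℝ → ℝ → ℝ) : Prop :=
  (∀ t ∈ S, MemH2 (f t)) ∧
    ∀ t ∈ S, Tendsto (fun s => h2NormSq (fun x => f s x - f t x)) (𝓝[S] t) (𝓝 0)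

/-- The bound on g s - g t is uniform in space, so continuity in time and continuity in space
combine to joint continuity. It serves for f and for ∂ₓf alike, with H the squared H² distance. -/
lemma continuousOn_uncurry_of_sq_le {S : Set ℝ} {g : ℝ → ℝ → ℝ} {H : ℝ → ℝ → ℝ}
    (hg : ∀ t ∈ S, ContinuousOn (g t) (Icc 0 1))
    (hH : ∀ t ∈ S, Tendsto (fun s => H s t) (𝓝[S] t) (𝓝 0))
    (hle : ∀ s ∈ S, ∀ t ∈ S, ∀ y ∈ Icc (0 : ℝ) 1, (g s y - g t y) ^ 2 ≤ 2 * H s t) :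
    ContinuousOn (fun z : ℝ × ℝ => g z.1 z.2) (S ×ˢ Icc 0 1) := by
  rintro ⟨t, x⟩ ⟨ht, hx⟩
  have h1 : Tendsto (fun z : ℝ × ℝ => √(2 * H z.1 t)) (𝓝[S ×ˢ Icc 0 1] (t, x)) (𝓝 0) := by
    have : Tendsto (fun s => √(2 * H s t)) (𝓝[S] t) (𝓝 0) := by
      have := (Real.continuous_sqrt.tendsto _).comp ((hH t ht).const_mul 2)
      rw [mul_zero, Real.sqrt_zero] at this
      exact this
    refine this.comp ?_
    rw [nhdsWithin_prod_eq]
    exact tendsto_fst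
  have h2 : Tendsto (fun z : ℝ × ℝ => g t z.2) (𝓝[S ×ˢ Icc 0 1] (t, x)) (𝓝 (g t x)) := by
    refine (hg t ht x hx).tendsto.comp ?_
    rw [nhdsWithin_prod_eq]
    exact tendsto_snd
  have h3 : Tendsto (fun z : ℝ × ℝ => g z.1 z.2 - g t z.2) (𝓝[S ×ˢ Icc 0 1] (t, x)) (𝓝 0) := by
    refine squeeze_zero_norm' ?_ h1
    filter_upwards [self_mem_nhdsWithin] with z hz
    rw [Real.norm_eq_abs]
    exact Real.abs_le_sqrt (hle z.1 hz.1 t ht z.2 hz.2)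
  have := h3.add h2
  simpa [ContinuousWithinAt] using this

namespace H2ContinuousOn

variable {S : Set ℝ} {f : ℝ → ℝ → ℝ}

lemma isH2_sub {s t : ℝ} (hf : H2ContinuousOn S f) (hs : s ∈ S) (ht : t ∈ S) :
    ∃ w, IsH2 (fun x => f s x - f t x)
      (fun x => derivWithin (f s) (Icc 0 1) x - derivWithin (f t) (Icc 0 1) x) w := by
  obtain ⟨w, hw⟩ := (hf.1 s hs).exists_isH2
  obtain ⟨w', hw'⟩ := (hf.1 t ht).exists_isH2
  exact ⟨_, hw.sub hw'⟩

lemma continuousOn_uncurry (hf : H2ContinuousOn S f) :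
    ContinuousOn (fun z : ℝ × ℝ => f z.1 z.2) (S ×ˢ Icc 0 1) :=
  continuousOn_uncurry_of_sq_le (H := fun s t => h2NormSq (fun x => f s x - f t x))
    (fun t ht => (hf.1 t ht).1) hf.2 fun _ hs _ ht _ hy =>
      (hf.isH2_sub hs ht).choose_spec.sq_u_le hy

lemma continuousOn_derivWithin (hf : H2ContinuousOn S f) :
    ContinuousOn (fun z : ℝ × ℝ => derivWithin (f z.1) (Icc 0 1) z.2) (S ×ˢ Icc 0 1) :=
  continuousOn_uncurry_of_sq_le (g := fun t x => derivWithin (f t) (Icc 0 1) x)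
    (H := fun s t => h2NormSq (fun x => f s x - f t x))
    (fun t ht => (hf.1 t ht).exists_isH2.choose_spec.continuousOn_v) hf.2 fun _ hs _ ht _ hy =>
      (hf.isH2_sub hs ht).choose_spec.sq_v_le hy

lemma continuousOn_apply (hf : H2ContinuousOn S f) {x : ℝ} (hx : x ∈ Icc (0 : ℝ) 1) :
    ContinuousOn (fun t => f t x) S :=
  hf.continuousOn_uncurry.comp (f := fun t => (t, x)) (by fun_prop) fun _ ht => ⟨ht, hx⟩

end H2ContinuousOn

/-! ### Systems of an interface and a transport equation -/

/-- The data of the system `l' = F(l, f(·,1))`, `∂ₜ f + (n(l) - x l') / l * ∂ₓ f = 0`,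
`f(·,0) = β(l)`, where `(l, f(·,1))` ranges over `Ω`. -/
structure InterfaceSystem where
  n : ℝ → ℝ
  β : ℝ → ℝ
  F : ℝ → ℝ → ℝ
  Ω : Set (ℝ × ℝ)
  isOpen_Ω : IsOpen Ω
  n_smooth : ∀ z ∈ Ω, ContDiffAt ℝ 2 n z.1
  β_smooth : ∀ z ∈ Ω, ContDiffAt ℝ 2 β z.1
  F_smooth : ∀ z ∈ Ω, ContDiffAt ℝ 1 (Function.uncurry F) z
  l_ne_zero : ∀ z ∈ Ω, z.1 ≠ 0

namespace InterfaceSystem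

variable (S : InterfaceSystem)

/-- The transport speed. -/
def speed (l φ x : ℝ) : ℝ := (S.n l - x * S.F l φ) / l

/-- The states at which the transport speed is positive on `[0,1]`. -/
def good : Set (ℝ × ℝ) := {z | z ∈ S.Ω ∧ 0 < z.1 ∧ 0 < S.n z.1 ∧ S.F z.1 z.2 < S.n z.1}

/-- `(l, f)` is a classical solution on `[a,b)`. -/
structure IsClassical (a b : ℝ) (l : ℝ → ℝ) (f : ℝ → ℝ → ℝ) : Prop where
  mem : ∀ t ∈ Ico a b, (l t, f t 1) ∈ S.Ω
  l_deriv : ∀ t ∈ Ico a b, HasDerivWithinAt l (S.F (l t) (f t 1)) (Ici a) t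
  f_mem : H2ContinuousOn (Ico a b) f
  f_deriv : ∀ t ∈ Ico a b, ∀ x ∈ Icc (0 : ℝ) 1, HasDerivWithinAt (fun s => f s x)
    (-(S.speed (l t) (f t 1) x * derivWithin (f t) (Icc 0 1) x)) (Ici a) t
  boundary : ∀ t ∈ Ico a b, f t 0 = S.β (l t)

variable {S}

lemma isOpen_good : IsOpen S.good := by
  rw [isOpen_iff_mem_nhds]
  rintro z ⟨hz, h1, h2, h3⟩
  have hn : ContinuousAt (fun z : ℝ × ℝ => S.n z.1) z :=
    ContinuousAt.comp (f := Prod.fst) (g := S.n) (S.n_smooth z hz).continuousAt continuousAt_fst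
  have hF : ContinuousAt (fun z : ℝ × ℝ => S.F z.1 z.2) z := (S.F_smooth z hz).continuousAt
  filter_upwards [S.isOpen_Ω.mem_nhds hz, continuousAt_fst.eventually (lt_mem_nhds h1),
    hn.eventually (lt_mem_nhds h2), hF.eventually_lt hn h3] with y hy1 hy2 hy3 hy4
  exact ⟨hy1, hy2, hy3, hy4⟩

namespace IsClassical

variable {a b : ℝ} {l l' : ℝ → ℝ} {f f' : ℝ → ℝ → ℝ}

lemma l_continuousOn (h : S.IsClassical a b l f) : ContinuousOn l (Ico a b) := fun t ht =>
  (h.l_deriv t ht).continuousWithinAt.mono Ico_subset_Ici_self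

lemma state_continuousOn (h : S.IsClassical a b l f) :
    ContinuousOn (fun t => (l t, f t 1)) (Ico a b) :=
  h.l_continuousOn.prodMk (h.f_mem.continuousOn_apply (by simp))

lemma n_continuousOn (h : S.IsClassical a b l f) : ContinuousOn (fun t => S.n (l t)) (Ico a b) :=
  fun t ht => ContinuousAt.comp_continuousWithinAt (g := S.n) (f := l)
    (S.n_smooth _ (h.mem t ht)).continuousAt (h.l_continuousOn t ht)

lemma F_continuousOn (h : S.IsClassical a b l f) :
    ContinuousOn (fun t => S.F (l t) (f t 1)) (Ico a b) :=
  fun t ht => ContinuousAt.comp_continuousWithinAt (g := Function.uncurry S.F) (f := fun t => (l t, f t 1))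
    (S.F_smooth _ (h.mem t ht)).continuousAt (h.state_continuousOn t ht)

lemma f_deriv_continuousOn (h : S.IsClassical a b l f) :
    ContinuousOn (fun z : ℝ × ℝ =>
      -(S.speed (l z.1) (f z.1 1) z.2 * derivWithin (f z.1) (Icc 0 1) z.2))
      (Ico a b ×ˢ Icc 0 1) := by
  have hm : MapsTo (Prod.fst : ℝ × ℝ → ℝ) (Ico a b ×ˢ Icc (0 : ℝ) 1) (Ico a b) :=
    fun z hz => hz.1
  have h1 := h.n_continuousOn.comp continuousOn_fst hm
  have h2 := h.F_continuousOn.comp continuousOn_fst hm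
  have h3 := h.l_continuousOn.comp continuousOn_fst hm
  refine (ContinuousOn.mul ?_ h.f_mem.continuousOn_derivWithin).neg
  exact (h1.sub (continuousOn_snd.mul h2)).div h3 fun z hz => S.l_ne_zero _ (h.mem _ hz.1)

lemma mono (h : S.IsClassical a b l f) {a' b' : ℝ} (ha : a ≤ a') (hb : b' ≤ b) :
    S.IsClassical a' b' l f := by
  have hs : Ico a' b' ⊆ Ico a b := Ico_subset_Ico ha hb
  exact ⟨fun t ht => h.mem t (hs ht),
    fun t ht => (h.l_deriv t (hs ht)).mono (Ici_subset_Ici.2 ha),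
    ⟨fun t ht => h.f_mem.1 t (hs ht),
      fun t ht => (h.f_mem.2 t (hs ht)).mono_left (nhdsWithin_mono _ hs)⟩,
    fun t ht x hx => (h.f_deriv t (hs ht) x hx).mono (Ici_subset_Ici.2 ha),
    fun t ht => h.boundary t (hs ht)⟩

end IsClassical

/-- The total derivative from the right of `f` along a curve. -/
lemma hasDerivWithinAt_along {f g : ℝ → ℝ → ℝ} {x : ℝ → ℝ} {r t d x' : ℝ} (hrt : r < t)
    (hf : ∀ s ∈ Ico r t, ∀ y ∈ Icc (0 : ℝ) 1, HasDerivWithinAt (fun s => f s y) (g s y) (Ici r) s)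
    (hg : ContinuousOn (fun z : ℝ × ℝ => g z.1 z.2) (Ico r t ×ˢ Icc 0 1))
    (hx : ∀ s ∈ Ico r t, x s ∈ Icc (0 : ℝ) 1) (hx' : HasDerivWithinAt x x' (Ici r) r)
    (hd : HasDerivWithinAt (f r) d (Icc 0 1) (x r)) :
    HasDerivWithinAt (fun s => f s (x s)) (g r (x r) + d * x') (Ici r) r := by
  have hr : r ∈ Ico r t := ⟨le_rfl, hrt⟩
  have hnhds : 𝓝[Ici r] r = 𝓝[Ico r t] r := (nhdsWithin_Ico_eq_nhdsGE hrt).symm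
  have h2 : HasDerivWithinAt (fun s => f r (x s)) (d * x') (Ici r) r := by
    have := HasDerivWithinAt.comp r hd (hx'.mono Ico_subset_Ici_self) (fun s hs => hx s hs)
    unfold HasDerivWithinAt at this ⊢
    rw [hnhds]
    exact this
  -- The evaluation point moves with s, so the time derivative at a fixed point does not suffice.
  -- The mean value inequality on [r,s] at the frozen point `x s`, with g jointly continuous, gives
  -- the uniformity.
  have h1 : HasDerivWithinAt (fun s => f s (x s) - f r (x s)) (g r (x r)) (Ici r) r := by
    rw [hasDerivWithinAt_iff_isLittleO, Asymptotics.isLittleO_iff]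
    intro ε hε
    obtain ⟨δ, hδ, hgδ⟩ := Metric.continuousWithinAt_iff.1 (hg (r, x r) ⟨hr, hx r hr⟩) ε hε
    have hxc := hx'.continuousWithinAt
    have e1 : ∀ᶠ s in 𝓝[Ici r] r, dist (x s) (x r) < δ :=
      hxc.eventually (Metric.ball_mem_nhds _ hδ)
    have e2 : ∀ᶠ s in 𝓝[Ici r] r, s ∈ Ico r t := by rw [hnhds]; exact self_mem_nhdsWithin
    have e3 : ∀ᶠ s in 𝓝[Ici r] r, s < r + δ :=
      mem_nhdsWithin_of_mem_nhds (Iio_mem_nhds (by linarith))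
    filter_upwards [e1, e2, e3] with s hs1 hs2 hs3
    have hy := hx s hs2
    have hsub : Icc r s ⊆ Ico r t := fun q hq => ⟨hq.1, hq.2.trans_lt hs2.2⟩
    have key := norm_image_sub_le_of_norm_deriv_le_segment' (a := r) (b := s) (C := ε)
      (f := fun q => f q (x s) - q * g r (x r)) (f' := fun q => g q (x s) - 1 * g r (x r))
      (fun q hq => ((hf q (hsub hq) (x s) hy).mono Icc_subset_Ici_self).sub
        ((hasDerivWithinAt_id q _).mul_const _))
      (fun q hq => by
        have hq' := hsub (Ico_subset_Icc_self hq)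
        have := hgδ (x := (q, x s)) ⟨hq', hy⟩ (by
          rw [Prod.dist_eq, max_lt_iff]
          refine ⟨?_, hs1⟩
          rw [Real.dist_eq, abs_of_nonneg (by linarith [hq.1])]
          linarith [hq.2])
        rw [one_mul, ← dist_eq_norm]
        exact this.le) s ⟨hs2.1, le_rfl⟩
    have hnn : ‖s - r‖ = s - r := by
      rw [Real.norm_eq_abs, abs_of_nonneg (by linarith [hs2.1])]
    rw [hnn]
    refine le_trans (le_of_eq ?_) key
    congr 1
    simp only [smul_eq_mul]
    ring
  refine (h1.add h2).congr_of_eventuallyEq (Eventually.of_forall fun s => ?_) ?_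
  · simp
  · simp

/-! ### Characteristics and the representation of classical solutions -/

namespace IsClassical

variable {a b : ℝ} {l l' : ℝ → ℝ} {f f' : ℝ → ℝ → ℝ}

/-- Along a characteristic the total derivative is -α ∂ₓf + ∂ₓf · α = 0. Right derivatives are
enough, which allows the curve to start at the initial time or on the boundary. -/
lemma const_along (h : S.IsClassical a b l f) {s t : ℝ} (hs : a ≤ s) (hst : s ≤ t) (ht : t < b)
    {x : ℝ → ℝ} (hx : ∀ r ∈ Icc s t, x r ∈ Icc (0 : ℝ) 1) (hxc : ContinuousOn x (Icc s t))
    (hx' : ∀ r ∈ Ico s t, HasDerivWithinAt x (S.speed (l r) (f r 1) (x r)) (Ici r) r) :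
    f t (x t) = f s (x s) := by
  have hsub : Icc s t ⊆ Ico a b := fun r hr => ⟨hs.trans hr.1, hr.2.trans_lt ht⟩
  refine constant_of_has_deriv_right_zero (f := fun r => f r (x r)) (a := s) (b := t) ?_ ?_ t
    ⟨hst, le_rfl⟩
  · exact h.f_mem.continuousOn_uncurry.comp (f := fun r => (r, x r)) (continuousOn_id.prodMk hxc)
      fun r hr => ⟨hsub hr, hx r hr⟩
  · intro r hr
    have hr' : r ∈ Ico a b := hsub (Ico_subset_Icc_self hr)
    have hsub' : Ico r t ⊆ Ico a b := fun q hq => ⟨hr'.1.trans hq.1, hq.2.trans ht⟩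
    obtain ⟨w, hw⟩ := (h.f_mem.1 r hr').exists_isH2
    have := hasDerivWithinAt_along (f := f) hr.2
      (g := fun t x => -(S.speed (l t) (f t 1) x * derivWithin (f t) (Icc 0 1) x))
      (fun q hq y hy => (h.f_deriv q (hsub' hq) y hy).mono (Ici_subset_Ici.2 hr'.1))
      (h.f_deriv_continuousOn.mono (prod_mono hsub' Subset.rfl))
      (fun q hq => hx q ⟨hr.1.trans hq.1, hq.2.le⟩) (hx' r hr)
      (hw.hasDerivWithinAt (hx r (Ico_subset_Icc_self hr)))
    convert! this using 1
    ring

/-- Short-time representation of a classical solution along characteristics. -/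
lemma exists_representation (h : S.IsClassical a b l f) (hab : a < b)
    (hg : (l a, f a 1) ∈ S.good) :
    ∃ c ∈ Ioo a b, ∃ Z : ℝ → ℝ, Z a = 0 ∧
      (∀ t ∈ Icc a c, HasDerivWithinAt Z (S.n (l t)) (Ici t) t) ∧ ContinuousOn Z (Icc a c) ∧
      (∀ t ∈ Icc a c, 0 ≤ Z t ∧ Z t ≤ l t ∧ 0 < l t) ∧
      (∀ t ∈ Icc a c, l t - Z t ≤ l a) ∧
      (∀ t ∈ Icc a c, ∀ x ∈ Icc (0 : ℝ) 1, Z t ≤ l t * x →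
        f t x = f a ((l t * x - Z t) / l a)) ∧
      (∀ t ∈ Icc a c, ∀ x ∈ Icc (0 : ℝ) 1, ∀ s ∈ Icc a t, Z s = Z t - l t * x →
        f t x = S.β (l s)) := by
  have haI : a ∈ Ico a b := ⟨le_rfl, hab⟩
  -- The distance travelled since time a in the coordinate l x, common to all characteristics.
  set Z : ℝ → ℝ := fun t => ∫ r in a..t, S.n (l r) with hZ
  have hnI : ∀ t ∈ Ico a b, IntervalIntegrable (fun r => S.n (l r)) volume a t := fun t ht =>
    (h.n_continuousOn.mono (by
      rw [uIcc_of_le ht.1]; exact fun r hr => ⟨hr.1, hr.2.trans_lt ht.2⟩)).intervalIntegrable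
  have hZd : ∀ t ∈ Ico a b, HasDerivWithinAt Z (S.n (l t)) (Ici t) t := by
    intro t ht
    have hnh : 𝓝[Ioi t] t ≤ 𝓝[Ico a b] t := by
      rw [← nhdsWithin_Ioo_eq_nhdsGT ht.2]
      exact nhdsWithin_mono _ fun r hr => ⟨ht.1.trans hr.1.le, hr.2⟩
    refine intervalIntegral.integral_hasDerivWithinAt_right (hnI t ht) (t := Ioi t) ?_
      ((h.n_continuousOn t ht).mono_left hnh)
    refine StronglyMeasurableAtFilter.filter_mono ?_ hnh
    exact ⟨Ico a b, self_mem_nhdsWithin, h.n_continuousOn.aestronglyMeasurable measurableSet_Ico⟩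
  have hZ0 : Z a = 0 := by simp [hZ]
  have hZc : ∀ c ∈ Ico a b, ContinuousOn Z (Icc a c) := fun c hc => by
    have := intervalIntegral.continuousOn_primitive_interval' (hnI c hc) (left_mem_uIcc)
    rwa [uIcc_of_le hc.1] at this
  obtain ⟨c₁, hc₁⟩ : ∃ c₁, c₁ ∈ Ioo a b := ⟨(a + b) / 2, by constructor <;> linarith⟩
  have hnh : 𝓝[≥] a = 𝓝[Ico a b] a := (nhdsWithin_Ico_eq_nhdsGE hab).symm
  have hnh' : 𝓝[≥] a = 𝓝[Icc a c₁] a := (nhdsWithin_Icc_eq_nhdsGE hc₁.1).symm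
  have ev1 : ∀ᶠ t in 𝓝[≥] a, (l t, f t 1) ∈ S.good := by
    rw [hnh]
    exact (h.state_continuousOn a haI).eventually (isOpen_good.mem_nhds hg)
  have ev2 : ∀ᶠ t in 𝓝[≥] a, 0 < l t - Z t := by
    have h1 : Tendsto (fun t => l t - Z t) (𝓝[≥] a) (𝓝 (l a - Z a)) := by
      refine Tendsto.sub ?_ ?_
      · rw [hnh]; exact h.l_continuousOn a haI
      · rw [hnh']; exact hZc c₁ ⟨hc₁.1.le, hc₁.2⟩ a ⟨le_rfl, hc₁.1.le⟩
    exact h1.eventually (lt_mem_nhds (by rw [hZ0, sub_zero]; exact hg.2.1))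
  -- Up to time c the states are good and Z < l, so the characteristic issuing from the corner (a,0)
  -- has not yet reached x = 1.
  obtain ⟨c, hc, hcsub⟩ := mem_nhdsGE_iff_exists_Icc_subset.1
    (ev1.and (ev2.and (mem_nhdsWithin_of_mem_nhds (Iio_mem_nhds hab))))
  replace hc : a < c := hc
  have hcb : c < b := (hcsub ⟨hc.le, le_rfl⟩).2.2
  have hcI : c ∈ Ico a b := ⟨hc.le, hcb⟩
  have hsub : Icc a c ⊆ Ico a b := fun r hr => ⟨hr.1, hr.2.trans_lt hcb⟩
  have hlc : ContinuousOn l (Icc a c) := h.l_continuousOn.mono hsub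
  have hld : ∀ t ∈ Icc a c, HasDerivWithinAt l (S.F (l t) (f t 1)) (Ici t) t := fun t ht =>
    (h.l_deriv t (hsub ht)).mono (Ici_subset_Ici.2 ht.1)
  have hZmono : ∀ s ∈ Icc a c, ∀ t ∈ Icc s c, Z s ≤ Z t := by
    intro s hs t ht
    refine image_le_of_deriv_right_le_deriv_boundary (f := fun _ => Z s) (f' := fun _ => 0)
      (B := Z) (a := s) (b := c) continuousOn_const (fun _ _ => hasDerivWithinAt_const _ _ _) le_rfl
      ((hZc c hcI).mono (Icc_subset_Icc_left hs.1))
      (fun q hq => hZd q (hsub ⟨hs.1.trans hq.1, hq.2.le⟩)) ?_ ht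
    exact fun q hq => (hcsub ⟨hs.1.trans hq.1, hq.2.le⟩).1.2.2.1.le
  -- On good states F < n: the material outruns the interface, so no characteristic enters through x
  -- = 1.
  have hlZ : ∀ s ∈ Icc a c, ∀ t ∈ Icc s c, l t - Z t ≤ l s - Z s := by
    intro s hs t ht
    refine image_le_of_deriv_right_le_deriv_boundary (f := fun t => l t - Z t)
      (f' := fun t => S.F (l t) (f t 1) - S.n (l t)) (B := fun _ => l s - Z s) (B' := fun _ => 0)
      (a := s) (b := c) ((hlc.sub (hZc c hcI)).mono (Icc_subset_Icc_left hs.1))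
      (fun q hq => ?_) le_rfl continuousOn_const (fun _ _ => hasDerivWithinAt_const _ _ _) ?_ ht
    · have hq' : q ∈ Icc a c := ⟨hs.1.trans hq.1, hq.2.le⟩
      exact (hld q hq').sub (hZd q (hsub hq'))
    · intro q hq
      have := (hcsub ⟨hs.1.trans hq.1, hq.2.le⟩).1.2.2.2
      simp only at this
      linarith
  have hpos : ∀ t ∈ Icc a c, 0 ≤ Z t ∧ Z t ≤ l t ∧ 0 < l t := by
    intro t ht
    have h1 := hZmono a ⟨le_rfl, hc.le⟩ t ht
    have h2 := (hcsub ht).2.1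
    have h3 := (hcsub ht).1.2.1
    simp only at h3
    rw [hZ0] at h1
    exact ⟨h1, by linarith, h3⟩
  -- The curves x = (y + Z)/l solve the characteristic equation for every constant y.
  have hchar : ∀ y : ℝ, ∀ s ∈ Icc a c, ∀ t ∈ Icc s c,
      (∀ r ∈ Icc s t, (y + Z r) / l r ∈ Icc (0 : ℝ) 1) →
      f t ((y + Z t) / l t) = f s ((y + Z s) / l s) := by
    intro y s hs t ht hy
    have hsub' : Icc s t ⊆ Icc a c := Icc_subset_Icc hs.1 ht.2
    refine h.const_along hs.1 ht.1 (ht.2.trans_lt hcb) (x := fun r => (y + Z r) / l r) hy ?_ ?_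
    · exact (continuousOn_const.add ((hZc c hcI).mono hsub')).div (hlc.mono hsub')
        fun r hr => (hpos r (hsub' hr)).2.2.ne'
    · intro r hr
      have hr' := hsub' (Ico_subset_Icc_self hr)
      have hl0 := (hpos r hr').2.2.ne'
      have := ((hZd r (hsub hr')).const_add y).div (hld r hr') hl0
      convert! this using 1
      unfold speed
      field_simp
  refine ⟨c, ⟨hc, hcb⟩, Z, hZ0, fun t ht => hZd t (hsub ht), hZc c hcI, hpos,
    fun t ht => ?_, ?_, ?_⟩
  · simpa [hZ0] using hlZ a ⟨le_rfl, hc.le⟩ t ht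
  · intro t ht x hx hxZ
    obtain ⟨-, -, hlt⟩ := hpos t ht
    -- This curve passes through (t,x) and sits at (l t * x - Z t) / l a at time a. Monotonicity of
    -- l - Z keeps it below 1 in between.
    have := hchar (l t * x - Z t) a ⟨le_rfl, hc.le⟩ t ht (by
      intro r hr
      have hr' : r ∈ Icc a c := ⟨hr.1, hr.2.trans ht.2⟩
      obtain ⟨h1, h2, h3⟩ := hpos r hr'
      have h4 := hlZ r hr' t ⟨hr.2, ht.2⟩
      refine ⟨div_nonneg (by linarith) h3.le, (div_le_one h3).2 ?_⟩
      nlinarith [hx.2])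
    rw [hZ0, add_zero, sub_add_cancel, mul_div_cancel_left₀ _ hlt.ne'] at this
    exact this
  · intro t ht x hx s hs hsZ
    obtain ⟨-, -, hlt⟩ := hpos t ht
    have hs' : s ∈ Icc a c := ⟨hs.1, hs.2.trans ht.2⟩
    -- This curve leaves x = 0 at time s, and `hsZ` says that it passes through (t,x).
    have := hchar (-Z s) s hs' t ⟨hs.2, ht.2⟩ (by
      intro r hr
      have hr' : r ∈ Icc a c := ⟨hs.1.trans hr.1, hr.2.trans ht.2⟩
      obtain ⟨h1, h2, h3⟩ := hpos r hr'
      have h4 := hZmono s hs' r ⟨hr.1, hr'.2⟩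
      have h5 := (hpos s hs').1
      exact ⟨div_nonneg (by linarith) h3.le, (div_le_one h3).2 (by linarith)⟩)
    have e : -Z s + Z t = l t * x := by rw [hsZ]; ring
    rw [neg_add_cancel, zero_div, e, mul_div_cancel_left₀ _ hlt.ne',
      h.boundary s (hsub hs')] at this
    exact this

end IsClassical

end InterfaceSystem

end Extruder

end

noncomputable section

namespace Extruder

/-! ### Uniqueness of classical solutions -/

/-- The extension of a function on `[0,1]` to `ℝ` that is constant on both sides. -/
def clampExtend (u : ℝ → ℝ) (y : ℝ) : ℝ := u (max 0 (min 1 y))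

lemma clamp_mem (y : ℝ) : max 0 (min 1 y) ∈ Icc (0 : ℝ) 1 :=
  ⟨le_max_left _ _, max_le zero_le_one (min_le_left _ _)⟩

lemma clampExtend_of_mem (u : ℝ → ℝ) {y : ℝ} (hy : y ∈ Icc (0 : ℝ) 1) : clampExtend u y = u y := by
  unfold clampExtend
  rw [min_eq_right hy.2, max_eq_right hy.1]

lemma IsH2.lipschitzWith_clampExtend {u v w : ℝ → ℝ} (h : IsH2 u v w) {K : NNReal}
    (hK : ∀ x ∈ Icc (0 : ℝ) 1, |v x| ≤ K) : LipschitzWith K (clampExtend u) := by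
  have h1 : LipschitzOnWith K u (Icc 0 1) :=
    (convex_Icc 0 1).lipschitzOnWith_of_nnnorm_hasDerivWithin_le
      (fun x hx => h.hasDerivWithinAt hx) fun x hx => by
        rw [← NNReal.coe_le_coe]; exact hK x hx
  have h2 : LipschitzWith 1 (fun y : ℝ => max 0 (min 1 y)) :=
    (LipschitzWith.id.const_min 1).const_max 0
  have := h1.comp h2.lipschitzOnWith (s := univ) fun y _ => clamp_mem y
  rw [mul_one, lipschitzOnWith_univ] at this
  exact this

lemma MemH2.exists_lipschitzWith_clampExtend {u : ℝ → ℝ} (h : MemH2 u) :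
    ∃ K, LipschitzWith K (clampExtend u) := by
  obtain ⟨w, hw⟩ := h.exists_isH2
  obtain ⟨C, hC⟩ := isCompact_Icc.exists_bound_of_continuousOn hw.continuousOn_v
  exact ⟨C.toNNReal, hw.lipschitzWith_clampExtend fun x hx =>
    (hC x hx).trans (Real.le_coe_toNNReal C)⟩

namespace InterfaceSystem

variable {S : InterfaceSystem}

/-- The field of the closed ODE for (l,Z), obtained by inserting f(t,1) = u((l - Z)/l₀). At (l₀,0)
the argument of u is the endpoint 1, so u has to be extended beyond [0,1] to get a full
neighbourhood. -/
lemma exists_lipschitzOnWith_reduced {l₀ : ℝ} {u : ℝ → ℝ} (hu : MemH2 u) (h : (l₀, u 1) ∈ S.Ω) :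
    ∃ K, ∃ s ∈ 𝓝 (l₀, (0 : ℝ)), LipschitzOnWith K
      (fun y : ℝ × ℝ => (S.F y.1 (clampExtend u ((y.1 - y.2) / l₀)), S.n y.1)) s := by
  obtain ⟨K₁, hK₁⟩ := hu.exists_lipschitzWith_clampExtend
  obtain ⟨K₂, s₂, hs₂, hK₂⟩ := (S.F_smooth _ h).exists_lipschitzOnWith
  obtain ⟨K₃, s₃, hs₃, hK₃⟩ := ((S.n_smooth _ h).of_le (by norm_num)).exists_lipschitzOnWith
  have hl₀ : l₀ ≠ 0 := S.l_ne_zero _ h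
  let m : ℝ × ℝ → ℝ × ℝ := fun y => (y.1, clampExtend u ((y.1 - y.2) / l₀))
  have hm0 : m (l₀, 0) = (l₀, u 1) := by
    simp only [m]
    rw [sub_zero, div_self hl₀, clampExtend_of_mem u (by simp)]
  have hdiv : LipschitzWith (‖l₀⁻¹‖₊ * (1 + 1)) (fun y : ℝ × ℝ => (y.1 - y.2) / l₀) := by
    have h1 := (LipschitzWith.prod_fst (α := ℝ) (β := ℝ)).sub LipschitzWith.prod_snd
    have h2 := (lipschitzWith_smul (β := ℝ) l₀⁻¹).comp h1
    convert! h2 using 2 with y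
    simp [div_eq_inv_mul]
  have hm : LipschitzWith (max 1 (K₁ * (‖l₀⁻¹‖₊ * (1 + 1)))) m :=
    LipschitzWith.prod_fst.prodMk (hK₁.comp hdiv)
  have hmc : ContinuousAt m (l₀, 0) := hm.continuous.continuousAt
  refine ⟨_, m ⁻¹' s₂ ∩ Prod.fst ⁻¹' s₃, inter_mem ?_ ?_, LipschitzOnWith.prodMk
    (hK₂.comp hm.lipschitzOnWith (s := m ⁻¹' s₂ ∩ Prod.fst ⁻¹' s₃) fun y hy => hy.1)
    (hK₃.comp LipschitzWith.prod_fst.lipschitzOnWith (s := m ⁻¹' s₂ ∩ Prod.fst ⁻¹' s₃)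
      fun y hy => hy.2)⟩
  · exact hmc (by rwa [hm0])
  · exact continuousAt_fst hs₃

namespace IsClassical

variable {a b : ℝ} {l l' : ℝ → ℝ} {f f' : ℝ → ℝ → ℝ}

/-- Both solutions obey the representation formula with the same datum, so both pairs (l,Z) solve
the same Lipschitz ODE; once l and Z agree, the formula determines f. -/
lemma exists_agree (h : S.IsClassical a b l f) (h' : S.IsClassical a b l' f') (hab : a < b)
    (hg : (l a, f a 1) ∈ S.good) (hl : l' a = l a)
    (hf : ∀ x ∈ Icc (0 : ℝ) 1, f' a x = f a x) :
    ∃ c, a < c ∧ ∀ t ∈ Icc a c, l' t = l t ∧ ∀ x ∈ Icc (0 : ℝ) 1, f' t x = f t x := by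
  have haI : a ∈ Ico a b := ⟨le_rfl, hab⟩
  have hg' : (l' a, f' a 1) ∈ S.good := by rwa [hl, hf 1 (by simp)]
  obtain ⟨c, hc, Z, hZ0, hZd, hZc, hp, hla, hin, hbd⟩ := h.exists_representation hab hg
  obtain ⟨c', hc', Z', hZ0', hZd', hZc', hp', hla', hin', hbd'⟩ := h'.exists_representation hab hg'
  obtain ⟨K, s, hs, hK⟩ := exists_lipschitzOnWith_reduced (h.f_mem.1 a haI) hg.1
  have hlc : ContinuousOn l (Icc a c) :=
    h.l_continuousOn.mono fun r hr => ⟨hr.1, hr.2.trans_lt hc.2⟩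
  have hlc' : ContinuousOn l' (Icc a c') :=
    h'.l_continuousOn.mono fun r hr => ⟨hr.1, hr.2.trans_lt hc'.2⟩
  have hyc : ContinuousOn (fun t => (l t, Z t)) (Icc a c) := hlc.prodMk hZc
  have hyc' : ContinuousOn (fun t => (l' t, Z' t)) (Icc a c') := hlc'.prodMk hZc'
  have ev : ∀ᶠ t in 𝓝[≥] a, (l t, Z t) ∈ s := by
    rw [← nhdsWithin_Icc_eq_nhdsGE hc.1]
    exact (hyc a ⟨le_rfl, hc.1.le⟩).eventually (by simp only [hZ0]; exact hs)
  have ev' : ∀ᶠ t in 𝓝[≥] a, (l' t, Z' t) ∈ s := by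
    rw [← nhdsWithin_Icc_eq_nhdsGE hc'.1]
    exact (hyc' a ⟨le_rfl, hc'.1.le⟩).eventually (by simp only [hZ0', hl]; exact hs)
  obtain ⟨d, hd, hds⟩ := mem_nhdsGE_iff_exists_Icc_subset.1 (ev.and ev')
  replace hd : a < d := hd
  set e := min d (min c c') with he
  have hae : a < e := lt_min hd (lt_min hc.1 hc'.1)
  have hec : Icc a e ⊆ Icc a c := Icc_subset_Icc_right ((min_le_right _ _).trans (min_le_left _ _))
  have hec' : Icc a e ⊆ Icc a c' :=
    Icc_subset_Icc_right ((min_le_right _ _).trans (min_le_right _ _))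
  have hed : Icc a e ⊆ Icc a d := Icc_subset_Icc_right (min_le_left _ _)
  have hpos : 0 < l a := hg.2.1
  have hf1 : ∀ t ∈ Icc a e, f t 1 = clampExtend (f a) ((l t - Z t) / l a) := by
    intro t ht
    obtain ⟨p1, p2, p3⟩ := hp t (hec ht)
    have h1 := hin t (hec ht) 1 (by simp) (by linarith)
    rw [mul_one] at h1
    rw [clampExtend_of_mem _ ⟨div_nonneg (by linarith) hpos.le,
      (div_le_one hpos).2 (hla t (hec ht))⟩, h1]
  have hf1' : ∀ t ∈ Icc a e, f' t 1 = clampExtend (f a) ((l' t - Z' t) / l a) := by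
    intro t ht
    obtain ⟨p1, p2, p3⟩ := hp' t (hec' ht)
    have h1 := hin' t (hec' ht) 1 (by simp) (by linarith)
    have hm : (l' t - Z' t) / l a ∈ Icc (0 : ℝ) 1 := ⟨div_nonneg (by linarith) hpos.le,
      (div_le_one hpos).2 (hl ▸ hla' t (hec' ht))⟩
    rw [mul_one, hl, hf _ hm] at h1
    rw [clampExtend_of_mem _ hm, h1]
  have heq := ODE_solution_unique_of_mem_Icc_right (a := a) (b := e) (K := K) (s := fun _ => s)
    (v := fun _ y => (S.F y.1 (clampExtend (f a) ((y.1 - y.2) / l a)), S.n y.1))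
    (f := fun t => (l t, Z t)) (g := fun t => (l' t, Z' t)) (fun _ _ => hK) (hyc.mono hec)
    (fun t ht => by
      have ht' := Ico_subset_Icc_self ht
      have h1 := (h.l_deriv t ⟨ht.1, (hec ht').2.trans_lt hc.2⟩).mono (Ici_subset_Ici.2 ht.1)
      rw [hf1 t ht'] at h1
      exact h1.prodMk (hZd t (hec ht')))
    (fun t ht => (hds (hed (Ico_subset_Icc_self ht))).1) (hyc'.mono hec')
    (fun t ht => by
      have ht' := Ico_subset_Icc_self ht
      have h1 := (h'.l_deriv t ⟨ht.1, (hec' ht').2.trans_lt hc'.2⟩).mono (Ici_subset_Ici.2 ht.1)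
      rw [hf1' t ht'] at h1
      exact h1.prodMk (hZd' t (hec' ht')))
    (fun t ht => (hds (hed (Ico_subset_Icc_self ht))).2) (by simp only [hl, hZ0, hZ0'])
  have hll : ∀ t ∈ Icc a e, l' t = l t := fun t ht => (congrArg Prod.fst (heq ht)).symm
  have hZZ : ∀ t ∈ Icc a e, Z' t = Z t := fun t ht => (congrArg Prod.snd (heq ht)).symm
  refine ⟨e, hae, fun t ht => ⟨hll t ht, fun x hx => ?_⟩⟩
  obtain ⟨p1, p2, p3⟩ := hp t (hec ht)
  -- The characteristic through (t,x) comes either from the initial line or from the boundary; in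
  -- the second case the intermediate value theorem supplies its entry time s.
  rcases le_total (Z t) (l t * x) with hle | hle
  · rw [hin t (hec ht) x hx hle, hin' t (hec' ht) x hx (by rwa [hZZ t ht, hll t ht]), hZZ t ht,
      hll t ht, hl, hf]
    refine ⟨div_nonneg (by linarith) hpos.le, (div_le_one hpos).2 ?_⟩
    have := hla t (hec ht)
    nlinarith [hx.2]
  · obtain ⟨s, hs, hsZ⟩ := intermediate_value_Icc ht.1 (hZc.mono (Icc_subset_Icc_right (hec ht).2))
      (show Z t - l t * x ∈ Icc (Z a) (Z t) from
        ⟨by rw [hZ0]; linarith, by nlinarith [hx.1]⟩)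
    have hs' : s ∈ Icc a e := ⟨hs.1, hs.2.trans ht.2⟩
    rw [hbd t (hec ht) x hx s hs hsZ, hbd' t (hec' ht) x hx s hs
      (by rw [hZZ s hs', hZZ t ht, hll t ht, hsZ]), hll s hs']

/-- Two classical solutions with the same initial data coincide, if one of them is good. -/
theorem eq_of_good (h : S.IsClassical a b l f) (h' : S.IsClassical a b l' f')
    (hg : ∀ t ∈ Ico a b, (l t, f t 1) ∈ S.good) (hl : l' a = l a)
    (hf : ∀ x ∈ Icc (0 : ℝ) 1, f' a x = f a x) {t : ℝ} (ht : t ∈ Ico a b) :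
    l' t = l t ∧ ∀ x ∈ Icc (0 : ℝ) 1, f' t x = f t x := by
  let A : Set ℝ := {s | l' s = l s ∧ ∀ x ∈ Icc (0 : ℝ) 1, f' s x = f s x}
  have hsub : Icc a t ⊆ Ico a b := fun s hs => ⟨hs.1, hs.2.trans_lt ht.2⟩
  have hcl : IsClosed (A ∩ Icc a t) := by
    have h1 : IsClosed (Icc a t ∩ (fun s => l' s - l s) ⁻¹' {0}) :=
      ((h'.l_continuousOn.sub h.l_continuousOn).mono hsub).preimage_isClosed_of_isClosed
        isClosed_Icc isClosed_singleton
    have h2 : ∀ x ∈ Icc (0 : ℝ) 1, IsClosed (Icc a t ∩ (fun s => f' s x - f s x) ⁻¹' {0}) :=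
      fun x hx => (((h'.f_mem.continuousOn_apply hx).sub
        (h.f_mem.continuousOn_apply hx)).mono hsub).preimage_isClosed_of_isClosed
        isClosed_Icc isClosed_singleton
    have h3 : A ∩ Icc a t = (Icc a t ∩ (fun s => l' s - l s) ⁻¹' {0}) ∩
        ⋂ x ∈ Icc (0 : ℝ) 1, (Icc a t ∩ (fun s => f' s x - f s x) ⁻¹' {0}) := by
      ext s
      simp only [A, mem_inter_iff, mem_ofPred_eq, mem_preimage, mem_singleton_iff, sub_eq_zero,
        mem_iInter]
      exact ⟨fun hs => ⟨⟨hs.2, hs.1.1⟩, fun x hx => ⟨hs.2, hs.1.2 x hx⟩⟩,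
        fun hs => ⟨⟨hs.1.2, fun x hx => (hs.2 x hx).2⟩, hs.1.1⟩⟩
    rw [h3]
    exact h1.inter (isClosed_biInter h2)
  have hA : Icc a t ⊆ A := by
    -- The agreement set is closed, and local uniqueness restarted at any of its points extends it
    -- to the right.
    refine hcl.Icc_subset_of_forall_mem_nhdsWithin ⟨hl, hf⟩ ?_
    rintro s ⟨hs, hst⟩
    have hs' : s ∈ Ico a b := hsub (Ico_subset_Icc_self hst)
    obtain ⟨c, hc, hcs⟩ := (h.mono hs'.1 le_rfl).exists_agree (h'.mono hs'.1 le_rfl) hs'.2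
      (hg s hs') hs.1 hs.2
    filter_upwards [Ioc_mem_nhdsGT hc] with q hq
    exact hcs q (Ioc_subset_Icc_self hq)
  exact hA ⟨ht.1, le_rfl⟩

end IsClassical

end InterfaceSystem

end Extruder

end

noncomputable section

namespace Extruder

/-! ### Dilations and translations in `L²` -/

lemma memLp_comp_affine {w : ℝ → ℝ} (hw : MemLp w 2 volume) {A : ℝ} (hA : A ≠ 0) (b : ℝ) :
    MemLp (fun x => w (A * x - b)) 2 volume := by
  have h1 : MemLp (w ∘ fun x => x - b) 2 volume :=
    hw.comp_measurePreserving (measurePreserving_sub_right volume b)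
  have h2 : MemLp (w ∘ fun x => x - b) 2 (Measure.map (fun x => A * x) volume) := by
    rw [Real.map_volume_mul_left hA]
    exact h1.smul_measure ENNReal.ofReal_ne_top
  exact (memLp_map_measure_iff h2.1 (measurable_const_mul A).aemeasurable).1 h2

lemma setIntegral_comp_affine_le {k : ℝ → ℝ} (hk : Integrable k) (hk0 : ∀ x, 0 ≤ k x) {A : ℝ}
    (hA : 0 < A) (b : ℝ) :
    Integrable (fun x => k (A * x - b)) ∧
      ∫ x in Ioo (0 : ℝ) 1, k (A * x - b) ≤ A⁻¹ * ∫ x, k x := by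
  have h1 : Integrable (fun x => k (A * x - b)) :=
    (hk.comp_sub_right b).comp_mul_left' hA.ne'
  refine ⟨h1, (setIntegral_le_integral h1 (Eventually.of_forall fun x => hk0 _)).trans ?_⟩
  rw [Measure.integral_comp_mul_left (fun x => k (x - b)) A, integral_sub_right_eq_self,
    abs_of_pos (inv_pos.2 hA), smul_eq_mul]

/-- Dilations and translations are continuous in `L²`. -/
lemma tendsto_integral_sq_affine {ι : Type*} {𝓕 : Filter ι} [𝓕.IsCountablyGenerated]
    {w : ℝ → ℝ} (hw : MemLp w 2 volume) {c A b : ι → ℝ} {c₀ A₀ b₀ : ℝ} (hc : Tendsto c 𝓕 (𝓝 c₀))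
    (hA : Tendsto A 𝓕 (𝓝 A₀)) (hb : Tendsto b 𝓕 (𝓝 b₀)) (hA₀ : 0 < A₀) :
    Tendsto (fun s => ∫ x in Ioo (0 : ℝ) 1,
      (c s * w (A s * x - b s) - c₀ * w (A₀ * x - b₀)) ^ 2) 𝓕 (𝓝 0) := by
  have hnn : ∀ s, 0 ≤ ∫ x in Ioo (0 : ℝ) 1,
      (c s * w (A s * x - b s) - c₀ * w (A₀ * x - b₀)) ^ 2 :=
    fun s => integral_nonneg fun x => sq_nonneg _
  rw [Metric.tendsto_nhds]
  intro ε hε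
  set q : ℝ := c₀ ^ 2 * A₀⁻¹ with hq
  have hq0 : 0 ≤ q := by positivity
  -- Splitting off the two errors w - g by (a+b+c)² ≤ 3(a²+b²+c²) costs at most 3(q+1)δ + 3qδ =
  -- (6q+3)δ = ε/2; the part with g contributes less than 3 · ε/6.
  set δ : ℝ := ε / (2 * (6 * q + 3)) with hδ
  have hδ0 : 0 < δ := by positivity
  obtain ⟨g, hgc, hgδ, hg, hgL⟩ := MemLp.exists_hasCompactSupport_integral_rpow_sub_le
    (p := 2) (by norm_num) (f := w) (μ := volume) (by simpa using hw) hδ0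
  have hgL' : MemLp g 2 volume := by simpa using hgL
  set k : ℝ → ℝ := fun x => (w x - g x) ^ 2 with hk
  have hkI : Integrable k := (hw.sub hgL').integrable_sq
  have hk0 : ∀ x, 0 ≤ k x := fun x => sq_nonneg _
  have hkδ : ∫ x, k x ≤ δ := by
    refine le_trans (le_of_eq ?_) hgδ
    congr 1; ext x
    rw [Real.rpow_two, Real.norm_eq_abs, sq_abs]
  obtain ⟨Cg, hCg⟩ := hgc.exists_bound_of_continuous hg
  -- For the continuous, compactly supported g this is dominated convergence with a constant
  -- majorant.
  have hJ : Tendsto (fun s => ∫ x in Ioo (0 : ℝ) 1,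
      (c s * g (A s * x - b s) - c₀ * g (A₀ * x - b₀)) ^ 2) 𝓕 (𝓝 0) := by
    suffices h : Tendsto (fun s => ∫ x in Ioo (0 : ℝ) 1,
        (c s * g (A s * x - b s) - c₀ * g (A₀ * x - b₀)) ^ 2) 𝓕 (𝓝 (∫ x in Ioo (0 : ℝ) 1,
        (c₀ * g (A₀ * x - b₀) - c₀ * g (A₀ * x - b₀)) ^ 2)) by simpa using h
    refine tendsto_integral_filter_of_dominated_convergence
      (fun _ => (((|c₀| + 1) + |c₀|) * Cg) ^ 2) ?_ ?_ ?_ ?_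
    · refine Eventually.of_forall fun s => Continuous.aestronglyMeasurable ?_
      fun_prop
    · have := hc.abs.eventually (Iio_mem_nhds (lt_add_one |c₀|))
      filter_upwards [this] with s hs
      refine Eventually.of_forall fun x => ?_
      rw [Real.norm_eq_abs, abs_pow]
      refine pow_le_pow_left₀ (abs_nonneg _) ?_ 2
      refine (abs_sub _ _).trans ?_
      rw [abs_mul, abs_mul, add_mul]
      have h1 := hCg (A s * x - b s)
      have h2 := hCg (A₀ * x - b₀)
      rw [Real.norm_eq_abs] at h1 h2
      have hs' : |c s| ≤ |c₀| + 1 := le_of_lt hs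
      gcongr
    · exact integrable_const _
    · refine Eventually.of_forall fun x => ?_
      refine ((hc.mul ((hg.tendsto _).comp ((hA.mul_const x).sub hb))).sub tendsto_const_nhds).pow 2
  have hcA : Tendsto (fun s => c s ^ 2 * (A s)⁻¹) 𝓕 (𝓝 q) := (hc.pow 2).mul (hA.inv₀ hA₀.ne')
  filter_upwards [hcA.eventually (Iio_mem_nhds (lt_add_one q)), hA.eventually (lt_mem_nhds hA₀),
    hJ.eventually (Iio_mem_nhds (show (0 : ℝ) < ε / 6 by positivity))] with s hs1 hs2 hs3
  replace hs1 : c s ^ 2 * (A s)⁻¹ < q + 1 := hs1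
  replace hs3 : ∫ x in Ioo (0 : ℝ) 1,
      (c s * g (A s * x - b s) - c₀ * g (A₀ * x - b₀)) ^ 2 < ε / 6 := hs3
  rw [Real.dist_eq, sub_zero, abs_of_nonneg (hnn s)]
  obtain ⟨i1, j1⟩ := setIntegral_comp_affine_le hkI hk0 hs2 (b s)
  obtain ⟨i2, j2⟩ := setIntegral_comp_affine_le hkI hk0 hA₀ b₀
  have i3 : IntegrableOn
      (fun x => (c s * g (A s * x - b s) - c₀ * g (A₀ * x - b₀)) ^ 2) (Ioo 0 1) :=
    ((by fun_prop : Continuous fun x =>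
      (c s * g (A s * x - b s) - c₀ * g (A₀ * x - b₀)) ^ 2).integrableOn_Icc (a := 0)
        (b := 1)).mono_set Ioo_subset_Icc_self
  have i1' := (i1.restrict (s := Ioo 0 1)).const_mul (3 * c s ^ 2)
  have i2' := (i2.restrict (s := Ioo 0 1)).const_mul (3 * c₀ ^ 2)
  have i3' := i3.const_mul 3
  have i12 : Integrable (fun x => 3 * c s ^ 2 * k (A s * x - b s) + 3 * c₀ ^ 2 * k (A₀ * x - b₀))
      (volume.restrict (Ioo 0 1)) := i1'.add i2'
  have i123 : Integrable (fun x => 3 * c s ^ 2 * k (A s * x - b s) +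
      3 * c₀ ^ 2 * k (A₀ * x - b₀) +
      3 * (c s * g (A s * x - b s) - c₀ * g (A₀ * x - b₀)) ^ 2)
      (volume.restrict (Ioo 0 1)) := i12.add i3'
  have hle : ∫ x in Ioo (0 : ℝ) 1, (c s * w (A s * x - b s) - c₀ * w (A₀ * x - b₀)) ^ 2 ≤
      ∫ x in Ioo (0 : ℝ) 1, (3 * c s ^ 2 * k (A s * x - b s) + 3 * c₀ ^ 2 * k (A₀ * x - b₀) +
        3 * (c s * g (A s * x - b s) - c₀ * g (A₀ * x - b₀)) ^ 2) := by
    refine integral_mono_of_nonneg (Eventually.of_forall fun x => sq_nonneg _) i123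
      (Eventually.of_forall fun x => ?_)
    simp only [hk]
    generalize w (A s * x - b s) = w1
    generalize w (A₀ * x - b₀) = w2
    generalize g (A s * x - b s) = g1
    generalize g (A₀ * x - b₀) = g2
    nlinarith [sq_nonneg (c s * (w1 - g1) + c₀ * (w2 - g2)),
      sq_nonneg (c s * (w1 - g1) - (c s * g1 - c₀ * g2)),
      sq_nonneg (c₀ * (w2 - g2) + (c s * g1 - c₀ * g2))]
  rw [integral_add i12 i3', integral_add i1' i2', integral_const_mul, integral_const_mul,
    integral_const_mul] at hle
  have k1 : c s ^ 2 * ∫ x in Ioo (0 : ℝ) 1, k (A s * x - b s) ≤ (q + 1) * δ := by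
    have h0 : 0 ≤ ∫ x, k x := integral_nonneg hk0
    have : c s ^ 2 * ∫ x in Ioo (0 : ℝ) 1, k (A s * x - b s) ≤
        c s ^ 2 * ((A s)⁻¹ * ∫ x, k x) := by gcongr
    refine this.trans ?_
    rw [← mul_assoc]
    exact mul_le_mul hs1.le hkδ h0 (by linarith)
  have k2 : c₀ ^ 2 * ∫ x in Ioo (0 : ℝ) 1, k (A₀ * x - b₀) ≤ q * δ := by
    have : c₀ ^ 2 * ∫ x in Ioo (0 : ℝ) 1, k (A₀ * x - b₀) ≤
        c₀ ^ 2 * (A₀⁻¹ * ∫ x, k x) := by gcongr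
    refine this.trans ?_
    rw [← mul_assoc]
    exact mul_le_mul_of_nonneg_left hkδ hq0
  have k3 : (6 * q + 3) * δ = ε / 2 := by rw [hδ]; field_simp
  linarith

/-! ### Transported profiles -/

/-- `Φ` is an `H²` function on `[m,M]` with first derivative `P` and second weak derivative `w`. -/
structure IsProfile (m M : ℝ) (Φ P w : ℝ → ℝ) : Prop where
  memLp : MemLp w 2 volume
  P_sub : ∀ x ∈ Icc m M, ∀ y ∈ Icc m M, P y - P x = ∫ z in x..y, w z
  Φ_sub : ∀ x ∈ Icc m M, ∀ y ∈ Icc m M, Φ y - Φ x = ∫ z in x..y, P z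

namespace IsProfile

variable {m M : ℝ} {Φ P w : ℝ → ℝ}

lemma continuousOn_of_sub {P w : ℝ → ℝ} (hw : LocallyIntegrableOn w (Icc m M))
    (h : ∀ x ∈ Icc m M, ∀ y ∈ Icc m M, P y - P x = ∫ z in x..y, w z) :
    ContinuousOn P (Icc m M) := by
  rcases lt_or_ge M m with hmM | hmM
  · simp [Icc_eq_empty (not_le.2 hmM)]
  have hm : m ∈ Icc m M := ⟨le_rfl, hmM⟩
  have h1 := intervalIntegral.continuousOn_primitive_interval' (μ := volume) (f := w) (a := m)
    (b₁ := m) (b₂ := M) (intervalIntegrable_of_locallyIntegrableOn hw hm ⟨hmM, le_rfl⟩) (by simp)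
  rw [uIcc_of_le hmM] at h1
  refine (continuousOn_const (c := P m)).add h1 |>.congr fun x hx => ?_
  simp only [Pi.add_apply, ← h m hm x hx]; ring

lemma continuousOn_P (h : IsProfile m M Φ P w) : ContinuousOn P (Icc m M) :=
  continuousOn_of_sub ((h.memLp.locallyIntegrable (by norm_num)).locallyIntegrableOn _) h.P_sub

lemma continuousOn_Φ (h : IsProfile m M Φ P w) : ContinuousOn Φ (Icc m M) :=
  continuousOn_of_sub (h.continuousOn_P.locallyIntegrableOn measurableSet_Icc) h.Φ_sub

lemma hasDerivWithinAt (h : IsProfile m M Φ P w) {x : ℝ} (hx : x ∈ Icc m M) :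
    HasDerivWithinAt Φ (P x) (Icc m M) x := by
  have hm : m ∈ Icc m M := ⟨le_rfl, hx.1.trans hx.2⟩
  have : Fact (x ∈ Icc m M) := ⟨hx⟩
  have h1 : HasDerivWithinAt (fun y => Φ m + ∫ z in m..y, P z) (P x) (Icc m M) x := by
    refine (intervalIntegral.integral_hasDerivWithinAt_right (t := Icc m M) ?_ ?_
      (h.continuousOn_P x hx)).const_add _
    · exact (h.continuousOn_P.mono (ordConnected_Icc.uIcc_subset hm hx)).intervalIntegrable
    · exact ⟨Icc m M, self_mem_nhdsWithin,
        h.continuousOn_P.aestronglyMeasurable measurableSet_Icc⟩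
  refine h1.congr (fun y hy => ?_) ?_
  · rw [← h.Φ_sub m hm y hy]; ring
  · rw [← h.Φ_sub m hm x hx]; ring

lemma isH2 (h : IsProfile m M Φ P w) {A b : ℝ} (hA : A ≠ 0)
    (hAb : ∀ x ∈ Icc (0 : ℝ) 1, A * x - b ∈ Icc m M) :
    IsH2 (fun x => Φ (A * x - b)) (fun x => A * P (A * x - b))
      (fun x => A ^ 2 * w (A * x - b)) := by
  have h0 := hAb 0 (by simp)
  refine ⟨((memLp_comp_affine h.memLp hA b).const_mul (A ^ 2)).restrict _, fun x hx => ?_,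
    fun x hx => ?_⟩
  · rw [intervalIntegral.integral_const_mul, intervalIntegral.integral_comp_mul_sub w hA,
      ← h.P_sub _ h0 _ (hAb x hx), smul_eq_mul]
    field_simp
    ring
  · rw [intervalIntegral.integral_const_mul, intervalIntegral.integral_comp_mul_sub P hA,
      ← h.Φ_sub _ h0 _ (hAb x hx), smul_eq_mul]
    field_simp
    ring

/-- The squared H² distance is a sum of three L² errors of dilated and translated functions, with
prefactors 1, A and A². Φ and P are cut off to [m,M] only to lie in L²(ℝ). -/
lemma h2ContinuousOn (h : IsProfile m M Φ P w) {S : Set ℝ} {A b : ℝ → ℝ} (hA : ContinuousOn A S)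
    (hb : ContinuousOn b S) (hA0 : ∀ t ∈ S, 0 < A t)
    (hAb : ∀ t ∈ S, ∀ x ∈ Icc (0 : ℝ) 1, A t * x - b t ∈ Icc m M) :
    H2ContinuousOn S (fun t x => Φ (A t * x - b t)) := by
  have hH := fun t ht => h.isH2 (hA0 t ht).ne' (hAb t ht)
  refine ⟨fun t ht => (hH t ht).memH2, fun t ht => ?_⟩
  have hind : ∀ {k : ℝ → ℝ}, ContinuousOn k (Icc m M) →
      MemLp ((Icc m M).indicator k) 2 volume := by
    intro k hk
    obtain ⟨C, hC⟩ := isCompact_Icc.exists_bound_of_continuousOn hk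
    rw [memLp_indicator_iff_restrict measurableSet_Icc]
    refine MemLp.of_bound (hk.aestronglyMeasurable measurableSet_Icc) C ?_
    rw [ae_restrict_iff' measurableSet_Icc]
    exact Eventually.of_forall hC
  have hAt := hA t ht
  have hbt := hb t ht
  have c0 := tendsto_integral_sq_affine (𝓕 := 𝓝[S] t) (hind h.continuousOn_Φ)
    (c := fun _ => 1) tendsto_const_nhds hAt hbt (hA0 t ht)
  have c1 := tendsto_integral_sq_affine (𝓕 := 𝓝[S] t) (hind h.continuousOn_P) hAt hAt hbt
    (hA0 t ht)
  have c2 := tendsto_integral_sq_affine (𝓕 := 𝓝[S] t) h.memLp (hAt.pow 2) hAt hbt (hA0 t ht)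
  have key := (c0.add c1).add c2
  rw [add_zero, add_zero] at key
  refine key.congr' ?_
  filter_upwards [self_mem_nhdsWithin] with s hs
  rw [((hH s hs).sub (hH t ht)).h2NormSq_eq]
  have e : ∀ k : ℝ → ℝ, ∀ q ∈ S, ∀ x ∈ Ioo (0 : ℝ) 1,
      (Icc m M).indicator k (A q * x - b q) = k (A q * x - b q) := fun k q hq x hx =>
    indicator_of_mem (hAb q hq x (Ioo_subset_Icc_self hx)) k
  congr 2
  · refine setIntegral_congr_fun measurableSet_Ioo fun x hx => ?_
    simp only [e _ s hs x hx, e _ t ht x hx, one_mul]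
  · refine setIntegral_congr_fun measurableSet_Ioo fun x hx => ?_
    simp only [e _ s hs x hx, e _ t ht x hx]

end IsProfile

/-- Gluing an `H²` function on `[0,1]`, rescaled to `[0,l₀]`, with a `W^{2,∞}` function on
`[-σ,0]`. -/
lemma exists_isProfile {u v w B B' : ℝ → ℝ} {l₀ σ : ℝ} (hu : IsH2 u v w) (hl₀ : 0 < l₀)
    (hσ : 0 < σ) (hB : ∀ z ∈ Icc 0 σ, HasDerivWithinAt B (B' z) (Icc 0 σ) z) {K : NNReal}
    (hB' : LipschitzOnWith K B' (Icc 0 σ)) (h0 : B 0 = u 0) (h1 : -B' 0 = v 0 / l₀) :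
    ∃ P W, IsProfile (-σ) l₀ (fun ξ => if ξ < 0 then B (-ξ) else u (ξ / l₀)) P W := by
  set Q : ℝ → ℝ := fun ξ => -B' (-ξ) with hQ
  have hQL : LipschitzOnWith K Q (Icc (-σ) 0) := by
    have h2 : LipschitzOnWith 1 (fun ξ : ℝ => -ξ) (Icc (-σ) 0) := LipschitzWith.id.neg.lipschitzOnWith
    have := (hB'.comp h2 fun ξ hξ => ⟨by linarith [hξ.2], by linarith [hξ.1]⟩).neg
    rwa [mul_one] at this
  -- A Lipschitz function is absolutely continuous, so its almost-everywhere derivative recovers it;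
  -- `deriv Q` is the second derivative of the boundary branch.
  have hQAC : ∀ y ∈ Icc (-σ) 0, ∫ z in y..0, deriv Q z = Q 0 - Q y := by
    intro y hy
    refine AbsolutelyContinuousOnInterval.integral_deriv_eq_sub
      (LipschitzOnWith.absolutelyContinuousOnInterval (K := K) ?_)
    rw [uIcc_of_le hy.2]
    exact hQL.mono (Icc_subset_Icc_left hy.1)
  set W₀ : ℝ → ℝ := (Icc 0 1).indicator w with hW₀
  have hW₀L : MemLp W₀ 2 volume := by
    rw [hW₀, memLp_indicator_iff_restrict measurableSet_Icc,
      ← Measure.restrict_congr_set Ioo_ae_eq_Icc]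
    exact hu.memLp
  set W₁ : ℝ → ℝ := (Ioo (-σ) 0).indicator (deriv Q) with hW₁
  have hW₁L : MemLp W₁ 2 volume := by
    rw [hW₁, memLp_indicator_iff_restrict measurableSet_Ioo]
    refine MemLp.of_bound (measurable_deriv Q).aestronglyMeasurable K ?_
    rw [ae_restrict_iff' measurableSet_Ioo]
    exact Eventually.of_forall fun x hx =>
      norm_deriv_le_of_lipschitzOn (Icc_mem_nhds hx.1 hx.2) hQL
  set W₂ : ℝ → ℝ := fun ξ => l₀⁻¹ ^ 2 * W₀ (l₀⁻¹ * ξ - 0) with hW₂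
  have hW₂L : MemLp W₂ 2 volume := (memLp_comp_affine hW₀L (inv_ne_zero hl₀.ne') 0).const_mul _
  set W : ℝ → ℝ := fun ξ => W₁ ξ + W₂ ξ with hW
  have hWL : MemLp W 2 volume := hW₁L.add hW₂L
  have hWi : ∀ x y, IntervalIntegrable W volume x y := fun x y =>
    intervalIntegrable_of_locallyIntegrableOn (U := univ)
      ((hWL.locallyIntegrable (by norm_num)).locallyIntegrableOn _) trivial trivial
  set P : ℝ → ℝ := fun ξ => if ξ < 0 then Q ξ else v (ξ / l₀) / l₀ with hP
  set Φ : ℝ → ℝ := fun ξ => if ξ < 0 then B (-ξ) else u (ξ / l₀) with hΦ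
  have hQ0 : Q 0 = v 0 / l₀ := by simp only [hQ, neg_zero, h1]
  have hP0 : P 0 = v 0 / l₀ := by simp [hP]
  have hΦ0 : Φ 0 = u 0 := by simp [hΦ]
  have hunit : ∀ y ∈ Icc (0 : ℝ) l₀, y / l₀ ∈ Icc (0 : ℝ) 1 := fun y hy =>
    ⟨div_nonneg hy.1 hl₀.le, (div_le_one hl₀).2 hy.2⟩
  -- At the gluing point the integrands below may differ: the indicator in `W₁` excludes 0 and the
  -- one in `W₀` includes it.
  have hne : ∀ᵐ x : ℝ, x ≠ 0 := by simp [ae_iff]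
  have hPW : ∀ y ∈ Icc (-σ) l₀, P y - P 0 = ∫ z in (0 : ℝ)..y, W z := by
    intro y hy
    rcases lt_or_ge y 0 with hy0 | hy0
    · have e : ∫ z in y..0, W z = ∫ z in y..0, deriv Q z := by
        apply intervalIntegral.integral_congr_ae
        filter_upwards [hne] with z hz hz'
        rw [uIoc_of_le hy0.le] at hz'
        have hz0 : z < 0 := lt_of_le_of_ne hz'.2 hz
        simp only [hW, hW₁, hW₂, hW₀]
        rw [indicator_of_mem (show z ∈ Ioo (-σ) 0 from ⟨hy.1.trans_lt hz'.1, hz0⟩),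
          indicator_of_notMem, mul_zero, add_zero]
        intro hmem
        have : l₀⁻¹ * z < 0 := mul_neg_of_pos_of_neg (inv_pos.2 hl₀) hz0
        linarith [hmem.1]
      rw [intervalIntegral.integral_symm, e, hQAC y ⟨hy.1, hy0.le⟩, hP0, hQ0]
      simp only [hP, if_pos hy0]
      ring
    · have hyl : y ∈ Icc 0 l₀ := ⟨hy0, hy.2⟩
      have e : ∫ z in (0 : ℝ)..y, W z = ∫ z in (0 : ℝ)..y, l₀⁻¹ ^ 2 * w (z / l₀) := by
        apply intervalIntegral.integral_congr
        intro z hz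
        rw [uIcc_of_le hy0] at hz
        simp only [hW, hW₁, hW₂, hW₀]
        rw [indicator_of_notMem (fun h => absurd h.2 (not_lt.2 hz.1)), zero_add, sub_zero,
          ← div_eq_inv_mul, indicator_of_mem (hunit z ⟨hz.1, hz.2.trans hy.2⟩)]
      rw [e, intervalIntegral.integral_const_mul, intervalIntegral.integral_comp_div w hl₀.ne',
        zero_div, ← hu.v_sub (by simp) (hunit y hyl), hP0, smul_eq_mul]
      simp only [hP, if_neg (not_lt.2 hy0)]
      field_simp
  have hPsub : ∀ x ∈ Icc (-σ) l₀, ∀ y ∈ Icc (-σ) l₀, P y - P x = ∫ z in x..y, W z := by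
    intro x hx y hy
    have := intervalIntegral.integral_interval_sub_left (hWi 0 y) (hWi 0 x)
    rw [← this, ← hPW x hx, ← hPW y hy]
    ring
  have hPc : ContinuousOn P (Icc (-σ) l₀) :=
    IsProfile.continuousOn_of_sub
      ((hWL.locallyIntegrable (by norm_num)).locallyIntegrableOn _) hPsub
  have h0m : (0 : ℝ) ∈ Icc (-σ) l₀ := ⟨by linarith, hl₀.le⟩
  have hPi : ∀ x ∈ Icc (-σ) l₀, ∀ y ∈ Icc (-σ) l₀, IntervalIntegrable P volume x y :=
    fun x hx y hy => (hPc.mono (ordConnected_Icc.uIcc_subset hx hy)).intervalIntegrable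
  have hΦP : ∀ y ∈ Icc (-σ) l₀, Φ y - Φ 0 = ∫ z in (0 : ℝ)..y, P z := by
    intro y hy
    rcases lt_or_ge y 0 with hy0 | hy0
    · have e : ∫ z in y..0, P z = ∫ z in y..0, -B' (-z) := by
        apply intervalIntegral.integral_congr
        intro z hz
        rw [uIcc_of_le hy0.le] at hz
        rcases hz.2.lt_or_eq with hz0 | rfl
        · simp only [hP, if_pos hz0, hQ]
        · rw [hP0, ← hQ0]
      have hsub : Icc 0 (-y) ⊆ Icc 0 σ := Icc_subset_Icc_right (by linarith [hy.1])
      have e2 : ∫ z in (0 : ℝ)..(-y), B' z = B (-y) - B 0 := by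
        refine intervalIntegral.integral_eq_sub_of_hasDerivAt_of_le (by linarith) ?_ ?_ ?_
        · exact fun z hz => ((hB z (hsub hz)).mono hsub).continuousWithinAt
        · exact fun z hz => (hB z (hsub (Ioo_subset_Icc_self hz))).hasDerivAt
            (Icc_mem_nhds hz.1 (hz.2.trans_le (by linarith [hy.1])))
        · refine (hB'.continuousOn.mono ?_).intervalIntegrable
          rwa [uIcc_of_le (by linarith)]
      rw [intervalIntegral.integral_symm, e, intervalIntegral.integral_neg,
        intervalIntegral.integral_comp_neg B', neg_zero, e2, hΦ0, ← h0]
      simp only [hΦ, if_pos hy0]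
      ring
    · have hyl : y ∈ Icc 0 l₀ := ⟨hy0, hy.2⟩
      have e : ∫ z in (0 : ℝ)..y, P z = ∫ z in (0 : ℝ)..y, l₀⁻¹ * v (z / l₀) := by
        apply intervalIntegral.integral_congr
        intro z hz
        rw [uIcc_of_le hy0] at hz
        simp only [hP, if_neg (not_lt.2 hz.1), div_eq_inv_mul (v _)]
      rw [e, intervalIntegral.integral_const_mul, intervalIntegral.integral_comp_div v hl₀.ne',
        zero_div, ← hu.u_sub (by simp) (hunit y hyl), hΦ0, smul_eq_mul]
      simp only [hΦ, if_neg (not_lt.2 hy0)]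
      field_simp
  refine ⟨P, W, hWL, hPsub, fun x hx y hy => ?_⟩
  have := intervalIntegral.integral_interval_sub_left (hPi 0 h0m y hy) (hPi 0 h0m x hx)
  rw [← this, ← hΦP x hx, ← hΦP y hy]
  ring

end Extruder

end

noncomputable section

namespace Extruder

/-! ### Ordinary differential equations with bounded Lipschitz right-hand sides -/

/-- Since the field is globally defined and bounded, Picard–Lindelöf works on any prescribed length
σ, whatever the Lipschitz constant K. This is why the lifespan in `exists_local` does not depend on
the slope of the datum. -/
lemma exists_solution_of_bounded {v : ℝ → ℝ → ℝ} {K M : NNReal} (hv : ∀ t, LipschitzWith K (v t))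
    (hc : ∀ x, Continuous fun t => v t x) (hM : ∀ t x, |v t x| ≤ M) {σ : ℝ} (hσ : 0 ≤ σ)
    (x₀ : ℝ) :
    ∃ α : ℝ → ℝ, α 0 = x₀ ∧
      (∀ t ∈ Icc (-σ) σ, HasDerivWithinAt α (v t (α t)) (Icc (-σ) σ) t) ∧
      LipschitzOnWith M α (Icc (-σ) σ) ∧ ∀ t ∈ Icc (-σ) σ, |α t - x₀| ≤ M * σ := by
  have h0 : (0 : ℝ) ∈ Icc (-σ) σ := ⟨by linarith, hσ⟩
  have hPL : IsPicardLindelof v (⟨0, h0⟩ : Icc (-σ) σ) x₀ (M * ⟨σ, hσ⟩) 0 M K := by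
    refine ⟨fun t _ => (hv t).lipschitzOnWith, fun x _ => (hc x).continuousOn,
      fun t _ x _ => hM t x, ?_⟩
    simp only [sub_zero, zero_sub, neg_neg, max_self, NNReal.coe_zero]
    exact le_rfl
  obtain ⟨α, hα0, hα⟩ := hPL.exists_eq_forall_mem_Icc_hasDerivWithinAt₀
  have hL : LipschitzOnWith M α (Icc (-σ) σ) :=
    (convex_Icc _ _).lipschitzOnWith_of_nnnorm_hasDerivWithin_le hα fun t _ => hM _ _
  refine ⟨α, hα0, hα, hL, fun t ht => ?_⟩
  have h1 := hL.dist_le_mul t ht 0 h0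
  have hα0' : α 0 = x₀ := hα0
  rw [hα0', Real.dist_eq, Real.dist_eq, sub_zero] at h1
  refine h1.trans ?_
  gcongr
  exact abs_le.2 ht

/-- The projection to `[a,b]`. -/
def clampTo (a b x : ℝ) : ℝ := max a (min b x)

lemma clampTo_mem {a b : ℝ} (hab : a ≤ b) (x : ℝ) : clampTo a b x ∈ Icc a b :=
  ⟨le_max_left _ _, max_le hab (min_le_left _ _)⟩

lemma clampTo_of_mem {a b x : ℝ} (hx : x ∈ Icc a b) : clampTo a b x = x := by
  unfold clampTo
  rw [min_eq_right hx.2, max_eq_right hx.1]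

lemma lipschitzWith_clampTo (a b : ℝ) : LipschitzWith 1 (clampTo a b) :=
  (LipschitzWith.id.const_min b).const_max a

lemma exists_lipschitzOnWith_mul {g h : ℝ → ℝ} {K K' : NNReal} {a b : ℝ}
    (hg : LipschitzOnWith K g (Icc a b)) (hh : LipschitzOnWith K' h (Icc a b)) :
    ∃ C, LipschitzOnWith C (fun x => g x * h x) (Icc a b) := by
  obtain ⟨A, hA⟩ := isCompact_Icc.exists_bound_of_continuousOn hg.continuousOn
  obtain ⟨B, hB⟩ := isCompact_Icc.exists_bound_of_continuousOn hh.continuousOn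
  refine ⟨A.toNNReal * K' + B.toNNReal * K, LipschitzOnWith.of_dist_le_mul fun x hx y hy => ?_⟩
  have h1 := hg.dist_le_mul x hx y hy
  have h2 := hh.dist_le_mul x hx y hy
  rw [Real.dist_eq] at h1 h2 ⊢
  have e : g x * h x - g y * h y = g x * (h x - h y) + h y * (g x - g y) := by ring
  rw [e]
  refine (abs_add_le _ _).trans ?_
  rw [abs_mul, abs_mul]
  push_cast
  rw [add_mul, mul_assoc, mul_assoc]
  have hA' : |g x| ≤ A.toNNReal := (hA x hx).trans (Real.le_coe_toNNReal A)
  have hB' : |h y| ≤ B.toNNReal := (hB y hy).trans (Real.le_coe_toNNReal B)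
  gcongr

namespace InterfaceSystem

variable {S : InterfaceSystem}

/-- The factor 2 leaves room for the interface to move by r from a datum within r of lₑ. The filling
ratio needs no extra room: for short times f(t,1) is a value of the initial datum. -/
lemma exists_box {lₑ fₑ : ℝ} (hg : (lₑ, fₑ) ∈ S.good) :
    ∃ r > 0, Icc (lₑ - 2 * r) (lₑ + 2 * r) ×ˢ Icc (fₑ - r) (fₑ + r) ⊆ S.good := by
  obtain ⟨ρ, hρ, hs⟩ := Metric.isOpen_iff.1 S.isOpen_good _ hg
  refine ⟨ρ / 3, by positivity, fun z hz => hs ?_⟩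
  rw [Metric.mem_ball, Prod.dist_eq, max_lt_iff, Real.dist_eq, Real.dist_eq, abs_lt, abs_lt]
  obtain ⟨⟨h1, h2⟩, h3, h4⟩ := hz
  refine ⟨⟨?_, ?_⟩, ?_, ?_⟩ <;> simp only <;> linarith

/-- Local existence of classical solutions, with uniform bounds and a uniform time of existence
for data close to a good constant state. -/
theorem exists_local {lₑ fₑ : ℝ} (hg : (lₑ, fₑ) ∈ S.good) :
    ∃ r > 0, ∃ τ > 0, ∃ C,
      (∀ l φ, |l - lₑ| ≤ r → |φ - fₑ| ≤ r → (l, φ) ∈ S.good ∧ |l| ≤ C ∧ |S.F l φ| ≤ C) ∧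
      ∀ (l₀ : ℝ) (f₀ : ℝ → ℝ), MemH2 f₀ → |l₀ - lₑ| ≤ r →
        (∀ x ∈ Icc (0 : ℝ) 1, |f₀ x - fₑ| ≤ r) → f₀ 0 = S.β l₀ →
        deriv S.β l₀ * S.F l₀ (f₀ 1) + S.n l₀ / l₀ * derivWithin f₀ (Icc 0 1) 0 = 0 →
        ∃ l f, S.IsClassical 0 τ l f ∧ l 0 = l₀ ∧ (∀ x ∈ Icc (0 : ℝ) 1, f 0 x = f₀ x) ∧
          ∀ t ∈ Ico 0 τ, (l t, f t 1) ∈ S.good ∧ |l t| ≤ C ∧ |S.F (l t) (f t 1)| ≤ C := by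
  obtain ⟨r, hr, hbox⟩ := exists_box hg
  set I := Icc (lₑ - 2 * r) (lₑ + 2 * r) with hI
  set J := Icc (fₑ - r) (fₑ + r) with hJ
  have hIJc : IsCompact (I ×ˢ J) := isCompact_Icc.prod isCompact_Icc
  have hIle : lₑ - 2 * r ≤ lₑ + 2 * r := by linarith
  have hfeJ : fₑ ∈ J := ⟨by linarith, by linarith⟩
  have hnI : ∀ x ∈ I, ContDiffAt ℝ 2 S.n x := fun x hx =>
    S.n_smooth (x, fₑ) (hbox ⟨hx, hfeJ⟩).1
  have hβI : ∀ x ∈ I, ContDiffAt ℝ 2 S.β x := fun x hx =>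
    S.β_smooth (x, fₑ) (hbox ⟨hx, hfeJ⟩).1
  have hnpos : ∀ x ∈ I, 0 < S.n x := fun x hx => (hbox (⟨hx, hfeJ⟩ : (x, fₑ) ∈ I ×ˢ J)).2.2.1
  -- The slope dl/dZ. With the travelled distance as independent variable, the position solves a
  -- scalar ODE and the boundary input is directly a function of ξ = -Z; time is recovered
  -- afterwards from Z' = n(lam(Z)).
  set G : ℝ × ℝ → ℝ := fun z => S.F z.1 z.2 / S.n z.1 with hG
  have hGs : ∀ z ∈ I ×ˢ J, ContDiffAt ℝ 1 G z := by
    intro z hz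
    refine ContDiffAt.div (S.F_smooth z (hbox hz).1) ?_ (hnpos _ hz.1).ne'
    exact ContDiffAt.comp (g := S.n) z ((hnI _ hz.1).of_le (by norm_num)) contDiffAt_fst
  obtain ⟨KG, hKG⟩ := ContDiffOn.exists_lipschitzOnWith (n := 1)
    (fun z hz => (hGs z hz).contDiffWithinAt) (by norm_num)
    ((convex_Icc _ _).prod (convex_Icc _ _)) hIJc
  obtain ⟨Kn, hKn⟩ := ContDiffOn.exists_lipschitzOnWith (n := 2) (s := I) (f := S.n)
    (fun z hz => (hnI z hz).contDiffWithinAt) (by norm_num) (convex_Icc _ _) isCompact_Icc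
  obtain ⟨Kβ, hKβ⟩ := ContDiffOn.exists_lipschitzOnWith (n := 1) (s := I) (f := deriv S.β)
    (fun z hz => by
      have h1 : ContDiffAt ℝ 1 (fderiv ℝ S.β) z := (hβI z hz).fderiv_right (by norm_num)
      exact (h1.clm_apply contDiffAt_const).contDiffWithinAt) (by norm_num) (convex_Icc _ _)
    isCompact_Icc
  obtain ⟨MG, hMG⟩ := hIJc.exists_bound_of_continuousOn hKG.continuousOn
  obtain ⟨Mn, hMn⟩ := isCompact_Icc.exists_bound_of_continuousOn hKn.continuousOn
  obtain ⟨MF, hMF⟩ := hIJc.exists_bound_of_continuousOn (f := Function.uncurry S.F)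
    fun z hz => (S.F_smooth z (hbox hz).1).continuousAt.continuousWithinAt
  have hMG' : ∀ z ∈ I ×ˢ J, |G z| ≤ MG.toNNReal := fun z hz =>
    (hMG z hz).trans (Real.le_coe_toNNReal _)
  have hMn' : ∀ z ∈ I, |S.n z| ≤ Mn.toNNReal := fun z hz =>
    (hMn z hz).trans (Real.le_coe_toNNReal _)
  set M := MG.toNNReal
  set N := Mn.toNNReal
  -- For |z| ≤ σ the position moves by at most Mσ ≤ r and stays in I. Since l₀ > r = (M + 1)σ, also
  -- lam z - z ≥ 0 for 0 ≤ z ≤ σ/2, so x = 1 still sees the initial datum. No constant depending on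
  -- f₀ enters.
  set σ : ℝ := r / (M + 1) with hσdef
  have hσ : 0 < σ := by positivity
  have hσr : (M + 1) * σ = r := by rw [hσdef]; field_simp
  -- Chosen so that |Z| ≤ Nτ ≤ σ/2, strictly inside the interval where `lam` solves its equation.
  set τ : ℝ := σ / (2 * (N + 1)) with hτdef
  have hτ : 0 < τ := by positivity
  have hτσ : N * τ ≤ σ / 2 := by
    have : (N + 1) * τ = σ / 2 := by rw [hτdef]; field_simp
    linarith
  refine ⟨r, hr, τ, hτ, max (|lₑ| + 2 * r) MF, ?_, ?_⟩
  · intro l φ hl hφ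
    rw [abs_le] at hl hφ
    have hz : (l, φ) ∈ I ×ˢ J := ⟨⟨by linarith, by linarith⟩, ⟨by linarith, by linarith⟩⟩
    refine ⟨hbox hz, (?_ : _ ≤ _).trans (le_max_left _ _), (hMF _ hz).trans (le_max_right _ _)⟩
    have : |l| ≤ |lₑ| + |l - lₑ| := by simpa using abs_add_le lₑ (l - lₑ)
    refine this.trans ?_
    have := abs_le.2 hl
    linarith
  intro l₀ f₀ hf₀ hl₀ hf₀r hcomp0 hcomp1
  obtain ⟨w, hw⟩ := hf₀.exists_isH2
  obtain ⟨K₁, hK₁⟩ := hf₀.exists_lipschitzWith_clampExtend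
  rw [abs_le] at hl₀
  have hl₀I : l₀ ∈ I := ⟨by linarith, by linarith⟩
  have hIpos : ∀ x ∈ I, 0 < x := fun x hx => (hbox (⟨hx, hfeJ⟩ : (x, fₑ) ∈ I ×ˢ J)).2.1
  have hl₀pos : 0 < l₀ := hIpos _ hl₀I
  have hl₀r : r < l₀ := by
    have := hIpos (lₑ - 2 * r) ⟨le_rfl, hIle⟩
    linarith
  have hEJ : ∀ y, clampExtend f₀ y ∈ J := by
    intro y
    have := abs_le.1 (hf₀r _ (clamp_mem y))
    exact ⟨by unfold clampExtend; linarith, by unfold clampExtend; linarith⟩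
  set c : ℝ → ℝ := clampTo (lₑ - 2 * r) (lₑ + 2 * r) with hc
  have hcI : ∀ x, c x ∈ I := clampTo_mem hIle
  -- Both arguments are clamped to make the field global; along the solution the clamps are inactive
  -- (`hv_eq`, `hEz`).
  let v : ℝ → ℝ → ℝ := fun z x => G (c x, clampExtend f₀ ((x - z) / l₀))
  have hvL : ∀ z, LipschitzWith (KG * max 1 (K₁ * (‖l₀⁻¹‖₊ * 1))) (v z) := by
    intro z
    have h1 : LipschitzWith (‖l₀⁻¹‖₊ * 1) (fun x : ℝ => (x - z) / l₀) := by
      have h2 := (lipschitzWith_smul (β := ℝ) l₀⁻¹).comp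
        (LipschitzWith.of_dist_le_mul (K := 1) (f := fun x : ℝ => x - z) (by simp))
      convert! h2 using 2 with y
      simp [div_eq_inv_mul]
    have h2 := (lipschitzWith_clampTo (lₑ - 2 * r) (lₑ + 2 * r)).prodMk (hK₁.comp h1)
    have h3 := hKG.comp h2.lipschitzOnWith (s := univ) fun x _ => ⟨hcI x, hEJ _⟩
    rwa [lipschitzOnWith_univ] at h3
  have hvc : ∀ x, Continuous fun z => v z x := by
    intro x
    have h1 : Continuous fun z : ℝ => (c x, clampExtend f₀ ((x - z) / l₀)) := by
      have := hK₁.continuous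
      fun_prop
    exact hKG.continuousOn.comp_continuous h1 fun z => ⟨hcI x, hEJ _⟩
  obtain ⟨lam, hlam0, hlamd, hlamL, hlamb⟩ := exists_solution_of_bounded hvL hvc
    (fun z x => hMG' _ ⟨hcI x, hEJ _⟩) hσ.le l₀
  have hlamr : ∀ z ∈ Icc (-σ) σ, |lam z - l₀| ≤ M * σ := hlamb
  have hlamI : ∀ z ∈ Icc (-σ) σ, lam z ∈ I := by
    intro z hz
    have := abs_le.1 (hlamr z hz)
    exact ⟨by linarith, by linarith⟩
  have hv_eq : ∀ z ∈ Icc (-σ) σ, v z (lam z) = G (lam z, clampExtend f₀ ((lam z - z) / l₀)) := by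
    intro z hz
    simp only [v, hc, clampTo_of_mem (hlamI z hz)]
  let cs : ℝ → ℝ := clampTo (-σ) σ
  have hcs : ∀ x, cs x ∈ Icc (-σ) σ := clampTo_mem (by linarith)
  have hzL : LipschitzWith (Kn * (M * 1)) fun x => S.n (lam (cs x)) := by
    have h1 := (hKn.comp hlamL fun z hz => hlamI z hz).comp
      (lipschitzWith_clampTo (-σ) σ).lipschitzOnWith (s := univ) fun x _ => hcs x
    rw [lipschitzOnWith_univ] at h1
    rw [← mul_assoc]
    exact h1
  obtain ⟨Z, hZ0, hZd, hZL, hZb⟩ := exists_solution_of_bounded (v := fun _ x => S.n (lam (cs x)))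
    (fun _ => hzL) (fun _ => continuous_const) (fun _ x => hMn' _ (hlamI _ (hcs x))) hτ.le 0
  have hZσ : ∀ t ∈ Ico 0 τ, |Z t| ≤ σ / 2 := fun t ht => by
    simpa using (hZb t ⟨by linarith [ht.1], ht.2.le⟩).trans hτσ
  have hZm : ∀ t ∈ Ico 0 τ, Z t ∈ Ioo (-σ) σ := fun t ht => by
    have := abs_le.1 (hZσ t ht)
    exact ⟨by linarith, by linarith⟩
  have hZd' : ∀ t ∈ Ico 0 τ, HasDerivAt Z (S.n (lam (Z t))) t := fun t ht => by
    have h1 := (hZd t ⟨by linarith [ht.1], ht.2.le⟩).hasDerivAt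
      (Icc_mem_nhds (by linarith [ht.1]) ht.2)
    simp only [cs, clampTo_of_mem (Ioo_subset_Icc_self (hZm t ht))] at h1
    exact h1
  set E : ℝ → ℝ := fun z => clampExtend f₀ ((lam z - z) / l₀) with hE
  have hlamd' : ∀ z ∈ Ioo (-σ) σ, HasDerivAt lam (G (lam z, E z)) z := fun z hz => by
    have h1 := (hlamd z (Ioo_subset_Icc_self hz)).hasDerivAt (Icc_mem_nhds hz.1 hz.2)
    rwa [hv_eq z (Ioo_subset_Icc_self hz)] at h1
  have hQz : ∀ z ∈ Ioo (-σ) σ, (lam z, E z) ∈ I ×ˢ J := fun z hz =>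
    ⟨hlamI z (Ioo_subset_Icc_self hz), hEJ _⟩
  have hhalf : Icc 0 (σ / 2) ⊆ Ioo (-σ) σ := fun z hz =>
    ⟨by linarith [hz.1], by linarith [hz.2]⟩
  -- The slope G is at most 1 because F < n on good states.
  have hup : ∀ z ∈ Icc 0 (σ / 2), lam z - z ≤ l₀ := by
    intro z hz
    have := image_le_of_deriv_right_le_deriv_boundary (f := lam) (f' := fun z => G (lam z, E z))
      (a := 0) (b := σ / 2) (B := fun z => l₀ + z) (B' := fun _ => 1)
      (fun q hq => (hlamd' q (hhalf hq)).continuousAt.continuousWithinAt)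
      (fun q hq => (hlamd' q (hhalf (Ico_subset_Icc_self hq))).hasDerivWithinAt)
      (by rw [hlam0, add_zero]) (by fun_prop)
      (fun q _ => ((hasDerivAt_id q).const_add l₀).hasDerivWithinAt)
      (fun q hq => by
        have hq' := hQz q (hhalf (Ico_subset_Icc_self hq))
        exact (div_le_one (hnpos _ hq'.1)).2 (hbox hq').2.2.2.le) hz
    linarith
  have hlow : ∀ z ∈ Icc 0 (σ / 2), 0 ≤ lam z - z := by
    intro z hz
    have h1 := abs_le.1 (hlamr z (Ioo_subset_Icc_self (hhalf hz)))
    linarith [hz.2]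
  have hEz : ∀ z ∈ Icc 0 (σ / 2), E z = f₀ ((lam z - z) / l₀) := fun z hz =>
    clampExtend_of_mem _ ⟨div_nonneg (hlow z hz) hl₀pos.le, (div_le_one hl₀pos).2 (hup z hz)⟩
  -- A Lipschitz slope makes the derivative of β(lam z) Lipschitz (`hKB`), which is the regularity
  -- that the boundary branch of the profile needs.
  obtain ⟨KE, hKE⟩ : ∃ KE, LipschitzOnWith KE (fun z => G (lam z, E z)) (Icc 0 (σ / 2)) := by
    have hs : Icc 0 (σ / 2) ⊆ Icc (-σ) σ := hhalf.trans Ioo_subset_Icc_self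
    have h1 := hlamL.mono hs
    have h2 : LipschitzOnWith (‖l₀⁻¹‖₊ * (M + 1)) (fun z => (lam z - z) / l₀)
        (Icc 0 (σ / 2)) := by
      have h3 := (lipschitzWith_smul (β := ℝ) l₀⁻¹).comp_lipschitzOnWith
        (h1.sub (LipschitzWith.id.lipschitzOnWith))
      convert! h3 using 2 with y
      simp [div_eq_inv_mul]
    have h4 := h1.prodMk (hK₁.comp_lipschitzOnWith h2)
    exact ⟨_, hKG.comp h4 fun z hz => hQz z (hhalf hz)⟩
  obtain ⟨KB, hKB⟩ := exists_lipschitzOnWith_mul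
    (hKβ.comp (hlamL.mono (hhalf.trans Ioo_subset_Icc_self))
      fun z hz => hlamI z (Ioo_subset_Icc_self (hhalf hz))) hKE
  have h0half : (0 : ℝ) ∈ Icc 0 (σ / 2) := ⟨le_rfl, by positivity⟩
  have hE0 : E 0 = f₀ 1 := by
    rw [hEz 0 h0half, hlam0, sub_zero, div_self hl₀pos.ne']
  -- The two compatibility conditions are the matching of the values and of the slopes of the two
  -- branches at ξ = 0.
  obtain ⟨P, W, hprof⟩ := exists_isProfile (σ := σ / 2) (B := fun z => S.β (lam z))
    (B' := fun z => (deriv S.β ∘ lam) z * G (lam z, E z)) hw hl₀pos (by positivity)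
    (fun z hz => (HasDerivAt.comp z
      ((hβI _ (hQz z (hhalf hz)).1).differentiableAt (by norm_num)).hasDerivAt
      (hlamd' z (hhalf hz))).hasDerivWithinAt) hKB (by rw [hlam0, hcomp0]) (by
      have hn0 := (hnpos l₀ hl₀I).ne'
      simp only [Function.comp_apply, hlam0, hE0, hG]
      field_simp at hcomp1 ⊢
      linarith)
  set Φ : ℝ → ℝ := fun ξ => if ξ < 0 then S.β (lam (-ξ)) else f₀ (ξ / l₀) with hΦ
  have hZnn : ∀ t ∈ Ico 0 τ, 0 ≤ Z t := by
    intro t ht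
    have hs : Icc 0 t ⊆ Ico 0 τ := fun q hq => ⟨hq.1, hq.2.trans_lt ht.2⟩
    exact image_le_of_deriv_right_le_deriv_boundary (f := fun _ => 0) (f' := fun _ => 0) (B := Z)
      (a := 0) (b := t) continuousOn_const (fun _ _ => hasDerivWithinAt_const _ _ _) hZ0.ge
      (fun q hq => (hZd' q (hs hq)).continuousAt.continuousWithinAt)
      (fun q hq => (hZd' q (hs (Ico_subset_Icc_self hq))).hasDerivWithinAt)
      (fun q hq => (hnpos _ (hQz _ (hZm q (hs (Ico_subset_Icc_self hq)))).1).le) ⟨ht.1, le_rfl⟩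
  have hZh : ∀ t ∈ Ico 0 τ, Z t ∈ Icc 0 (σ / 2) := fun t ht =>
    ⟨hZnn t ht, (abs_le.1 (hZσ t ht)).2⟩
  set l : ℝ → ℝ := fun t => lam (Z t) with hl
  have hlI : ∀ t ∈ Ico 0 τ, l t ∈ I := fun t ht => (hQz _ (hZm t ht)).1
  set f : ℝ → ℝ → ℝ := fun t x => Φ (l t * x - Z t) with hf
  have hf1 : ∀ t ∈ Ico 0 τ, f t 1 = E (Z t) := by
    intro t ht
    simp only [hf, hΦ, mul_one]
    rw [if_neg (not_lt.2 (hlow _ (hZh t ht))), hEz _ (hZh t ht)]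
  have hQ : ∀ t ∈ Ico 0 τ, (l t, f t 1) ∈ I ×ˢ J := fun t ht => by
    rw [hf1 t ht]; exact hQz _ (hZm t ht)
  have hld : ∀ t ∈ Ico 0 τ, HasDerivAt l (S.F (l t) (f t 1)) t := by
    intro t ht
    have h1 := (hlamd' _ (hZm t ht)).comp t (hZd' t ht)
    convert! h1 using 1
    rw [hf1 t ht]
    simp only [hG]
    rw [div_mul_cancel₀ _ (hnpos _ (hlI t ht)).ne']
  have hrange : ∀ t ∈ Ico 0 τ, ∀ x ∈ Icc (0 : ℝ) 1, l t * x - Z t ∈ Icc (-(σ / 2)) l₀ := by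
    intro t ht x hx
    have h1 := hup _ (hZh t ht)
    have h2 := hIpos _ (hlI t ht)
    have h3 := (hZh t ht).2
    constructor
    · nlinarith [hx.1]
    · have : l t - Z t ≤ l₀ := h1
      nlinarith [hx.2]
  have hlc : ContinuousOn l (Ico 0 τ) := fun t ht => (hld t ht).continuousAt.continuousWithinAt
  have hZc : ContinuousOn Z (Ico 0 τ) := fun t ht => (hZd' t ht).continuousAt.continuousWithinAt
  have h0τ : (0 : ℝ) ∈ Ico 0 τ := ⟨le_rfl, hτ⟩
  refine ⟨l, f, ⟨fun t ht => (hbox (hQ t ht)).1, fun t ht => (hld t ht).hasDerivWithinAt,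
    hprof.h2ContinuousOn hlc hZc (fun t ht => hIpos _ (hlI t ht)) hrange, ?_, ?_⟩, ?_, ?_, ?_⟩
  · intro t ht x hx
    have hlt := (hIpos _ (hlI t ht)).ne'
    rw [(hprof.isH2 hlt (hrange t ht)).derivWithin_eq hx]
    have h1 : HasDerivWithinAt (fun s => l s * x - Z s)
        (S.F (l t) (f t 1) * x - S.n (l t)) (Ico 0 τ) t :=
      (((hld t ht).mul_const x).sub (hZd' t ht)).hasDerivWithinAt
    have h2 := HasDerivWithinAt.comp t (hprof.hasDerivWithinAt (hrange t ht x hx)) h1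
      fun s hs => hrange s hs x hx
    have h3 : HasDerivWithinAt (fun s => f s x)
        (P (l t * x - Z t) * (S.F (l t) (f t 1) * x - S.n (l t))) (Ici 0) t := by
      refine HasDerivWithinAt.mono_of_mem_nhdsWithin h2 ?_
      filter_upwards [self_mem_nhdsWithin, mem_nhdsWithin_of_mem_nhds (Iio_mem_nhds ht.2)]
        with s hs1 hs2
      exact ⟨hs1, hs2⟩
    convert! h3 using 1
    unfold speed
    field_simp
    ring
  · intro t ht
    simp only [hf, hΦ, mul_zero, zero_sub, neg_neg]
    rcases (hZnn t ht).lt_or_eq with hpos | hzero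
    · rw [if_pos (by linarith)]
    · simp only [hl]
      rw [← hzero, neg_zero, if_neg (lt_irrefl _), zero_div, hlam0, hcomp0]
  · simp only [hl, hZ0, hlam0]
  · intro x hx
    simp only [hf, hΦ, hl, hZ0, hlam0, sub_zero]
    rw [if_neg (not_lt.2 (mul_nonneg hl₀pos.le hx.1)), mul_div_cancel_left₀ _ hl₀pos.ne']
  · intro t ht
    refine ⟨hbox (hQ t ht), (?_ : _ ≤ _).trans (le_max_left _ _),
      (hMF _ (hQ t ht)).trans (le_max_right _ _)⟩
    have h1 := hlI t ht
    have h2 : |l t - lₑ| ≤ 2 * r := abs_le.2 ⟨by linarith [h1.1], by linarith [h1.2]⟩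
    have : |l t| ≤ |lₑ| + |l t - lₑ| := by simpa using abs_add_le lₑ (l t - lₑ)
    linarith

end InterfaceSystem

end Extruder

end

noncomputable section

namespace Extruder

/-! ### Weak and classical solutions of the equations -/

/-- The distributional equation speaks only of the open interval; at t = 0 the right derivative is
the limit of the derivatives, since u and h are continuous up to 0. -/
lemma hasDerivWithinAt_Ici_of_sub_eq_integral {b : ℝ} {u h : ℝ → ℝ} (hu : ContinuousOn u (Ico 0 b))
    (hh : ContinuousOn h (Ico 0 b))
    (huh : ∀ s ∈ Ioo 0 b, ∀ t ∈ Ioo 0 b, u t - u s = ∫ r in s..t, h r) {t : ℝ}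
    (ht : t ∈ Ico 0 b) : HasDerivWithinAt u (h t) (Ici 0) t := by
  have hint : ∀ t ∈ Ioo 0 b, HasDerivAt u (h t) t := by
    intro t ht
    have hn : Ioo 0 b ∈ 𝓝 t := Ioo_mem_nhds ht.1 ht.2
    have h1 : HasDerivAt (fun y => u t + ∫ r in t..y, h r) (h t) t := by
      refine (intervalIntegral.integral_hasDerivAt_right (by simp) ?_ ?_).const_add _
      · exact ⟨Ioo 0 b, hn,
          (hh.mono Ioo_subset_Ico_self).aestronglyMeasurable measurableSet_Ioo⟩
      · exact (hh.mono Ioo_subset_Ico_self).continuousAt hn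
    refine h1.congr_of_eventuallyEq ?_
    filter_upwards [hn] with y hy
    rw [← huh t ht y hy]; ring
  rcases ht.1.lt_or_eq with h0 | rfl
  · exact (hint t ⟨h0, ht.2⟩).hasDerivWithinAt
  · have hn : Ioo 0 b ∈ 𝓝[>] (0 : ℝ) := Ioo_mem_nhdsGT ht.2
    refine hasDerivWithinAt_Ici_of_tendsto_deriv (s := Ioo 0 b)
      (fun s hs => (hint s hs).differentiableAt.differentiableWithinAt)
      ((hu 0 ht).mono Ioo_subset_Ico_self) hn ?_
    have h1 : Tendsto h (𝓝[>] 0) (𝓝 (h 0)) := by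
      rw [← nhdsWithin_Ioo_eq_nhdsGT ht.2]
      exact (hh 0 ht).mono_left (nhdsWithin_mono _ Ioo_subset_Ico_self)
    refine h1.congr' ?_
    filter_upwards [hn] with s hs
    exact (hint s hs).deriv.symm

lemma continuous_integral_Ioo {h : ℝ → ℝ → ℝ} (hh : Continuous (Function.uncurry h)) :
    Continuous fun t => ∫ x in Ioo (0 : ℝ) 1, h t x := by
  simp_rw [← integral_Icc_eq_integral_Ioo]
  exact continuous_parametric_integral_of_continuous hh isCompact_Icc

lemma deriv_affine_mul {χ : ℝ → ℝ} (hχ : Differentiable ℝ χ) (c q y : ℝ) :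
    deriv (fun y => (c - y * q) * χ y) y = -q * χ y + (c - y * q) * deriv χ y := by
  have h1 : HasDerivAt (fun y => c - y * q) (-(1 * q)) y := by
    simpa using ((hasDerivAt_id y).mul_const q).const_sub c
  rw [(h1.fun_mul (hχ y).hasDerivAt).deriv]
  ring

/-- A weak solution of a transport equation with speed `c(t) - x q(t)` that is continuous together
with its space derivative satisfies the equation classically. -/
lemma sub_eq_integral_of_weak_transport {a b : ℝ} {f g : ℝ → ℝ → ℝ} {c q : ℝ → ℝ}
    (hf : Continuous (Function.uncurry f)) (hg : Continuous (Function.uncurry g))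
    (hc : Continuous c) (hq : Continuous q)
    (hfg : ∀ t ∈ Ioo a b, HasWeakDerivOn (Ioo 0 1) (f t) (g t))
    (hweak : ∀ ψ χ : ℝ → ℝ, ContDiff ℝ ∞ ψ → HasCompactSupport ψ → tsupport ψ ⊆ Ioo a b →
      ContDiff ℝ ∞ χ → HasCompactSupport χ → tsupport χ ⊆ Ioo 0 1 →
      ∫ z in Ioo a b ×ˢ Ioo (0 : ℝ) 1, f z.1 z.2 * (deriv ψ z.1 * χ z.2 +
        ψ z.1 * deriv (fun y => (c z.1 - y * q z.1) * χ y) z.2) = 0)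
    {s t : ℝ} (hs : s ∈ Ioo a b) (ht : t ∈ Ioo a b) {x : ℝ} (hx : x ∈ Icc (0 : ℝ) 1) :
    f t x - f s x = -∫ r in s..t, (c r - x * q r) * g r x := by
  have hgc : Continuous fun z : ℝ × ℝ => (c z.1 - z.2 * q z.1) * g z.1 z.2 := by
    have : Continuous fun z : ℝ × ℝ => g z.1 z.2 := hg
    fun_prop
  have key : ∀ χ : ℝ → ℝ, ContDiff ℝ ∞ χ → HasCompactSupport χ → tsupport χ ⊆ Ioo 0 1 →
      ∫ x in Ioo (0 : ℝ) 1,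
        (f t x - f s x + ∫ r in s..t, (c r - x * q r) * g r x) * χ x = 0 := by
    intro χ hχ hχc hχt
    have hχd : Continuous (deriv χ) := hχ.continuous_deriv (by simp)
    have hχ' := hχ.continuous
    have hχdiff : Differentiable ℝ χ := hχ.differentiable (by simp)
    have hf' : Continuous fun z : ℝ × ℝ => f z.1 z.2 := hf
    have hg' : Continuous fun z : ℝ × ℝ => g z.1 z.2 := hg
    set A : ℝ → ℝ := fun t => ∫ x in Ioo (0 : ℝ) 1, f t x * χ x with hA
    set B : ℝ → ℝ := fun t => ∫ x in Ioo (0 : ℝ) 1,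
      f t x * (-q t * χ x + (c t - x * q t) * deriv χ x) with hB
    have hfχ : Continuous fun z : ℝ × ℝ => f z.1 z.2 * χ z.2 := by fun_prop
    have hfB : Continuous fun z : ℝ × ℝ =>
        f z.1 z.2 * (-q z.1 * χ z.2 + (c z.1 - z.2 * q z.1) * deriv χ z.2) := by fun_prop
    have hAc : Continuous A := continuous_integral_Ioo hfχ
    have hBc : Continuous B := continuous_integral_Ioo hfB
    have hiA : ∀ t, IntegrableOn (fun x => f t x * χ x) (Ioo 0 1) := fun t =>
      ((by fun_prop : Continuous fun x => f t x * χ x).integrableOn_Icc (a := 0)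
        (b := 1)).mono_set Ioo_subset_Icc_self
    have hiB : ∀ t, IntegrableOn
        (fun x => f t x * (-q t * χ x + (c t - x * q t) * deriv χ x)) (Ioo 0 1) := fun t =>
      ((by fun_prop : Continuous fun x => f t x * (-q t * χ x + (c t - x * q t) *
        deriv χ x)).integrableOn_Icc (a := 0) (b := 1)).mono_set Ioo_subset_Icc_self
    -- Tested with products ψ(t)χ(x), the equation says that the scalar function t ↦ ∫ f χ has weak
    -- derivative B, hence is its primitive. Integration by parts in space and Fubini then give the
    -- claim tested against χ.
    have hW : HasWeakDerivOn (Ioo a b) A B := by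
      refine ⟨hAc.locallyIntegrable.locallyIntegrableOn _,
        hBc.locallyIntegrable.locallyIntegrableOn _, fun ψ hψ hψc hψt => ?_⟩
      have h1 := hweak ψ χ hψ hψc hψt hχ hχc hχt
      simp_rw [deriv_affine_mul hχdiff] at h1
      have hψd : Continuous (deriv ψ) := hψ.continuous_deriv (by simp)
      have hψ' := hψ.continuous
      have hcont : Continuous fun z : ℝ × ℝ => f z.1 z.2 * (deriv ψ z.1 * χ z.2 +
          ψ z.1 * (-q z.1 * χ z.2 + (c z.1 - z.2 * q z.1) * deriv χ z.2)) := by fun_prop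
      rw [Measure.volume_eq_prod, setIntegral_prod _ (by
        rw [← Measure.volume_eq_prod]
        exact (hcont.continuousOn.integrableOn_compact
          (isCompact_Icc.prod isCompact_Icc)).mono_set
            (prod_mono Ioo_subset_Icc_self Ioo_subset_Icc_self))] at h1
      have h2 : ∀ t, ∫ x in Ioo (0 : ℝ) 1, f t x * (deriv ψ t * χ x +
          ψ t * (-q t * χ x + (c t - x * q t) * deriv χ x)) = A t * deriv ψ t + B t * ψ t := by
        intro t
        simp only [hA, hB]
        rw [← integral_mul_const, ← integral_mul_const,
          ← integral_add ((hiA t).mul_const _) ((hiB t).mul_const _)]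
        congr 1; ext x; ring
      simp_rw [h2] at h1
      have hi1 : IntegrableOn (fun t => A t * deriv ψ t) (Ioo a b) :=
        ((hAc.mul hψd).integrableOn_Icc (a := a) (b := b)).mono_set Ioo_subset_Icc_self
      have hi2 : IntegrableOn (fun t => B t * ψ t) (Ioo a b) :=
        ((hBc.mul hψ').integrableOn_Icc (a := a) (b := b)).mono_set Ioo_subset_Icc_self
      rw [integral_add hi1 hi2] at h1
      linarith
    have h3 := hW.eq_primitive isOpen_Ioo hAc.continuousOn hs ht
    have hBeq : ∀ r ∈ Ioo a b, B r =
        -∫ x in Ioo (0 : ℝ) 1, (c r - x * q r) * g r x * χ x := by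
      intro r hr
      -- The speed is affine in y, so its product with χ is an admissible test function at each
      -- fixed time; no smoothness of c and q in time is needed.
      have h4 := (hfg r hr).2.2 (fun y => (c r - y * q r) * χ y) (by fun_prop)
        hχc.mul_left ((tsupport_mul_subset_right).trans hχt)
      simp_rw [deriv_affine_mul hχdiff] at h4
      simp only [hB]
      rw [h4]
      congr 2; ext x; ring
    have h5 : ∫ r in s..t, B r =
        -∫ r in s..t, ∫ x in Ioo (0 : ℝ) 1, (c r - x * q r) * g r x * χ x := by
      rw [← intervalIntegral.integral_neg]
      apply intervalIntegral.integral_congr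
      intro r hr
      exact hBeq r (ordConnected_Ioo.uIcc_subset hs ht hr)
    have hcont : Continuous fun z : ℝ × ℝ => (c z.1 - z.2 * q z.1) * g z.1 z.2 * χ z.2 := by
      fun_prop
    rw [h5, intervalIntegral_integral_swap (by
      have h6 : IntegrableOn (fun z : ℝ × ℝ => (c z.1 - z.2 * q z.1) * g z.1 z.2 * χ z.2)
          (uIoc s t ×ˢ Ioo 0 1) :=
        (hcont.continuousOn.integrableOn_compact (isCompact_uIcc.prod isCompact_Icc)).mono_set
            (prod_mono uIoc_subset_uIcc Ioo_subset_Icc_self)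
      rw [IntegrableOn, Measure.volume_eq_prod, ← Measure.prod_restrict] at h6
      exact h6)] at h3
    simp only [hA] at h3
    have hcI : Continuous fun x => ∫ r in s..t, (c r - x * q r) * g r x := by
      refine intervalIntegral.continuous_parametric_intervalIntegral_of_continuous'
        (f := fun x r => (c r - x * q r) * g r x) ?_ s t
      exact hgc.comp continuous_swap
    have hi3 : IntegrableOn (fun x => (∫ r in s..t, (c r - x * q r) * g r x) * χ x) (Ioo 0 1) :=
      ((hcI.mul hχ').integrableOn_Icc (a := 0) (b := 1)).mono_set Ioo_subset_Icc_self
    have h7 : ∀ x, (f t x - f s x + ∫ r in s..t, (c r - x * q r) * g r x) * χ x =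
        (f t x * χ x - f s x * χ x) + (∫ r in s..t, (c r - x * q r) * g r x) * χ x := by
      intro x; ring
    simp_rw [h7]
    have hi4 : IntegrableOn (fun x => f t x * χ x - f s x * χ x) (Ioo 0 1) := (hiA t).sub (hiA s)
    rw [integral_add hi4 hi3, integral_sub (hiA t) (hiA s)]
    simp_rw [intervalIntegral.integral_mul_const] at h3
    linarith
  set D : ℝ → ℝ := fun x => f t x - f s x + ∫ r in s..t, (c r - x * q r) * g r x with hD
  have hDc : Continuous D := by
    have hcI : Continuous fun x => ∫ r in s..t, (c r - x * q r) * g r x := by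
      refine intervalIntegral.continuous_parametric_intervalIntegral_of_continuous'
        (f := fun x r => (c r - x * q r) * g r x) ?_ s t
      exact hgc.comp continuous_swap
    have hf' : Continuous fun z : ℝ × ℝ => f z.1 z.2 := hf
    have h1 : Continuous fun x => f t x := hf'.comp (by fun_prop : Continuous fun x => (t, x))
    have h2 : Continuous fun x => f s x := hf'.comp (by fun_prop : Continuous fun x => (s, x))
    exact (h1.sub h2).add hcI
  have hae : ∀ᵐ x ∂(volume : Measure ℝ), x ∈ Ioo (0 : ℝ) 1 → D x = 0 := by
    refine isOpen_Ioo.ae_eq_zero_of_integral_contDiff_smul_eq_zero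
      (hDc.locallyIntegrable.locallyIntegrableOn _) fun χ hχ hχc hχt => ?_
    rw [← key χ hχ hχc hχt, setIntegral_eq_integral_of_forall_compl_eq_zero
      (fun x hx => by rw [eq_zero_of_tsupport_subset hχt hx, mul_zero])]
    congr 1; ext x; rw [smul_eq_mul, mul_comm]
  have hEq : EqOn D 0 (Ioo 0 1) := Measure.eqOn_open_of_ae_eq
    ((ae_restrict_iff' measurableSet_Ioo).2 hae) isOpen_Ioo hDc.continuousOn continuousOn_const
  have hEq' : EqOn D 0 (Icc 0 1) := hEq.of_subset_closure hDc.continuousOn continuousOn_const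
    Ioo_subset_Icc_self (by rw [closure_Ioo (by norm_num)])
  have := hEq' hx
  simp only [hD, Pi.zero_apply] at this
  linarith

/-- Meant for functions known only on the open strip, multiplied by a test function and extended by
zero. -/
lemma continuous_of_continuousOn_of_eq_zero {X : Type*} [TopologicalSpace X] {U K : Set X}
    {g : X → ℝ} (hU : IsOpen U) (hK : IsClosed K) (hKU : K ⊆ U) (hg : ContinuousOn g U)
    (h0 : ∀ z, z ∉ K → g z = 0) : Continuous g := by
  rw [continuous_iff_continuousAt]
  intro z
  by_cases hz : z ∈ K
  · exact hg.continuousAt (hU.mem_nhds (hKU hz))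
  · have : g =ᶠ[𝓝 z] fun _ => 0 := by
      filter_upwards [hK.isOpen_compl.mem_nhds hz] with y hy using h0 y hy
    exact continuousAt_const.congr this.symm

/-! ### Classical solutions solve the transport equation in the sense of distributions -/

namespace InterfaceSystem

variable {S : InterfaceSystem} {a b : ℝ} {l : ℝ → ℝ} {f : ℝ → ℝ → ℝ}

lemma hasDerivAt_speed_mul {k : ℝ → ℝ} {k' y : ℝ} (hk : HasDerivAt k k' y) (l φ : ℝ) :
    HasDerivAt (fun y => S.speed l φ y * k y)
      (-(S.F l φ / l) * k y + S.speed l φ y * k') y := by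
  have h1 : HasDerivAt (fun y => S.speed l φ y) (-(S.F l φ / l)) y := by
    have := (((hasDerivAt_id y).mul_const (S.F l φ)).const_sub (S.n l)).div_const l
    convert! this using 1
    ring
  exact h1.fun_mul hk

/-- Classical solutions satisfy the transport equation in the sense of distributions. -/
lemma IsClassical.integral_transport_eq_zero (h : S.IsClassical a b l f) {φ : ℝ × ℝ → ℝ}
    (hφ : ContDiff ℝ ∞ φ) (hφc : HasCompactSupport φ)
    (hφt : tsupport φ ⊆ Ioo a b ×ˢ Ioo 0 1) :
    ∫ z : ℝ × ℝ, f z.1 z.2 * (deriv (fun s => φ (s, z.2)) z.1 +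
      deriv (fun y => S.speed (l z.1) (f z.1 1) y * φ (z.1, y)) z.2) = 0 := by
  have hUo : IsOpen (Ioo a b ×ˢ Ioo (0 : ℝ) 1) := isOpen_Ioo.prod isOpen_Ioo
  have hUs : Ioo a b ×ˢ Ioo (0 : ℝ) 1 ⊆ Ico a b ×ˢ Icc 0 1 :=
    prod_mono Ioo_subset_Ico_self Ioo_subset_Icc_self
  set φ₁ : ℝ × ℝ → ℝ := fun z => fderiv ℝ φ z (1, 0) with hφ₁
  set φ₂ : ℝ × ℝ → ℝ := fun z => fderiv ℝ φ z (0, 1) with hφ₂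
  have hφd : ∀ z, HasFDerivAt φ (fderiv ℝ φ z) z := fun z =>
    (hφ.differentiable (by simp) z).hasFDerivAt
  have hd1 : ∀ t x, HasDerivAt (fun s => φ (s, x)) (φ₁ (t, x)) t := fun t x =>
    HasFDerivAt.comp_hasDerivAt t (hφd (t, x)) ((hasDerivAt_id t).prodMk (hasDerivAt_const t x))
  have hd2 : ∀ t x, HasDerivAt (fun y => φ (t, y)) (φ₂ (t, x)) x := fun t x =>
    HasFDerivAt.comp_hasDerivAt x (hφd (t, x)) ((hasDerivAt_const x t).prodMk (hasDerivAt_id x))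
  have hφ₁c : Continuous φ₁ := (hφ.continuous_fderiv (by simp)).clm_apply continuous_const
  have hφ₂c : Continuous φ₂ := (hφ.continuous_fderiv (by simp)).clm_apply continuous_const
  have hz : ∀ z, z ∉ tsupport φ → φ z = 0 ∧ φ₁ z = 0 ∧ φ₂ z = 0 := by
    intro z hz
    have h1 : fderiv ℝ φ z = 0 := image_eq_zero_of_notMem_tsupport
      fun h' => hz (tsupport_fderiv_subset ℝ h')
    exact ⟨image_eq_zero_of_notMem_tsupport hz, by simp [hφ₁, h1], by simp [hφ₂, h1]⟩
  have hloc : ∀ z, z ∉ tsupport φ → ∀ᶠ y in 𝓝 z, φ y = 0 := fun z hz => by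
    filter_upwards [(isClosed_tsupport φ).isOpen_compl.mem_nhds hz] with y hy
    exact image_eq_zero_of_notMem_tsupport hy
  set fx : ℝ × ℝ → ℝ := fun z => derivWithin (f z.1) (Icc 0 1) z.2 with hfx
  set α : ℝ × ℝ → ℝ := fun z => S.speed (l z.1) (f z.1 1) z.2 with hα
  -- G₁ = ∂ₜ(f φ) and G₂ = ∂ₓ(f α φ). They add up to the integrand because ∂ₜf = -α ∂ₓf, and each
  -- integrates to zero along lines.
  set G₁ : ℝ × ℝ → ℝ := fun z => -(α z * fx z) * φ z + f z.1 z.2 * φ₁ z with hG₁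
  set G₂ : ℝ × ℝ → ℝ := fun z => fx z * (α z * φ z) +
    f z.1 z.2 * (-(S.F (l z.1) (f z.1 1) / l z.1) * φ z + α z * φ₂ z) with hG₂
  have hfc := h.f_mem.continuousOn_uncurry.mono hUs
  have hfxc : ContinuousOn fx _ := h.f_mem.continuousOn_derivWithin.mono hUs
  have hm : MapsTo (Prod.fst : ℝ × ℝ → ℝ) (Ioo a b ×ˢ Ioo (0 : ℝ) 1) (Ico a b) :=
    fun z hz => Ioo_subset_Ico_self hz.1
  have hFc := h.F_continuousOn.comp continuousOn_fst hm
  have hlc := h.l_continuousOn.comp continuousOn_fst hm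
  have hl0 : ∀ z ∈ Ioo a b ×ˢ Ioo (0 : ℝ) 1, l z.1 ≠ 0 := fun z hz =>
    S.l_ne_zero _ (h.mem _ (hm hz))
  have hαc : ContinuousOn α (Ioo a b ×ˢ Ioo 0 1) :=
    ((h.n_continuousOn.comp continuousOn_fst hm).sub (continuousOn_snd.mul hFc)).div hlc hl0
  have hG₁c : Continuous G₁ := continuous_of_continuousOn_of_eq_zero hUo (isClosed_tsupport φ) hφt
    (((hαc.mul hfxc).neg.mul hφ.continuous.continuousOn).add (hfc.mul hφ₁c.continuousOn))
    fun z h' => by simp [hG₁, hz z h']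
  have hG₂c : Continuous G₂ := continuous_of_continuousOn_of_eq_zero hUo (isClosed_tsupport φ) hφt
    ((hfxc.mul (hαc.mul hφ.continuous.continuousOn)).add (hfc.mul
      (((hFc.div hlc hl0).neg.mul hφ.continuous.continuousOn).add (hαc.mul hφ₂c.continuousOn))))
    fun z h' => by simp [hG₂, hz z h']
  have hG₁s : HasCompactSupport G₁ := HasCompactSupport.intro hφc fun z h' => by simp [hG₁, hz z h']
  have hG₂s : HasCompactSupport G₂ := HasCompactSupport.intro hφc fun z h' => by simp [hG₂, hz z h']
  have hfφc : Continuous fun z : ℝ × ℝ => f z.1 z.2 * φ z :=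
    continuous_of_continuousOn_of_eq_zero hUo (isClosed_tsupport φ) hφt
      (hfc.mul hφ.continuous.continuousOn) fun z h' => by simp [hz z h']
  have hfαφc : Continuous fun z : ℝ × ℝ => f z.1 z.2 * (α z * φ z) :=
    continuous_of_continuousOn_of_eq_zero hUo (isClosed_tsupport φ) hφt
      (hfc.mul (hαc.mul hφ.continuous.continuousOn)) fun z h' => by simp [hz z h']
  have hslice : ∀ {g : ℝ × ℝ → ℝ}, Continuous g → (∀ z, z ∉ tsupport φ → g z = 0) →
      (∀ x, Integrable fun t => g (t, x)) ∧ ∀ t, Integrable fun x => g (t, x) := by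
    intro g hg hg0
    constructor
    · intro x
      refine (hg.comp (by fun_prop : Continuous fun t => (t, x))).integrable_of_hasCompactSupport
        (HasCompactSupport.intro (hφc.image continuous_fst) fun t ht => hg0 _ fun h' => ht ?_)
      exact ⟨_, h', rfl⟩
    · intro t
      refine (hg.comp (by fun_prop : Continuous fun x => (t, x))).integrable_of_hasCompactSupport
        (HasCompactSupport.intro (hφc.image continuous_snd) fun x hx => hg0 _ fun h' => hx ?_)
      exact ⟨_, h', rfl⟩
  have hI₁ : ∫ z, G₁ z = 0 := by
    rw [Measure.volume_eq_prod, integral_prod_symm _ (by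
      rw [← Measure.volume_eq_prod]; exact hG₁c.integrable_of_hasCompactSupport hG₁s)]
    refine (integral_congr_ae (Eventually.of_forall fun x => ?_)).trans (integral_zero _ _)
    refine integral_eq_zero_of_hasDerivAt_of_integrable (f := fun t => f t x * φ (t, x))
      (fun t => ?_) ((hslice hG₁c fun z h' => by simp [hG₁, hz z h']).1 x)
      ((hslice hfφc fun z h' => by simp [hz z h']).1 x)
    by_cases hmem : (t, x) ∈ tsupport φ
    · obtain ⟨ht, hx⟩ := hφt hmem
      exact ((h.f_deriv t (Ioo_subset_Ico_self ht) x (Ioo_subset_Icc_self hx)).hasDerivAt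
        (Ici_mem_nhds ht.1)).mul (hd1 t x)
    · have e : G₁ (t, x) = 0 := by simp [hG₁, hz _ hmem]
      rw [e]
      refine (hasDerivAt_const t (0 : ℝ)).congr_of_eventuallyEq ?_
      have := (by fun_prop : Continuous fun t : ℝ => (t, x)).continuousAt.eventually (hloc _ hmem)
      filter_upwards [this] with s hs
      rw [hs, mul_zero]
  have hI₂ : ∫ z, G₂ z = 0 := by
    rw [Measure.volume_eq_prod, integral_prod _ (by
      rw [← Measure.volume_eq_prod]; exact hG₂c.integrable_of_hasCompactSupport hG₂s)]
    refine (integral_congr_ae (Eventually.of_forall fun t => ?_)).trans (integral_zero _ _)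
    refine integral_eq_zero_of_hasDerivAt_of_integrable
      (f := fun x => f t x * (α (t, x) * φ (t, x)))
      (fun x => ?_) ((hslice hG₂c fun z h' => by simp [hG₂, hz z h']).2 t)
      ((hslice hfαφc fun z h' => by simp [hz z h']).2 t)
    by_cases hmem : (t, x) ∈ tsupport φ
    · obtain ⟨ht, hx⟩ := hφt hmem
      obtain ⟨w, hw⟩ := (h.f_mem.1 t (Ioo_subset_Ico_self ht)).exists_isH2
      exact ((hw.hasDerivWithinAt (Ioo_subset_Icc_self hx)).hasDerivAt
        (Icc_mem_nhds hx.1 hx.2)).mul (hasDerivAt_speed_mul (S := S) (hd2 t x) (l t) (f t 1))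
    · have e : G₂ (t, x) = 0 := by simp [hG₂, hz _ hmem]
      rw [e]
      refine (hasDerivAt_const x (0 : ℝ)).congr_of_eventuallyEq ?_
      have := (by fun_prop : Continuous fun x : ℝ => (t, x)).continuousAt.eventually (hloc _ hmem)
      filter_upwards [this] with s hs
      rw [hs, mul_zero, mul_zero]
  have hsum : ∀ z : ℝ × ℝ, f z.1 z.2 * (deriv (fun s => φ (s, z.2)) z.1 +
      deriv (fun y => S.speed (l z.1) (f z.1 1) y * φ (z.1, y)) z.2) = G₁ z + G₂ z := by
    intro z
    rw [(hd1 z.1 z.2).deriv, (hasDerivAt_speed_mul (hd2 z.1 z.2) _ _).deriv]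
    simp only [hG₁, hG₂, hα]
    ring
  simp_rw [hsum]
  rw [integral_add (hG₁c.integrable_of_hasCompactSupport hG₁s)
    (hG₂c.integrable_of_hasCompactSupport hG₂s), hI₁, hI₂, add_zero]

end InterfaceSystem

end Extruder

end

noncomputable section

namespace Extruder

/-! ### The closed-loop system of the extruder -/

/-- The ratio `𝒫(N,l) / N`. -/
def Params.gain (p : Params) (l : ℝ) : ℝ :=
  p.η * p.ρ * p.Veff * (p.L - l) / (p.B * p.ρ + p.Kd * (p.L - l))

lemma Params.pressure_eq (p : Params) (N l : ℝ) : p.pressure N l = N * p.gain l := by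
  unfold Params.pressure Params.gain
  ring

lemma Params.contDiffAt_gain (p : Params) {l : ℝ} (h : p.B * p.ρ + p.Kd * (p.L - l) ≠ 0) :
    ContDiffAt ℝ 2 p.gain l := by
  unfold Params.gain
  exact ContDiffAt.div (by fun_prop) (by fun_prop) h

namespace Equilibrium

variable {p : Params} (e : Equilibrium p) (k₁ k₂ : ℝ)

/-- The screw speed determined by the feedback law. -/
def screw (l : ℝ) : ℝ := (e.Ne - k₁ * e.pressure) / (1 - k₁ * p.gain l)

/-- The inlet flow rate determined by the feedback law. -/
def feed (l : ℝ) : ℝ := e.inflow + k₂ * (e.screw k₁ l * p.gain l - e.pressure)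

lemma b₂_eq : e.b₂ = p.gain e.le := by
  unfold b₂
  simp_rw [Params.pressure_eq]
  exact (by simpa using (hasDerivAt_id e.Ne).mul_const (p.gain e.le) :
    HasDerivAt (fun N => N * p.gain e.le) (p.gain e.le) e.Ne).deriv

variable {k₁ k₂} {e}

lemma numerator_ne_zero (hk : 1 - k₁ * e.b₂ ≠ 0) : e.Ne - k₁ * e.pressure ≠ 0 := by
  have : e.Ne - k₁ * e.pressure = e.Ne * (1 - k₁ * e.b₂) := by
    rw [b₂_eq, pressure, Params.pressure_eq]; ring
  rw [this]
  exact mul_ne_zero e.Ne_pos.ne' hk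

/-- If the factor vanished, the law would reduce to N_e - k₁ ΔP_e = 0, whereas the left side is N_e
(1 - k₁ b₂). So arbitrary solutions, even far from equilibrium, obey the reduced system. -/
lemma Feedback.one_sub_ne_zero (hk : 1 - k₁ * e.b₂ ≠ 0) {l N Fin : ℝ}
    (h : e.Feedback k₁ k₂ l N Fin) : 1 - k₁ * p.gain l ≠ 0 := by
  intro h0
  have h1 := h.1
  rw [Params.pressure_eq] at h1
  exact numerator_ne_zero hk (by linear_combination -h1 + N * h0)

lemma Feedback.eq_screw {l N Fin : ℝ} (h : e.Feedback k₁ k₂ l N Fin)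
    (h0 : 1 - k₁ * p.gain l ≠ 0) : N = e.screw k₁ l ∧ Fin = e.feed k₁ k₂ l := by
  have h1 := h.1
  rw [Params.pressure_eq] at h1
  have hN : N = e.screw k₁ l := by
    rw [screw, eq_div_iff h0]
    linear_combination h1
  refine ⟨hN, ?_⟩
  have h2 := h.2
  rw [Params.pressure_eq, hN] at h2
  rw [feed]
  linear_combination h2

lemma feedback_screw {l : ℝ} (h0 : 1 - k₁ * p.gain l ≠ 0) :
    e.Feedback k₁ k₂ l (e.screw k₁ l) (e.feed k₁ k₂ l) := by
  refine ⟨?_, ?_⟩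
  · rw [Params.pressure_eq]
    have : e.screw k₁ l * (1 - k₁ * p.gain l) = e.Ne - k₁ * e.pressure := by
      rw [screw, div_mul_cancel₀ _ h0]
    linear_combination this
  · rw [Params.pressure_eq, feed]; ring

lemma screw_ne_zero (hk : 1 - k₁ * e.b₂ ≠ 0) {l : ℝ} (h0 : 1 - k₁ * p.gain l ≠ 0) :
    e.screw k₁ l ≠ 0 := div_ne_zero (numerator_ne_zero hk) h0

lemma contDiffAt_screw {l : ℝ} (hd : p.B * p.ρ + p.Kd * (p.L - l) ≠ 0)
    (h0 : 1 - k₁ * p.gain l ≠ 0) : ContDiffAt ℝ 2 (e.screw k₁) l := by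
  have := p.contDiffAt_gain hd
  unfold screw
  exact contDiffAt_const.div (contDiffAt_const.sub (contDiffAt_const.mul this)) h0

lemma contDiffAt_feed {l : ℝ} (hd : p.B * p.ρ + p.Kd * (p.L - l) ≠ 0)
    (h0 : 1 - k₁ * p.gain l ≠ 0) : ContDiffAt ℝ 2 (e.feed k₁ k₂) l := by
  have h1 := p.contDiffAt_gain hd
  have h2 := e.contDiffAt_screw hd h0
  unfold feed
  exact contDiffAt_const.add (contDiffAt_const.mul ((h2.mul h1).sub contDiffAt_const))

variable (e k₁ k₂)

/-- The closed-loop system, with the controls expressed through the position of the interface. -/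
def system (hk : 1 - k₁ * e.b₂ ≠ 0) : InterfaceSystem where
  n l := p.ζ * e.screw k₁ l
  β l := e.feed k₁ k₂ l / (p.ρ * p.Veff * e.screw k₁ l)
  F l φ := p.interfaceVelocity l (e.screw k₁ l) φ
  Ω := {z | z.1 ≠ 0 ∧ p.B * p.ρ + p.Kd * (p.L - z.1) ≠ 0 ∧ 1 - k₁ * p.gain z.1 ≠ 0 ∧ z.2 ≠ 1}
  isOpen_Ω := by
    rw [isOpen_iff_mem_nhds]
    rintro z ⟨h1, h2, h3, h4⟩
    have c2 : ContinuousAt (fun z : ℝ × ℝ => p.B * p.ρ + p.Kd * (p.L - z.1)) z := by fun_prop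
    have c3 : ContinuousAt (fun z : ℝ × ℝ => 1 - k₁ * p.gain z.1) z :=
      continuousAt_const.sub (continuousAt_const.mul (ContinuousAt.comp (g := p.gain)
        (f := Prod.fst) (p.contDiffAt_gain h2).continuousAt continuousAt_fst))
    filter_upwards [continuousAt_fst.eventually_ne h1, c2.eventually_ne h2, c3.eventually_ne h3,
      continuousAt_snd.eventually_ne h4] with y y1 y2 y3 y4
    exact ⟨y1, y2, y3, y4⟩
  n_smooth := fun z hz => contDiffAt_const.mul (contDiffAt_screw hz.2.1 hz.2.2.1)
  β_smooth := fun z hz => (contDiffAt_feed hz.2.1 hz.2.2.1).div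
    (contDiffAt_const.mul (contDiffAt_screw hz.2.1 hz.2.2.1))
    (mul_ne_zero (mul_pos p.ρ_pos p.Veff_pos).ne' (screw_ne_zero hk hz.2.2.1))
  F_smooth := fun z hz => by
    have h1 : ContDiffAt ℝ 1 (fun z : ℝ × ℝ => e.screw k₁ z.1) z :=
      ContDiffAt.comp (g := e.screw k₁) z
        ((contDiffAt_screw hz.2.1 hz.2.2.1).of_le (by norm_num)) contDiffAt_fst
    have h2 : ContDiffAt ℝ 1 (fun z : ℝ × ℝ => p.gain z.1) z :=
      ContDiffAt.comp (g := p.gain) z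
        ((p.contDiffAt_gain hz.2.1).of_le (by norm_num)) contDiffAt_fst
    have h3 : ContDiffAt ℝ 1 (fun z : ℝ × ℝ =>
        (p.Kd / p.η * (e.screw k₁ z.1 * p.gain z.1) - p.ρ * p.Veff * e.screw k₁ z.1 * z.2) /
          (p.ρ * p.Seff * (1 - z.2))) z := by
      refine ContDiffAt.div ?_ (by fun_prop) ?_
      · exact (contDiffAt_const.mul (h1.mul h2)).sub ((contDiffAt_const.mul h1).mul contDiffAt_snd)
      · exact mul_ne_zero (mul_pos p.ρ_pos p.Seff_pos).ne' (sub_ne_zero.2 hz.2.2.2.symm)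
    convert! h3 using 2 with y
    simp only [Function.uncurry, Params.interfaceVelocity, Params.pressure_eq]
  l_ne_zero := fun z hz => hz.1

variable {e k₁ k₂}

/-- At the equilibrium F = 0 and n = ζ N_e > 0, so the transport speed is positive. -/
lemma equilibrium_mem_good (hk : 1 - k₁ * e.b₂ ≠ 0) : (e.le, e.fe) ∈ (e.system k₁ k₂ hk).good := by
  have hd : 0 < p.B * p.ρ + p.Kd * (p.L - e.le) := by
    have := mul_pos p.B_pos p.ρ_pos
    have := mul_pos p.Kd_pos (sub_pos.2 e.le_mem.2)
    linarith
  have h0 : 1 - k₁ * p.gain e.le ≠ 0 := by rwa [← b₂_eq]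
  have hN : e.screw k₁ e.le = e.Ne := by
    rw [screw, div_eq_iff h0, pressure, Params.pressure_eq]; ring
  have hpos : 0 < p.ζ * e.Ne := mul_pos p.ζ_pos e.Ne_pos
  refine ⟨⟨e.le_mem.1.ne', hd.ne', h0, e.fe_mem.2.ne⟩, e.le_mem.1, ?_, ?_⟩
  · simp only [system, hN, hpos]
  · simp only [system, hN, e.stationary, hpos]

/-- The compatibility conditions in terms of the reduced system. -/
lemma Compatible.reduced (hk : 1 - k₁ * e.b₂ ≠ 0) {l₀ : ℝ} {f₀ : ℝ → ℝ}
    (hΩ : (l₀, f₀ 1) ∈ (e.system k₁ k₂ hk).Ω) (h : e.Compatible k₁ k₂ l₀ f₀) :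
    f₀ 0 = (e.system k₁ k₂ hk).β l₀ ∧
      deriv (e.system k₁ k₂ hk).β l₀ * (e.system k₁ k₂ hk).F l₀ (f₀ 1) +
        (e.system k₁ k₂ hk).n l₀ / l₀ * derivWithin f₀ (Icc 0 1) 0 = 0 := by
  obtain ⟨N, Fin, dl, dP, dN, dFin, hfb, hdl, hdP, hdN, hdFin, h0, h1⟩ := h
  obtain ⟨hl, hd, hk', hf⟩ := hΩ
  simp only at hl hd hk' hf
  obtain ⟨rfl, rfl⟩ := hfb.eq_screw hk'
  refine ⟨h0, ?_⟩
  have hNne := screw_ne_zero (e := e) hk hk'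
  have hg := ((p.contDiffAt_gain hd).differentiableAt (by norm_num)).hasDerivAt
  set g := p.gain l₀ with hgdef
  set g' := deriv p.gain l₀ with hg'
  set N := e.screw k₁ l₀ with hN
  have hden := ((hg.const_mul k₁).const_sub 1)
  have hNd : HasDerivAt (e.screw k₁) (k₁ * (N * g' / (1 - k₁ * g))) l₀ := by
    have := (hasDerivAt_const l₀ (e.Ne - k₁ * e.pressure)).div hden hk'
    convert! this using 1
    have hc : e.Ne - k₁ * e.pressure = N * (1 - k₁ * g) := by
      rw [hN, screw, div_mul_cancel₀ _ hk']
    rw [hc, ← hgdef]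
    field_simp
    ring
  have hPd : HasDerivAt (fun l => e.screw k₁ l * p.gain l) (N * g' / (1 - k₁ * g)) l₀ := by
    have := hNd.fun_mul hg
    convert! this using 1
    rw [← hN, ← hgdef]
    field_simp
    ring
  have hFd : HasDerivAt (e.feed k₁ k₂) (k₂ * (N * g' / (1 - k₁ * g))) l₀ :=
    ((hPd.sub_const _).const_mul k₂).const_add _
  have hβd := (hFd.div (hNd.const_mul (p.ρ * p.Veff))
    (mul_ne_zero (mul_pos p.ρ_pos p.Veff_pos).ne' hNne)).deriv
  have e1 : deriv (fun l => p.pressure N l) l₀ = N * g' := by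
    simp_rw [Params.pressure_eq]
    exact (hg.const_mul N).deriv
  have e2 : deriv (fun M => p.pressure M l₀) N = g := by
    simp_rw [Params.pressure_eq]
    exact (by simpa using (hasDerivAt_id N).mul_const g : HasDerivAt (fun M => M * g) g N).deriv
  rw [e1, e2] at hdP
  -- The differentiated feedback law is implicit, dP = N g' dl + k₁ g dP; it is solved for dP.
  have hP : dP = N * g' / (1 - k₁ * g) * dl := by
    rw [div_mul_eq_mul_div, eq_div_iff hk']
    rw [hdN] at hdP
    linear_combination hdP
  have e3 : deriv (e.system k₁ k₂ hk).β l₀ * (e.system k₁ k₂ hk).F l₀ (f₀ 1) =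
      (dFin * N - e.feed k₁ k₂ l₀ * dN) / (p.ρ * p.Veff * N ^ 2) := by
    have hρ := (mul_pos p.ρ_pos p.Veff_pos).ne'
    have e4 : deriv (e.system k₁ k₂ hk).β l₀ = _ := hβd
    have e5 : (e.system k₁ k₂ hk).F l₀ (f₀ 1) = dl := hdl.symm
    rw [e4, e5, hdFin, hdN, hP, ← hN]
    have := p.ρ_pos.ne'
    have := p.Veff_pos.ne'
    generalize N * g' / (1 - k₁ * g) = D
    field_simp
  rw [e3]
  exact h1

end Equilibrium

/-! ### Time intervals -/

lemma isOpen_timeIoo (T : EReal) : IsOpen (timeIoo T) := by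
  have h1 : IsOpen {t : ℝ | (t : EReal) < T} :=
    isOpen_lt continuous_coe_real_ereal continuous_const
  exact isOpen_Ioi.inter h1

instance ordConnected_timeIoo (T : EReal) : (timeIoo T).OrdConnected :=
  ⟨fun _ hx _ hy _ hz => ⟨hx.1.trans_le hz.1, (EReal.coe_le_coe_iff.2 hz.2).trans_lt hy.2⟩⟩

lemma Ico_subset_timeIco {T : EReal} {b : ℝ} (hb : (b : EReal) ≤ T) : Ico 0 b ⊆ timeIco T :=
  fun _ ht => ⟨ht.1, (EReal.coe_lt_coe_iff.2 ht.2).trans_le hb⟩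

lemma Ioo_subset_timeIoo {T : EReal} {b : ℝ} (hb : (b : EReal) ≤ T) : Ioo 0 b ⊆ timeIoo T :=
  fun _ ht => ⟨ht.1, (EReal.coe_lt_coe_iff.2 ht.2).trans_le hb⟩

lemma timeIoo_subset_timeIco (T : EReal) : timeIoo T ⊆ timeIco T := fun _ ht => ⟨ht.1.le, ht.2⟩

lemma exists_real_of_mem_timeIco {T : EReal} {t : ℝ} (ht : t ∈ timeIco T) :
    ∃ b : ℝ, t < b ∧ (b : EReal) ≤ T := by
  obtain ⟨b, h1, h2⟩ := EReal.lt_iff_exists_real_btwn.1 ht.2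
  exact ⟨b, EReal.coe_lt_coe_iff.1 h1, h2.le⟩

end Extruder

end

/-! ### Weak solutions of the extruder and classical solutions of the reduced system -/

noncomputable section

namespace Extruder

namespace Equilibrium

variable {p : Params} {e : Equilibrium p} {k₁ k₂ l₀ : ℝ} {f₀ : ℝ → ℝ} {T : EReal}
  {l : ℝ → ℝ} {f : ℝ → ℝ → ℝ} {N Fin : ℝ → ℝ}

lemma deriv_mul_test {ψ χ : ℝ → ℝ} (hψ : Differentiable ℝ ψ) (L M F : ℝ) (t x : ℝ) :
    deriv (fun s => ψ s * χ x) t + deriv (fun y => (M - y * F) / L * (ψ t * χ y)) x =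
      deriv ψ t * χ x + ψ t * deriv (fun y => (M / L - y * (F / L)) * χ y) x := by
  have h1 : (fun y => (M - y * F) / L * (ψ t * χ y)) =
      fun y => ψ t * ((M / L - y * (F / L)) * χ y) := by
    ext y; ring
  rw [h1, deriv_const_mul_field, ((hψ t).hasDerivAt.mul_const (χ x)).deriv]

namespace IsSolutionWith

lemma mem_Ω (h : e.IsSolutionWith k₁ k₂ l₀ f₀ T l f N Fin) (hk : 1 - k₁ * e.b₂ ≠ 0) {t : ℝ}
    (ht : t ∈ timeIco T) : (l t, f t 1) ∈ (e.system k₁ k₂ hk).Ω ∧ N t = e.screw k₁ (l t) ∧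
      Fin t = e.feed k₁ k₂ (l t) := by
  obtain ⟨h1, h2, h3, h4⟩ := h.nondegenerate t ht
  have h5 := (h.feedback t ht).one_sub_ne_zero hk
  exact ⟨⟨h1, h4, h5, h3⟩, (h.feedback t ht).eq_screw h5⟩

/-- Clamping time to a compact [a',b'] in (0,b) around s and t, and space to [0,1], makes all
coefficients globally continuous, as `sub_eq_integral_of_weak_transport` demands, and changes
nothing on the supports of the test functions. -/
lemma f_sub_eq_integral (h : e.IsSolutionWith k₁ k₂ l₀ f₀ T l f N Fin)
    (hk : 1 - k₁ * e.b₂ ≠ 0) {b : ℝ} (hb : (b : EReal) ≤ T) {s t x : ℝ} (hs : s ∈ Ioo 0 b)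
    (ht : t ∈ Ioo 0 b) (hx : x ∈ Icc (0 : ℝ) 1) :
    f t x - f s x = ∫ r in s..t,
      -((e.system k₁ k₂ hk).speed (l r) (f r 1) x * derivWithin (f r) (Icc 0 1) x) := by
  set S := e.system k₁ k₂ hk with hS
  obtain ⟨a', ha0, has, hat⟩ : ∃ a', 0 < a' ∧ a' < s ∧ a' < t :=
    ⟨min s t / 2, half_pos (lt_min hs.1 ht.1),
      (half_lt_self (lt_min hs.1 ht.1)).trans_le (min_le_left _ _),
      (half_lt_self (lt_min hs.1 ht.1)).trans_le (min_le_right _ _)⟩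
  obtain ⟨b', hb1, hb2⟩ := exists_between (max_lt hs.2 ht.2)
  have hsb : s < b' := (le_max_left _ _).trans_lt hb1
  have htb : t < b' := (le_max_right _ _).trans_lt hb1
  have hab : a' ≤ b' := (has.trans hsb).le
  have hsub : Icc a' b' ⊆ Ico 0 b := fun r hr => ⟨ha0.le.trans hr.1, hr.2.trans_lt hb2⟩
  have hsubT : Icc a' b' ⊆ timeIco T := hsub.trans (Ico_subset_timeIco hb)
  set κ : ℝ → ℝ := clampTo a' b' with hκ
  set π : ℝ → ℝ := clampTo 0 1 with hπ
  have hκm : ∀ r, κ r ∈ Icc a' b' := clampTo_mem hab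
  have hπm : ∀ y, π y ∈ Icc (0 : ℝ) 1 := clampTo_mem zero_le_one
  have hκc : Continuous κ := (lipschitzWith_clampTo _ _).continuous
  have hπc : Continuous π := (lipschitzWith_clampTo _ _).continuous
  have hf2 : H2ContinuousOn (timeIco T) f := h.f_mem
  have hl : ContinuousOn l (Icc a' b') := h.l_continuous.mono hsubT
  have hst : ContinuousOn (fun r => (l r, f r 1)) (Icc a' b') :=
    hl.prodMk ((hf2.continuousOn_apply (by simp)).mono hsubT)
  have hn : ContinuousOn (fun r => S.n (l r)) (Icc a' b') := fun r hr =>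
    ContinuousAt.comp_continuousWithinAt (g := S.n) (f := l)
      (S.n_smooth _ (h.mem_Ω hk (hsubT hr)).1).continuousAt (hl r hr)
  have hF : ContinuousOn (fun r => S.F (l r) (f r 1)) (Icc a' b') := fun r hr =>
    ContinuousAt.comp_continuousWithinAt (g := Function.uncurry S.F) (f := fun t => (l t, f t 1))
      (S.F_smooth _ (h.mem_Ω hk (hsubT hr)).1).continuousAt (hst r hr)
  have hl0 : ∀ r ∈ Icc a' b', l r ≠ 0 := fun r hr => (h.mem_Ω hk (hsubT hr)).1.1
  have hpair : Continuous fun z : ℝ × ℝ => (κ z.1, π z.2) := by fun_prop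
  have hmaps : ∀ z : ℝ × ℝ, (κ z.1, π z.2) ∈ timeIco T ×ˢ Icc (0 : ℝ) 1 := fun z =>
    ⟨hsubT (hκm _), hπm _⟩
  have key := sub_eq_integral_of_weak_transport (a := a') (b := b')
    (f := fun r y => f (κ r) (π y)) (g := fun r y => derivWithin (f (κ r)) (Icc 0 1) (π y))
    (c := fun r => S.n (l (κ r)) / l (κ r)) (q := fun r => S.F (l (κ r)) (f (κ r) 1) / l (κ r))
    (hf2.continuousOn_uncurry.comp_continuous hpair hmaps)
    (hf2.continuousOn_derivWithin.comp_continuous hpair hmaps)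
    ((hn.div hl hl0).comp_continuous hκc hκm) ((hF.div hl hl0).comp_continuous hκc hκm)
    (fun r hr => by
      have hr' := Ioo_subset_Icc_self hr
      obtain ⟨w, hw⟩ := (hf2.1 r (hsubT hr')).exists_isH2
      simp only [hκ, clampTo_of_mem hr']
      exact (hw.congr (fun y hy => by rw [hπ, clampTo_of_mem hy])
        fun y hy => by rw [hπ, clampTo_of_mem hy]).hasWeakDerivOn_u)
    (fun ψ χ hψ hψc hψt hχ hχc hχt => by
      have hψd : Differentiable ℝ ψ := hψ.differentiable (by simp)
      have hts : tsupport (fun z : ℝ × ℝ => ψ z.1 * χ z.2) ⊆ tsupport ψ ×ˢ tsupport χ := by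
        refine closure_minimal ?_ ((isClosed_tsupport ψ).prod (isClosed_tsupport χ))
        intro z hz
        exact ⟨subset_tsupport _ (left_ne_zero_of_mul hz),
          subset_tsupport _ (right_ne_zero_of_mul hz)⟩
      have hsubo : Ioo a' b' ⊆ timeIoo T := fun r hr =>
        Ioo_subset_timeIoo hb ⟨ha0.trans hr.1, hr.2.trans hb2⟩
      have h1 := h.transport_eq (fun z => ψ z.1 * χ z.2) (by fun_prop)
        ((hψc.isCompact.prod hχc.isCompact).of_isClosed_subset (isClosed_tsupport _) hts)
        (hts.trans (prod_mono (hψt.trans hsubo) hχt))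
      simp only [Params.transportSpeed] at h1
      simp_rw [deriv_mul_test hψd] at h1
      rw [setIntegral_eq_of_subset_of_forall_sdiff_eq_zero
        ((isOpen_timeIoo T).measurableSet.prod measurableSet_Ioo)
        (prod_mono hsubo Subset.rfl) (by
          rintro z ⟨hz1, hz2⟩
          have hz : z.1 ∉ Ioo a' b' := fun h' => hz2 ⟨h', hz1.2⟩
          rw [eq_zero_of_tsupport_subset hψt hz, deriv_eq_zero_of_tsupport_subset hψt hz]
          simp)] at h1
      refine Eq.trans ?_ h1
      refine setIntegral_congr_fun (s := Ioo a' b' ×ˢ Ioo (0 : ℝ) 1)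
        (measurableSet_Ioo.prod measurableSet_Ioo) fun z hz => ?_
      have hz1 := Ioo_subset_Icc_self hz.1
      simp only [hκ, hπ, clampTo_of_mem hz1, clampTo_of_mem (Ioo_subset_Icc_self hz.2)]
      rw [(h.mem_Ω hk (hsubT hz1)).2.1]
      rfl)
    ⟨has, hsb⟩ ⟨hat, htb⟩ hx
  simp only [hπ, clampTo_of_mem hx] at key
  rw [hκ, clampTo_of_mem ⟨hat.le, htb.le⟩, clampTo_of_mem ⟨has.le, hsb.le⟩] at key
  rw [key, ← intervalIntegral.integral_neg]
  apply intervalIntegral.integral_congr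
  intro r hr
  have hr' : r ∈ Icc a' b' :=
    ordConnected_Icc.uIcc_subset ⟨has.le, hsb.le⟩ ⟨hat.le, htb.le⟩ hr
  simp only [clampTo_of_mem hr', InterfaceSystem.speed]
  ring

/-- Weak solutions are classical solutions of the reduced system. -/
theorem isClassical (h : e.IsSolutionWith k₁ k₂ l₀ f₀ T l f N Fin)
    (hk : 1 - k₁ * e.b₂ ≠ 0) {b : ℝ} (hb : (b : EReal) ≤ T) :
    (e.system k₁ k₂ hk).IsClassical 0 b l f := by
  set S := e.system k₁ k₂ hk with hS
  have hsub : Ico 0 b ⊆ timeIco T := Ico_subset_timeIco hb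
  have hsubo : Ioo 0 b ⊆ timeIoo T := Ioo_subset_timeIoo hb
  have hmem : ∀ t ∈ Ico 0 b, (l t, f t 1) ∈ S.Ω := fun t ht => (h.mem_Ω hk (hsub ht)).1
  have hf2 : H2ContinuousOn (Ico 0 b) f := ⟨fun t ht => h.f_mem.1 t (hsub ht),
    fun t ht => (h.f_mem.2 t (hsub ht)).mono_left (nhdsWithin_mono _ hsub)⟩
  have hl : ContinuousOn l (Ico 0 b) := h.l_continuous.mono hsub
  have hst : ContinuousOn (fun r => (l r, f r 1)) (Ico 0 b) :=
    hl.prodMk (hf2.continuousOn_apply (by simp))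
  have hn : ContinuousOn (fun r => S.n (l r)) (Ico 0 b) := fun r hr =>
    ContinuousAt.comp_continuousWithinAt (g := S.n) (f := l)
      (S.n_smooth _ (hmem r hr)).continuousAt (hl r hr)
  have hβ : ContinuousOn (fun r => S.β (l r)) (Ico 0 b) := fun r hr =>
    ContinuousAt.comp_continuousWithinAt (g := S.β) (f := l)
      (S.β_smooth _ (hmem r hr)).continuousAt (hl r hr)
  have hF : ContinuousOn (fun r => S.F (l r) (f r 1)) (Ico 0 b) := fun r hr =>
    ContinuousAt.comp_continuousWithinAt (g := Function.uncurry S.F) (f := fun t => (l t, f t 1))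
      (S.F_smooth _ (hmem r hr)).continuousAt (hst r hr)
  refine ⟨hmem, fun t ht => ?_, hf2, fun t ht x hx => ?_, ?_⟩
  · refine hasDerivWithinAt_Ici_of_sub_eq_integral hl hF (fun s hs t ht => ?_) ht
    rw [h.interface_eq.eq_primitive (isOpen_timeIoo T)
      (h.l_continuous.mono (timeIoo_subset_timeIco T)) (hsubo hs) (hsubo ht)]
    apply intervalIntegral.integral_congr
    intro r hr
    have hr' : r ∈ Ioo 0 b := ordConnected_Ioo.uIcc_subset hs ht hr
    simp only [(h.mem_Ω hk (hsub (Ioo_subset_Ico_self hr'))).2.1]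
    rfl
  · refine hasDerivWithinAt_Ici_of_sub_eq_integral (u := fun s => f s x)
      (h := fun r => -(S.speed (l r) (f r 1) x * derivWithin (f r) (Icc 0 1) x))
      (hf2.continuousOn_apply hx) ?_ (fun s hs t ht => h.f_sub_eq_integral hk hb hs ht hx) ht
    refine (ContinuousOn.mul ?_ ?_).neg
    · exact (hn.sub (continuousOn_const.mul hF)).div hl fun r hr => (hmem r hr).1
    · exact hf2.continuousOn_derivWithin.comp (f := fun r => (r, x)) (by fun_prop)
        fun r hr => ⟨hr, hx⟩
  · have h1 : EqOn (fun t => f t 0) (fun t => S.β (l t)) (Ioo 0 b) := by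
      intro t ht
      obtain ⟨-, h2, h3⟩ := h.mem_Ω hk (hsub (Ioo_subset_Ico_self ht))
      simp only [h.f_boundary t (hsubo ht), h2, h3]
      rfl
    -- The boundary condition is imposed for t > 0 only; continuity carries it to t = 0.
    have h2 := h1.of_subset_closure (hf2.continuousOn_apply (by simp)) hβ Ioo_subset_Ico_self
      (by
        rcases lt_or_ge 0 b with hb0 | hb0
        · rw [closure_Ioo hb0.ne]; exact Ico_subset_Icc_self
        · simp [Ico_eq_empty (not_lt.2 hb0)])
    exact fun t ht => h2 ht

end IsSolutionWith

/-- Bounded classical solutions of the reduced system are weak solutions. -/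
theorem isSolution_of_isClassical (hk : 1 - k₁ * e.b₂ ≠ 0) (hT : 0 < T) {C : ℝ}
    (h : ∀ b : ℝ, (b : EReal) ≤ T → (e.system k₁ k₂ hk).IsClassical 0 b l f)
    (hC : ∀ t ∈ timeIco T, |l t| ≤ C ∧ |(e.system k₁ k₂ hk).F (l t) (f t 1)| ≤ C)
    (hl : l 0 = l₀) (hf : ∀ x ∈ Icc (0 : ℝ) 1, f 0 x = f₀ x) :
    e.IsSolution k₁ k₂ l₀ f₀ T l f := by
  set S := e.system k₁ k₂ hk with hS
  have hex : ∀ t ∈ timeIco T, ∃ b : ℝ, t ∈ Ico 0 b ∧ S.IsClassical 0 b l f ∧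
      𝓝[timeIco T] t ≤ 𝓝[Ico 0 b] t := by
    intro t ht
    obtain ⟨b, h1, h2⟩ := exists_real_of_mem_timeIco ht
    refine ⟨b, ⟨ht.1, h1⟩, h b h2, ?_⟩
    rw [nhdsWithin_le_iff]
    filter_upwards [self_mem_nhdsWithin, mem_nhdsWithin_of_mem_nhds (Iio_mem_nhds h1)] with s hs hs'
    exact ⟨hs.1, hs'⟩
  have hmem : ∀ t ∈ timeIco T, (l t, f t 1) ∈ S.Ω := fun t ht => by
    obtain ⟨b, h1, h2, -⟩ := hex t ht
    exact h2.mem t h1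
  have hlc : ContinuousOn l (timeIco T) := fun t ht => by
    obtain ⟨b, h1, h2, h3⟩ := hex t ht
    exact (h2.l_continuousOn t h1).mono_left h3
  have hFc : ContinuousOn (fun t => S.F (l t) (f t 1)) (timeIco T) := fun t ht => by
    obtain ⟨b, h1, h2, h3⟩ := hex t ht
    exact (h2.F_continuousOn t h1).mono_left h3
  have hsub := timeIoo_subset_timeIco T
  have hms : MeasurableSet (timeIoo T) := (isOpen_timeIoo T).measurableSet
  have hld : ∀ t ∈ timeIoo T, HasDerivAt l (S.F (l t) (f t 1)) t := fun t ht => by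
    obtain ⟨b, h1, h2, -⟩ := hex t (hsub ht)
    exact (h2.l_deriv t h1).hasDerivAt (Ici_mem_nhds ht.1)
  have hweak : HasWeakDerivOn (timeIoo T) l (fun t => S.F (l t) (f t 1)) := by
    refine hasWeakDerivOn_of_eq_primitive (isOpen_timeIoo T)
      ((hFc.mono hsub).locallyIntegrableOn hms) fun x hx y hy => ?_
    have huI : uIcc x y ⊆ timeIoo T := (ordConnected_timeIoo T).uIcc_subset hx hy
    exact (intervalIntegral.integral_eq_sub_of_hasDerivAt (fun t ht => hld t (huI ht))
      ((hFc.mono (huI.trans hsub)).intervalIntegrable)).symm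
  refine ⟨fun t => e.screw k₁ (l t), fun t => e.feed k₁ k₂ (l t), ?_⟩
  refine
    { l_continuous := hlc
      l_mem := ⟨fun t => S.F (l t) (f t 1), ?_, ?_, hweak⟩
      f_mem := ⟨fun t ht => ?_, fun t ht => ?_⟩
      nondegenerate := fun t ht => ?_
      feedback := fun t ht => feedback_screw (hmem t ht).2.2.1
      interface_eq := hweak
      transport_eq := ?_
      l_initial := hl
      f_initial := hf
      f_boundary := fun t ht => ?_ }
  · refine memLp_top_of_bound ((hlc.mono hsub).aestronglyMeasurable hms) C ?_
    rw [ae_restrict_iff' hms]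
    exact Eventually.of_forall fun t ht => (hC t (hsub ht)).1
  · refine memLp_top_of_bound ((hFc.mono hsub).aestronglyMeasurable hms) C ?_
    rw [ae_restrict_iff' hms]
    exact Eventually.of_forall fun t ht => (hC t (hsub ht)).2
  · obtain ⟨b, h1, h2, -⟩ := hex t ht
    exact h2.f_mem.1 t h1
  · obtain ⟨b, h1, h2, h3⟩ := hex t ht
    exact (h2.f_mem.2 t h1).mono_left h3
  · obtain ⟨h1, h2, h3, h4⟩ := hmem t ht
    exact ⟨h1, screw_ne_zero hk h3, h4, h2⟩
  · intro φ hφ hφc hφt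
    have hne : (timeIoo T).Nonempty := by
      obtain ⟨b, h1, h2⟩ := EReal.lt_iff_exists_real_btwn.1 hT
      exact ⟨b, by exact_mod_cast h1, h2⟩
    -- T may be infinite; the compact support of φ confines the integral to a finite interval on
    -- which the solution is classical.
    obtain ⟨a', b', ha', hb', -, hK, -⟩ := exists_Ioo_of_isCompact (isOpen_timeIoo T) hne
      (hφc.isCompact.image continuous_fst) (by
        rintro _ ⟨z, hz, rfl⟩
        exact (hφt hz).1)
    have hφt' : tsupport φ ⊆ Ioo 0 b' ×ˢ Ioo 0 1 := fun z hz =>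
      ⟨⟨(hφt hz).1.1, (hK ⟨z, hz, rfl⟩).2⟩, (hφt hz).2⟩
    have hloc : ∀ z, z ∉ tsupport φ → ∀ᶠ y in 𝓝 z, φ y = 0 := fun z hz => by
      filter_upwards [(isClosed_tsupport φ).isOpen_compl.mem_nhds hz] with y hy
      exact image_eq_zero_of_notMem_tsupport hy
    rw [setIntegral_eq_integral_of_forall_compl_eq_zero]
    · exact (h b' hb'.2.le).integral_transport_eq_zero hφ hφc hφt'
    · intro z hz
      have hz' : z ∉ tsupport φ := fun h' => hz (hφt h')
      have e1 : (fun s => φ (s, z.2)) =ᶠ[𝓝 z.1] fun _ => 0 :=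
        (by fun_prop : Continuous fun s : ℝ => (s, z.2)).continuousAt.eventually (hloc z hz')
      have e2 : (fun y => p.transportSpeed (l z.1) (e.screw k₁ (l z.1)) (f z.1 1) y *
          φ (z.1, y)) =ᶠ[𝓝 z.2] fun _ => 0 := by
        have := (by fun_prop : Continuous fun y : ℝ => (z.1, y)).continuousAt.eventually
          (hloc z hz')
        filter_upwards [this] with y hy
        rw [hy, mul_zero]
      rw [e1.deriv_eq, e2.deriv_eq]
      simp
  · obtain ⟨b, h1, h2, -⟩ := hex t (hsub ht)
    exact h2.boundary t h1

end Equilibrium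

end Extruder

end

/-! ### Restarting, gluing and continuation -/

noncomputable section

namespace Extruder

lemma MemH2.congr {u u' : ℝ → ℝ} (h : MemH2 u) (hu : ∀ x ∈ Icc (0 : ℝ) 1, u' x = u x) :
    MemH2 u' :=
  (h.exists_isH2.choose_spec.congr hu fun _ _ => rfl).memH2

lemma MemH2.h2NormSq_congr {u u' : ℝ → ℝ} (h : MemH2 u) (hu : ∀ x ∈ Icc (0 : ℝ) 1, u' x = u x) :
    h2NormSq u' = h2NormSq u := by
  obtain ⟨w, hw⟩ := h.exists_isH2
  have hw' := hw.congr hu fun _ _ => rfl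
  rw [hw.h2NormSq_eq, hw'.h2NormSq_eq, setIntegral_congr_fun measurableSet_Ioo (g := fun x => u x ^ 2)
    fun x hx => by simp only [hu x (Ioo_subset_Icc_self hx)]]

namespace InterfaceSystem

variable {S : InterfaceSystem} {a b c t₀ : ℝ} {l l' : ℝ → ℝ} {f f' : ℝ → ℝ → ℝ}

namespace IsClassical

lemma congr (h : S.IsClassical a b l f)
    (hl : ∀ t ∈ Ico a b, l' t = l t) (hf : ∀ t ∈ Ico a b, ∀ x ∈ Icc (0 : ℝ) 1, f' t x = f t x) :
    S.IsClassical a b l' f' := by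
  have hmem1 : ∀ t ∈ Ico a b, f' t 1 = f t 1 := fun t ht => hf t ht 1 (by simp)
  have hev : ∀ t ∈ Ico a b, ∀ᶠ s in 𝓝[Ici a] t, s ∈ Ico a b := fun t ht => by
    filter_upwards [self_mem_nhdsWithin, mem_nhdsWithin_of_mem_nhds (Iio_mem_nhds ht.2)] with s h1 h2
    exact ⟨h1, h2⟩
  refine ⟨fun t ht => ?_, fun t ht => ?_, ⟨fun t ht => ?_, fun t ht => ?_⟩, fun t ht x hx => ?_,
    fun t ht => ?_⟩
  · rw [hl t ht, hmem1 t ht]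
    exact h.mem t ht
  · rw [hl t ht, hmem1 t ht]
    exact (h.l_deriv t ht).congr_of_eventuallyEq ((hev t ht).mono hl) (hl t ht)
  · exact (h.f_mem.1 t ht).congr (hf t ht)
  · refine (h.f_mem.2 t ht).congr' ?_
    filter_upwards [self_mem_nhdsWithin] with s hs
    obtain ⟨w, hw⟩ := h.f_mem.isH2_sub hs ht
    exact (hw.memH2.h2NormSq_congr fun x hx => by rw [hf s hs x hx, hf t ht x hx]).symm
  · rw [hl t ht, hmem1 t ht, derivWithin_congr (hf t ht) (hf t ht x hx)]
    exact (h.f_deriv t ht x hx).congr_of_eventuallyEq ((hev t ht).mono fun s hs => hf s hs x hx)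
      (hf t ht x hx)
  · rw [hl t ht, hf t ht 0 (by simp)]
    exact h.boundary t ht

/-- Two overlapping pieces of a classical solution form a classical solution. -/
lemma union (h : S.IsClassical a c l f) (h' : S.IsClassical t₀ b l f)
    (htc : t₀ < c) : S.IsClassical a b l f := by
  have key : ∀ t ∈ Ico a b, t ∈ Ico a c ∨ t ∈ Ico t₀ b ∧ t₀ < t := fun t ht => by
    rcases lt_or_ge t c with h1 | h1
    · exact Or.inl ⟨ht.1, h1⟩
    · exact Or.inr ⟨⟨(htc.trans_le h1).le, ht.2⟩, htc.trans_le h1⟩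
  refine ⟨fun t ht => ?_, fun t ht => ?_, ⟨fun t ht => ?_, fun t ht => ?_⟩, fun t ht x hx => ?_,
    fun t ht => ?_⟩ <;> rcases key t ht with h1 | ⟨h1, h2⟩
  · exact h.mem t h1
  · exact h'.mem t h1
  · exact h.l_deriv t h1
  · exact ((h'.l_deriv t h1).hasDerivAt (Ici_mem_nhds h2)).hasDerivWithinAt
  · exact h.f_mem.1 t h1
  · exact h'.f_mem.1 t h1
  · refine (h.f_mem.2 t h1).mono_left ?_
    rw [nhdsWithin_le_iff]
    filter_upwards [self_mem_nhdsWithin, mem_nhdsWithin_of_mem_nhds (Iio_mem_nhds h1.2)] with s h3 h4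
    exact ⟨h3.1, h4⟩
  · refine (h'.f_mem.2 t h1).mono_left ?_
    rw [nhdsWithin_le_iff]
    filter_upwards [self_mem_nhdsWithin, mem_nhdsWithin_of_mem_nhds (Ioi_mem_nhds h2)] with s h3 h4
    exact ⟨h4.le, h3.2⟩
  · exact h.f_deriv t h1 x hx
  · exact ((h'.f_deriv t h1 x hx).hasDerivAt (Ici_mem_nhds h2)).hasDerivWithinAt
  · exact h.boundary t h1
  · exact h'.boundary t h1

lemma hasDerivWithinAt_shift {u : ℝ → ℝ} {d a t s : ℝ}
    (h : HasDerivWithinAt u d (Ici a) (t - s)) :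
    HasDerivWithinAt (fun r => u (r - s)) d (Ici (a + s)) t := by
  have h1 : HasDerivWithinAt (fun r : ℝ => r - s) 1 (Ici (a + s)) t :=
    ((hasDerivAt_id t).sub_const s).hasDerivWithinAt
  have h2 := HasDerivWithinAt.comp t h h1 fun r (hr : a + s ≤ r) =>
    show a ≤ r - s by linarith
  rw [mul_one] at h2
  exact h2

/-- The system is autonomous. -/
lemma shift (h : S.IsClassical a b l f) (s : ℝ) :
    S.IsClassical (a + s) (b + s) (fun t => l (t - s)) (fun t => f (t - s)) := by
  have hm : MapsTo (fun t => t - s) (Ico (a + s) (b + s)) (Ico a b) := fun t ht =>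
    ⟨by linarith [ht.1], by linarith [ht.2]⟩
  refine ⟨fun t ht => h.mem _ (hm ht), fun t ht => hasDerivWithinAt_shift (h.l_deriv _ (hm ht)),
    ⟨fun t ht => h.f_mem.1 _ (hm ht), fun t ht => ?_⟩,
    fun t ht x hx => hasDerivWithinAt_shift (u := fun r => f r x) (h.f_deriv _ (hm ht) x hx),
    fun t ht => h.boundary _ (hm ht)⟩
  refine (h.f_mem.2 _ (hm ht)).comp (tendsto_nhdsWithin_iff.2 ⟨?_, ?_⟩)
  · exact ((continuous_id.sub continuous_const).tendsto t).mono_left nhdsWithin_le_nhds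
  · filter_upwards [self_mem_nhdsWithin] with r hr using hm hr

end IsClassical

variable (S) in
/-- The compatibility conditions at the corner `(t,x) = (0,0)`. -/
def CompatibleData (l₀ : ℝ) (f₀ : ℝ → ℝ) : Prop :=
  f₀ 0 = S.β l₀ ∧
    deriv S.β l₀ * S.F l₀ (f₀ 1) + S.n l₀ / l₀ * derivWithin f₀ (Icc 0 1) 0 = 0

/-- A classical solution satisfies the compatibility conditions at all later times. -/
lemma IsClassical.compatibleData (h : S.IsClassical a b l f) {t : ℝ} (ht : t ∈ Ioo a b) :
    S.CompatibleData (l t) (f t) := by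
  have ht' := Ioo_subset_Ico_self ht
  refine ⟨h.boundary t ht', ?_⟩
  have h1 : HasDerivAt (fun s => S.β (l s)) (deriv S.β (l t) * S.F (l t) (f t 1)) t :=
    HasDerivAt.comp t (((S.β_smooth _ (h.mem t ht')).differentiableAt (by norm_num)).hasDerivAt)
      ((h.l_deriv t ht').hasDerivAt (Ici_mem_nhds ht.1))
  have h2 := (h.f_deriv t ht' 0 (by simp)).hasDerivAt (Ici_mem_nhds ht.1)
  have h3 : (fun s => f s 0) =ᶠ[𝓝 t] fun s => S.β (l s) := by
    filter_upwards [Ioo_mem_nhds ht.1 ht.2] with s hs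
    exact h.boundary s (Ioo_subset_Ico_self hs)
  have h4 := h2.unique (h1.congr_of_eventuallyEq h3)
  rw [← h4, speed]
  ring

variable (S) in
/-- `(l, f)` is a classical solution on `[0,b)` with initial data `(l₀, f₀)`, with positive
transport speed and with `l`, `l'` bounded by `C`. -/
structure IsRegular (C l₀ : ℝ) (f₀ : ℝ → ℝ) (b : ℝ) (l : ℝ → ℝ) (f : ℝ → ℝ → ℝ) : Prop where
  isClassical : S.IsClassical 0 b l f
  l_zero : l 0 = l₀
  f_zero : ∀ x ∈ Icc (0 : ℝ) 1, f 0 x = f₀ x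
  good : ∀ t ∈ Ico 0 b, (l t, f t 1) ∈ S.good
  bound : ∀ t ∈ Ico 0 b, |l t| ≤ C ∧ |S.F (l t) (f t 1)| ≤ C

namespace IsRegular

variable {C l₀ : ℝ} {f₀ : ℝ → ℝ}

lemma congr (h : S.IsRegular C l₀ f₀ b l f) (hb : 0 < b) (hl : ∀ t ∈ Ico 0 b, l' t = l t)
    (hf : ∀ t ∈ Ico 0 b, ∀ x ∈ Icc (0 : ℝ) 1, f' t x = f t x) :
    S.IsRegular C l₀ f₀ b l' f' := by
  have h0 : (0 : ℝ) ∈ Ico 0 b := ⟨le_rfl, hb⟩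
  refine ⟨h.isClassical.congr hl hf, (hl 0 h0).trans h.l_zero,
    fun x hx => (hf 0 h0 x hx).trans (h.f_zero x hx), fun t ht => ?_, fun t ht => ?_⟩
  · rw [hl t ht, hf t ht 1 (by simp)]
    exact h.good t ht
  · rw [hl t ht, hf t ht 1 (by simp)]
    exact h.bound t ht

lemma mono (h : S.IsRegular C l₀ f₀ b l f) (hcb : c ≤ b) : S.IsRegular C l₀ f₀ c l f :=
  ⟨h.isClassical.mono le_rfl hcb, h.l_zero, h.f_zero,
    fun t ht => h.good t ⟨ht.1, ht.2.trans_le hcb⟩,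
    fun t ht => h.bound t ⟨ht.1, ht.2.trans_le hcb⟩⟩

/-- A regular solution agrees with every classical solution with the same initial data. -/
lemma unique (h : S.IsRegular C l₀ f₀ b l f) (h' : S.IsClassical 0 c l' f') (hl : l' 0 = l₀)
    (hf : ∀ x ∈ Icc (0 : ℝ) 1, f' 0 x = f₀ x) {t : ℝ} (ht : t ∈ Ico 0 b) (ht' : t < c) :
    l' t = l t ∧ ∀ x ∈ Icc (0 : ℝ) 1, f' t x = f t x := by
  have h1 := h.mono (min_le_left b c)
  exact h1.isClassical.eq_of_good (h'.mono le_rfl (min_le_right b c)) h1.good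
    (hl.trans h.l_zero.symm) (fun x hx => (hf x hx).trans (h.f_zero x hx).symm)
    ⟨ht.1, lt_min ht.2 ht'⟩

/-- Regular solutions on arbitrarily long intervals fit together to a global one. -/
lemma exists_global (h : ∀ b : ℝ, 0 < b → ∃ l f, S.IsRegular C l₀ f₀ b l f) :
    ∃ l f, ∀ b : ℝ, 0 < b → S.IsRegular C l₀ f₀ b l f := by
  choose! u g hu using h
  -- At time t the solution on [0,t+1) is read, an interval that contains t; uniqueness makes the
  -- pieces consistent.
  refine ⟨fun t => u (t + 1) t, fun t => g (t + 1) t, fun b hb => (hu b hb).congr hb ?_ ?_⟩ <;>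
  · intro t ht
    have ht1 : 0 < t + 1 := by linarith [ht.1]
    have := (hu b hb).unique (hu (t + 1) ht1).isClassical (hu _ ht1).l_zero (hu _ ht1).f_zero ht
      (lt_add_one t)
    first | exact this.1 | exact this.2

end IsRegular

variable (S) in
/-- Near `(lₑ, fₑ)`, data satisfying the compatibility conditions launch regular solutions
with a common lifespan `τ` and a common bound `C`. -/
structure UniformlySolvable (lₑ fₑ r τ C : ℝ) : Prop where
  good : ∀ l φ, |l - lₑ| ≤ r → |φ - fₑ| ≤ r → (l, φ) ∈ S.good
  bound : ∀ l φ, |l - lₑ| ≤ r → |φ - fₑ| ≤ r → |l| ≤ C ∧ |S.F l φ| ≤ C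
  exists_isRegular : ∀ l₀ f₀, MemH2 f₀ → |l₀ - lₑ| ≤ r →
    (∀ x ∈ Icc (0 : ℝ) 1, |f₀ x - fₑ| ≤ r) → S.CompatibleData l₀ f₀ →
    ∃ l f, S.IsRegular C l₀ f₀ τ l f

lemma exists_uniformlySolvable {lₑ fₑ : ℝ} (hg : (lₑ, fₑ) ∈ S.good) :
    ∃ r > 0, ∃ τ > 0, ∃ C, S.UniformlySolvable lₑ fₑ r τ C := by
  obtain ⟨r, hr, τ, hτ, C, h1, h2⟩ := S.exists_local hg
  refine ⟨r, hr, τ, hτ, C, fun l φ hl hφ => (h1 l φ hl hφ).1, fun l φ hl hφ => (h1 l φ hl hφ).2,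
    fun l₀ f₀ hf₀ hl hf hc => ?_⟩
  obtain ⟨l, f, h3, h4, h5, h6⟩ := h2 l₀ f₀ hf₀ hl hf hc.1 hc.2
  exact ⟨l, f, h3, h4, h5, fun t ht => (h6 t ht).1, fun t ht => (h6 t ht).2⟩

/-- A classical solution that stays near `(lₑ, fₑ)` extends to a regular one by a fixed time. -/
lemma UniformlySolvable.extend {lₑ fₑ r τ C : ℝ} (hS : S.UniformlySolvable lₑ fₑ r τ C)
    (hτ : 0 < τ) {T l₀ : ℝ} {f₀ : ℝ → ℝ} (hT : 0 < T) (hc : S.CompatibleData l₀ f₀)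
    (hf₀ : MemH2 f₀)
    (h : S.IsClassical 0 T l f) (hl0 : l 0 = l₀) (hf0 : ∀ x ∈ Icc (0 : ℝ) 1, f 0 x = f₀ x)
    (hl : ∀ t ∈ Ico 0 T, |l t - lₑ| ≤ r)
    (hf : ∀ t ∈ Ico 0 T, ∀ x ∈ Icc (0 : ℝ) 1, |f t x - fₑ| ≤ r) :
    ∃ l' f', S.IsRegular C l₀ f₀ (T + τ / 2) l' f' ∧
      ∀ t ∈ Ico 0 T, l t = l' t ∧ ∀ x ∈ Icc (0 : ℝ) 1, f t x = f' t x := by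
  have h0T : (0 : ℝ) ∈ Ico 0 T := ⟨le_rfl, hT⟩
  -- A restart at most τ/2 before T, with lifespan τ, reaches T + τ/2; as t₀ < T, the pieces overlap
  -- on [t₀,T).
  obtain ⟨t₀, ht₀, hTt⟩ : ∃ t₀ ∈ Ico 0 T, T ≤ t₀ + τ / 2 :=
    ⟨max 0 (T - τ / 2), ⟨le_max_left _ _, max_lt hT (by linarith)⟩,
      by linarith [le_max_right 0 (T - τ / 2)]⟩
  obtain ⟨l₁, f₁, h₁⟩ : ∃ l₁ f₁, S.IsRegular C (l t₀) (f t₀) τ l₁ f₁ := by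
    -- `compatibleData` needs a time interior to the interval; at t₀ = 0 the assumed compatibility
    -- of the initial data takes its place.
    rcases ht₀.1.eq_or_lt with h0 | h0
    · obtain ⟨l₁, f₁, h₁⟩ := hS.exists_isRegular l₀ f₀ hf₀ (hl0 ▸ hl 0 h0T)
        (fun x hx => hf0 x hx ▸ hf 0 h0T x hx) hc
      refine ⟨l₁, f₁, h₁.isClassical, ?_, fun x hx => ?_, h₁.good, h₁.bound⟩
      · rw [← h0, hl0, h₁.l_zero]
      · rw [← h0, hf0 x hx, h₁.f_zero x hx]
    · exact hS.exists_isRegular _ _ (h.f_mem.1 t₀ ht₀) (hl t₀ ht₀) (hf t₀ ht₀)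
        (h.compatibleData ⟨h0, ht₀.2⟩)
  have hs : S.IsClassical t₀ (T + τ / 2) (fun t => l₁ (t - t₀)) (fun t => f₁ (t - t₀)) := by
    have := h₁.isClassical.shift t₀
    rw [zero_add] at this
    exact this.mono le_rfl (by linarith)
  have hsol : ∀ t ∈ Ico 0 T, (l t, f t 1) ∈ S.good := fun t ht =>
    hS.good _ _ (hl t ht) (hf t ht 1 (by simp))
  have hag : ∀ t ∈ Ico t₀ T, l₁ (t - t₀) = l t ∧ ∀ x ∈ Icc (0 : ℝ) 1, f₁ (t - t₀) x = f t x :=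
    fun t ht => (h.mono ht₀.1 le_rfl).eq_of_good (hs.mono le_rfl (by linarith))
      (fun s hs' => hsol s ⟨ht₀.1.trans hs'.1, hs'.2⟩) (by simp [h₁.l_zero])
      (fun x hx => by simp [h₁.f_zero x hx]) ht
  set l' : ℝ → ℝ := fun t => if t < T then l t else l₁ (t - t₀) with hl'
  set f' : ℝ → ℝ → ℝ := fun t => if t < T then f t else f₁ (t - t₀) with hf'
  have e1 : ∀ t, t < T → l' t = l t := fun t ht => if_pos ht
  have e2 : ∀ t, t < T → f' t = f t := fun t ht => if_pos ht
  have e3 : ∀ t, T ≤ t → l' t = l₁ (t - t₀) := fun t ht => if_neg (not_lt.2 ht)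
  have e4 : ∀ t, T ≤ t → f' t = f₁ (t - t₀) := fun t ht => if_neg (not_lt.2 ht)
  refine ⟨l', f', ⟨?_, ?_, fun x hx => ?_, fun t ht => ?_, fun t ht => ?_⟩, fun t ht => ?_⟩
  · refine IsClassical.union (c := T) (t₀ := t₀)
      (h.congr (fun t ht => e1 t ht.2) fun t ht x _ => by rw [e2 t ht.2])
      (hs.congr (fun t ht => ?_) fun t ht x hx => ?_) ht₀.2
    · rcases lt_or_ge t T with h1 | h1
      · rw [e1 t h1, (hag t ⟨ht.1, h1⟩).1]
      · exact e3 t h1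
    · rcases lt_or_ge t T with h1 | h1
      · rw [e2 t h1, (hag t ⟨ht.1, h1⟩).2 x hx]
      · rw [e4 t h1]
  · rw [e1 0 hT, hl0]
  · rw [e2 0 hT, hf0 x hx]
  · rcases lt_or_ge t T with h1 | h1
    · rw [e1 t h1, e2 t h1]
      exact hsol t ⟨ht.1, h1⟩
    · rw [e3 t h1, e4 t h1]
      exact h₁.good _ ⟨by linarith [ht₀.2], by linarith [ht.2]⟩
  · rcases lt_or_ge t T with h1 | h1
    · rw [e1 t h1, e2 t h1]
      exact hS.bound _ _ (hl t ⟨ht.1, h1⟩) (hf t ⟨ht.1, h1⟩ 1 (by simp))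
    · rw [e3 t h1, e4 t h1]
      exact h₁.bound _ ⟨by linarith [ht₀.2], by linarith [ht.2]⟩
  · rw [e1 t ht.2, e2 t ht.2]
    exact ⟨rfl, fun _ _ => rfl⟩

end InterfaceSystem

namespace Equilibrium

variable {p : Params} {e : Equilibrium p}

/-- The `H²` ball controls the interface and the filling ratio uniformly. -/
lemma abs_sub_le_of_distSq_le {r l : ℝ} {f : ℝ → ℝ} (hr : 0 ≤ r) (hf : MemH2 f)
    (h : e.distSq l f ≤ r ^ 2 / 2) :
    |l - e.le| ≤ r ∧ ∀ x ∈ Icc (0 : ℝ) 1, |f x - e.fe| ≤ r := by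
  obtain ⟨w, hw⟩ := hf.exists_isH2
  have hu := hw.sub (IsH2.const e.fe)
  have hd : e.distSq l f = |l - e.le| ^ 2 + h2NormSq (fun x => f x - e.fe) := rfl
  have h0 := hu.sq_u_le (x := 0) (by simp)
  have hn : 0 ≤ h2NormSq (fun x => f x - e.fe) := by nlinarith [sq_nonneg (f 0 - e.fe)]
  refine ⟨?_, fun x hx => abs_le_of_sq_le_sq ?_ hr⟩
  · exact abs_le_of_sq_le_sq' (by nlinarith) hr |>.2
  · nlinarith [hu.sq_u_le hx, sq_nonneg |l - e.le|]

end Equilibrium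

end Extruder

end

/-! ### Conclusion for the extruder -/

namespace Extruder.Equilibrium

variable {p : Params} {e : Equilibrium p} {k₁ k₂ l₀ : ℝ} {f₀ : ℝ → ℝ}

lemma isSolution_of_isRegular {hk : 1 - k₁ * e.b₂ ≠ 0} {T : EReal} (hT : 0 < T) {C : ℝ}
    {l : ℝ → ℝ} {f : ℝ → ℝ → ℝ}
    (h : ∀ b : ℝ, 0 < b → (b : EReal) ≤ T → (e.system k₁ k₂ hk).IsRegular C l₀ f₀ b l f) :
    e.IsSolution k₁ k₂ l₀ f₀ T l f := by
  obtain ⟨c, hc, hcT⟩ := EReal.lt_iff_exists_real_btwn.1 hT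
  have hreg := h c (by exact_mod_cast hc) hcT.le
  refine isSolution_of_isClassical hk hT (C := C) (fun b hb => ?_) (fun t ht => ?_) hreg.l_zero
    hreg.f_zero
  · rcases lt_or_ge 0 b with hb0 | hb0
    · exact (h b hb0 hb).isClassical
    · exact hreg.isClassical.mono le_rfl (hb0.trans (by exact_mod_cast hc.le))
  · obtain ⟨b, h1, h2⟩ := exists_real_of_mem_timeIco ht
    exact (h b (ht.1.trans_lt h1) h2).bound t ⟨ht.1, h1⟩

/-- The competitor is a weak and hence a classical solution; its states need not be known to be
good, because uniqueness uses this only for the regular solution. -/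
lemma agreeOn_of_isRegular {hk : 1 - k₁ * e.b₂ ≠ 0} {T T' : EReal} {C : ℝ}
    {l l' : ℝ → ℝ} {f f' : ℝ → ℝ → ℝ}
    (h : ∀ b : ℝ, 0 < b → (b : EReal) ≤ T → (e.system k₁ k₂ hk).IsRegular C l₀ f₀ b l f)
    (hT : T' ≤ T) (h' : e.IsSolution k₁ k₂ l₀ f₀ T' l' f') : AgreeOn T' l' f' l f := by
  intro t ht
  obtain ⟨N, Fin, hs⟩ := h'
  obtain ⟨b, h1, h2⟩ := exists_real_of_mem_timeIco ht
  exact (h b (ht.1.trans_lt h1) (h2.trans hT)).unique (hs.isClassical hk h2) hs.l_initial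
    hs.f_initial ⟨ht.1, h1⟩ h1

end Extruder.Equilibrium

theorem proposition1 (p : Extruder.Params) (e : Extruder.Equilibrium p) (k₁ k₂ : ℝ)
    (hk : 1 - k₁ * e.b₂ ≠ 0) :
    ∃ ε : ℝ, 0 < ε ∧ ∀ (l₀ : ℝ) (f₀ : ℝ → ℝ), Extruder.MemH2 f₀ →
      e.distSq l₀ f₀ ≤ ε → e.Compatible k₁ k₂ l₀ f₀ →
      -- existence and uniqueness on some `[0,T)`, with `T = ∞` if the solution stays in the ball
      (∃ T : EReal, 0 < T ∧ ∃ (l : ℝ → ℝ) (f : ℝ → ℝ → ℝ),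
        e.IsSolution k₁ k₂ l₀ f₀ T l f ∧
        (∀ T' : EReal, 0 < T' → T' ≤ T → ∀ (l' : ℝ → ℝ) (f' : ℝ → ℝ → ℝ),
          e.IsSolution k₁ k₂ l₀ f₀ T' l' f' → Extruder.AgreeOn T' l' f' l f) ∧
        ((∀ t ∈ Extruder.timeIco T, e.distSq (l t) (f t) ≤ ε) → T = ⊤)) ∧
      -- every solution that stays in the ball is global or can be continued
      (∀ T : EReal, 0 < T → ∀ (l : ℝ → ℝ) (f : ℝ → ℝ → ℝ),
        e.IsSolution k₁ k₂ l₀ f₀ T l f →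
        (∀ t ∈ Extruder.timeIco T, e.distSq (l t) (f t) ≤ ε) →
        T = ⊤ ∨ ∃ T' : EReal, T < T' ∧ ∃ (l' : ℝ → ℝ) (f' : ℝ → ℝ → ℝ),
          e.IsSolution k₁ k₂ l₀ f₀ T' l' f' ∧ Extruder.AgreeOn T l f l' f') := by
  set S := e.system k₁ k₂ hk with hSdef
  obtain ⟨r, hr, τ, hτ, C, hS⟩ :=
    Extruder.InterfaceSystem.exists_uniformlySolvable (e.equilibrium_mem_good (k₂ := k₂) hk)
  -- The factor 1/2 absorbs the constant 2 of the Sobolev bound, so the ball lies within distance r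
  -- in l and in sup norm.
  refine ⟨r ^ 2 / 2, by positivity, fun l₀ f₀ hf₀ hd₀ hcomp => ?_⟩
  obtain ⟨hl₀r, hf₀r⟩ := Extruder.Equilibrium.abs_sub_le_of_distSq_le hr.le hf₀ hd₀
  have hc : S.CompatibleData l₀ f₀ :=
    hcomp.reduced hk (hS.good _ _ hl₀r (hf₀r 1 (by simp))).1
  -- solutions in the ball extend by the fixed time `τ / 2`
  have hext : ∀ (T : ℝ) (l : ℝ → ℝ) (f : ℝ → ℝ → ℝ), 0 < T → S.IsClassical 0 T l f → l 0 = l₀ →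
      (∀ x ∈ Icc (0 : ℝ) 1, f 0 x = f₀ x) → (∀ t ∈ Ico 0 T, e.distSq (l t) (f t) ≤ r ^ 2 / 2) →
      ∃ l' f', S.IsRegular C l₀ f₀ (T + τ / 2) l' f' ∧
        ∀ t ∈ Ico 0 T, l t = l' t ∧ ∀ x ∈ Icc (0 : ℝ) 1, f t x = f' t x := by
    intro T l f hT h hl0 hf0 hball
    have hb := fun t ht =>
      Extruder.Equilibrium.abs_sub_le_of_distSq_le hr.le (h.f_mem.1 t ht) (hball t ht)
    exact hS.extend hτ hT hc hf₀ h hl0 hf0 (fun t ht => (hb t ht).1) fun t ht => (hb t ht).2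
  constructor
  · by_cases hall : ∀ (b : ℝ) (l : ℝ → ℝ) (f : ℝ → ℝ → ℝ), 0 < b → S.IsRegular C l₀ f₀ b l f →
        ∀ t ∈ Ico 0 b, e.distSq (l t) (f t) ≤ r ^ 2 / 2
    · have hn : ∀ n : ℕ, ∃ l f, S.IsRegular C l₀ f₀ (τ + n * (τ / 2)) l f := by
        intro n
        induction n with
        | zero =>
          obtain ⟨l, f, h⟩ := hS.exists_isRegular l₀ f₀ hf₀ hl₀r hf₀r hc
          exact ⟨l, f, by simpa using h⟩
        | succ n ih =>
          obtain ⟨l, f, h⟩ := ih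
          have hpos : 0 < τ + n * (τ / 2) := by positivity
          obtain ⟨l', f', h', -⟩ :=
            hext _ l f hpos h.isClassical h.l_zero h.f_zero (hall _ l f hpos h)
          refine ⟨l', f', ?_⟩
          have e1 : τ + ((n + 1 : ℕ) : ℝ) * (τ / 2) = τ + n * (τ / 2) + τ / 2 := by
            push_cast; ring
          rw [e1]
          exact h'
      obtain ⟨l, f, h⟩ : ∃ l f, ∀ b : ℝ, 0 < b → S.IsRegular C l₀ f₀ b l f := by
        refine Extruder.InterfaceSystem.IsRegular.exists_global fun b _ => ?_
        obtain ⟨n, hnb⟩ := exists_nat_gt (b / (τ / 2))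
        obtain ⟨l, f, h⟩ := hn n
        refine ⟨l, f, h.mono ?_⟩
        rw [div_lt_iff₀ (by positivity)] at hnb
        linarith
      exact ⟨⊤, EReal.zero_lt_top, l, f,
        Extruder.Equilibrium.isSolution_of_isRegular EReal.zero_lt_top fun b hb _ => h b hb,
        fun T' _ hT' l' f' h' =>
          Extruder.Equilibrium.agreeOn_of_isRegular (fun b hb _ => h b hb) hT' h',
        fun _ => rfl⟩
    · push Not at hall
      obtain ⟨b, l, f, hb, h, t, ht, hlt⟩ := hall
      have hreg : ∀ c : ℝ, 0 < c → (c : EReal) ≤ b → S.IsRegular C l₀ f₀ c l f :=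
        fun c _ hcb => h.mono (by exact_mod_cast hcb)
      have hb' : (0 : EReal) < b := by exact_mod_cast hb
      refine ⟨b, hb', l, f, Extruder.Equilibrium.isSolution_of_isRegular hb' hreg,
        fun T' _ hT' l' f' h' => Extruder.Equilibrium.agreeOn_of_isRegular hreg hT' h',
        fun hball => ?_⟩
      exact absurd (hball t (Extruder.Ico_subset_timeIco le_rfl ht)) (not_le.2 hlt)
  · rintro T hT l f ⟨N, Fin, h⟩ hball
    induction T with
    | bot => simp at hT
    | top => exact Or.inl rfl
    | coe T =>
      right
      have hT' : 0 < T := by exact_mod_cast hT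
      obtain ⟨l', f', hreg, hag⟩ := hext T l f hT' (h.isClassical hk le_rfl) h.l_initial
        h.f_initial fun t ht => hball t (Extruder.Ico_subset_timeIco le_rfl ht)
      refine ⟨(T + τ / 2 : ℝ), by exact_mod_cast (by linarith : T < T + τ / 2), l', f',
        Extruder.Equilibrium.isSolution_of_isRegular (C := C) (hk := hk) ?_ ?_, ?_⟩
      · exact_mod_cast (by linarith : 0 < T + τ / 2)
      · exact fun b _ hb => hreg.mono (by exact_mod_cast hb)
      · exact fun t ht => hag t ⟨ht.1, by exact_mod_cast ht.2⟩
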